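/- Let $\mathfrak R$ be an associative unital $\mathbb C$-algebra, $n\ge 0$ an integer and $q\in\mathbb C\setminus\{0\}$. Let $E_{ij}$ be the standard $n\times n$ matrices and let $$R(z)=\frac1{z-1}\Bigl((qz-q^{-1})\sum_{i}E_{ii}\otimes E_{ii}+(z-1)\sum_{i\neq j}E_{ii}\otimes E_{jj}+(q-q^{-1})\sum_{i<j}\bigl(z\,E_{ij}\otimes E_{ji}+E_{ji}\otimes E_{ij}\bigr)\Bigr)$$ be the trigonometric $R$-matrix. An $n\times n$ matrix $L(z)$ over $\mathfrak R$ depending on a parameter $z$ is an $L$-operator if $$R(z/w)\,L^{(1)}(z)L^{(2)}(w)=L^{(2)}(w)L^{(1)}(z)\,R(z/w),\qquad L^{(1)}=L\otimes 1,\quad L^{(2)}=1\otimes L.$$ For $n\times n$ matrices put $(A*_qB)_{ik}=\sum_j q^{\mathrm{sgn}(j-i)}A_{ij}B_{jk}$, define the quantum powers by $L^{[0]}(z)=1$, $L^{[m]}(z)=L^{[m-1]}(z)*_qL(q^{2(m-1)}z)$, and set $$I_k(z)=\mathrm{tr}\,L^{[k]}(z).$$ Let $\pi_q$ be the representation of the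 symmetric group $\mathfrak S_k$ on $(\mathbb C^n)^{\otimes k}$ in which the transposition of neighbouring positions acts on the two corresponding tensor factors by $e_i\otimes e_j\mapsto q^{-\mathrm{sgn}(i-j)}e_j\otimes e_i$, let $A^q_k=\frac1{k!}\sum_{\tau\in\mathfrak S_k}(-1)^\tau\pi_q(\tau)$, and let $$t_k(z)=\mathrm{tr}_{1,\dots,k}\bigl(A^q_k\,L^{(1)}(z)L^{(2)}(q^2z)\cdots L^{(k)}(q^{2(k-1)}z)\bigr)$$ be the transfer functions. Then for all integers $k,l\ge1$ $$I_k(z)I_l(w)=I_l(w)I_k(z),\qquad I_k(z)\,t_l(w)=t_l(w)I_k(z)\qquad(\ast)$$ in each of the following settings. 1. *Formal series.* The entries of $L(z)$ lie in $\mathfrak R((z))$, or they all lie in $\mathfrak R((z^{-1}))$, and the $RLL$ relation holds as an identity of formal series in $z,w$ (after multiplication by $z-w$). Then $(\ast)$ holds as an identity of formal series, i.e. all coefficients of $I_k$ commute with all coefficients of $I_l$ and of $t_l$. 2. *Functions.* $L$ is a function on a set $D\subseteq\mathbb C\setminus\{0\}$, and the $RLL$ relation holds for all distinct $z,w\in D$.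 Then $(\ast)$ holds for all $z,w$ with $z,q^2z,\dots,q^{2(k-1)}z\in D$ and $w,q^2w,\dots,q^{2(l-1)}w\in D$, provided that $w\ne q^{2s}z$ for all integers $s$ with $-l\le s\le k$. 3. *Continuous functions.* If, in setting 2, $\mathfrak R$ is moreover a Hausdorff topological ring, $D$ is open and $L$ is continuous on $D$, then $(\ast)$ holds for all $z,w$ with $z,\dots,q^{2(k-1)}z\in D$ and $w,\dots,q^{2(l-1)}w\in D$, without the last proviso. -/

import Mathlib

open scoped Kronecker

namespace QLax

noncomputable section

/-! ### The trigonometric `R`-matrix -/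

/-- The standard matrix `E_{ij}`. -/
def E {n : ℕ} (i j : Fin n) : Matrix (Fin n) (Fin n) ℂ := Matrix.single i j 1

/-- The homogeneous numerator `(u - v) R(u/v)` of the trigonometric `R`-matrix, a matrix acting
on `ℂⁿ ⊗ ℂⁿ` (basis indexed by `Fin n × Fin n`), linear in `(u, v)`. -/
def Rnum (n : ℕ) (q u v : ℂ) : Matrix (Fin n × Fin n) (Fin n × Fin n) ℂ :=
  (q * u - q⁻¹ * v) • ∑ i : Fin n, (E i i ⊗ₖ E i i)
    + (u - v) • ∑ i : Fin n, ∑ j : Fin n, (if i ≠ j then E i i ⊗ₖ E j j else 0)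
    + (q - q⁻¹) • ∑ i : Fin n, ∑ j : Fin n,
        (if i < j then u • (E i j ⊗ₖ E j i) + v • (E j i ⊗ₖ E i j) else 0)

/-- The trigonometric `R`-matrix `R(z)`. -/
def Rmat (n : ℕ) (q z : ℂ) : Matrix (Fin n × Fin n) (Fin n × Fin n) ℂ :=
  (z - 1)⁻¹ • Rnum n q z 1

theorem smul_Rmat_div (n : ℕ) (q u v : ℂ) (hv : v ≠ 0) (huv : u ≠ v) :
    (u - v) • Rmat n q (u / v) = Rnum n q u v := by
  have h1 : u - v ≠ 0 := sub_ne_zero.2 huv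
  have h2 : u / v - 1 = (u - v) / v := by field_simp
  have h3 : (u - v) * (u / v - 1)⁻¹ = v := by
    rw [h2]; field_simp
  rw [Rmat, smul_smul, h3]
  simp only [Rnum, smul_add, smul_smul, Finset.smul_sum, smul_ite, smul_zero]
  have e1 : v * (q * (u / v) - q⁻¹ * 1) = q * u - q⁻¹ * v := by field_simp
  have e2 : v * (u / v - 1) = u - v := by field_simp
  have e3 : v * ((q - q⁻¹) * (u / v)) = (q - q⁻¹) * u := by
    have h4 : v * (u / v) = u := by field_simp
    calc v * ((q - q⁻¹) * (u / v)) = (q - q⁻¹) * (v * (u / v)) := by ring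
      _ = _ := by rw [h4]
  have e4 : v * ((q - q⁻¹) * 1) = (q - q⁻¹) * v := by ring
  simp only [e1, e2, e3, e4]

/-- A complex matrix viewed as a matrix over a `ℂ`-algebra. -/
abbrev scalar (S : Type*) [Ring S] [Algebra ℂ S] {ι κ : Type*} (A : Matrix ι κ ℂ) :
    Matrix ι κ S :=
  A.map (algebraMap ℂ S)

/-! ### The `q`-product, quantum powers -/

section Algebra

variable {S : Type*} [Ring S] [Algebra ℂ S]

/-- The product `(A *_q B)_{ik} = ∑_j q^{sgn(j-i)} A_{ij} B_{jk}`. -/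
def qMul {n : ℕ} (q : ℂ) (A B : Matrix (Fin n) (Fin n) S) : Matrix (Fin n) (Fin n) S :=
  Matrix.of fun i k => ∑ j : Fin n, (q ^ Int.sign ((j : ℤ) - (i : ℤ))) • (A i j * B j k)

/-- `(…((M₀ *_q M₁) *_q M₂) *_q … *_q M_{k-1})`, the identity matrix for `k = 0`.  With
`M_s = L(q^{2s} z)` this is the quantum power `L^{[k]}(z)`. -/
def qPow {n : ℕ} (q : ℂ) (M : ℕ → Matrix (Fin n) (Fin n) S) : ℕ → Matrix (Fin n) (Fin n) S
  | 0 => 1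
  | k + 1 => qMul q (qPow q M k) (M k)

/-- With `M_s = L(q^{2s} z)` this is `I_k(z) = tr L^{[k]}(z)`. -/
def qPowTrace {n : ℕ} (q : ℂ) (M : ℕ → Matrix (Fin n) (Fin n) S) (k : ℕ) : S :=
  (qPow q M k).trace

end Algebra

/-! ### The `q`-antisymmetrizer -/

/-- The scalar `c` with `π_q(τ) e_J = c • e_{J ∘ τ⁻¹}`. -/
def permWeight {n m : ℕ} (q : ℂ) (τ : Equiv.Perm (Fin m)) (J : Fin m → Fin n) : ℂ :=
  ∏ a : Fin m, ∏ b : Fin m,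
    if a < b ∧ τ b < τ a then q ^ (-Int.sign ((J a : ℤ) - (J b : ℤ))) else 1

/-- The representation `π_q` of the symmetric group on `(ℂⁿ)^{⊗ m}` (basis `e_J` indexed by
`J : Fin m → Fin n`).  It is the homomorphism whose value on each adjacent transposition is the
`q`-permutation operator `e_i ⊗ e_j ↦ q^{-sgn(i-j)} e_j ⊗ e_i` of the two adjacent factors;
see `qPerm_mul` and `qPerm_swap` below. -/
def qPerm (n : ℕ) {m : ℕ} (q : ℂ) (τ : Equiv.Perm (Fin m)) :
    Matrix (Fin m → Fin n) (Fin m → Fin n) ℂ :=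
  Matrix.of fun I J => if I = J ∘ τ.symm then permWeight q τ J else 0

/-- The `q`-antisymmetrizer `A^q_m = (1/m!) ∑_τ (-1)^τ π_q(τ)` on `(ℂⁿ)^{⊗ m}`. -/
def qAntisymm (n m : ℕ) (q : ℂ) : Matrix (Fin m → Fin n) (Fin m → Fin n) ℂ :=
  ((m.factorial : ℂ)⁻¹) • ∑ τ : Equiv.Perm (Fin m), ((Equiv.Perm.sign τ : ℤ) : ℂ) • qPerm n q τ

section Legs

variable {S : Type*} [Ring S] [Algebra ℂ S]

/-- `M^{(s)}`: the matrix `M` acting in the `s`-th factor of `(ℂⁿ)^{⊗ m}`. -/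
def leg {n m : ℕ} (s : Fin m) (M : Matrix (Fin n) (Fin n) S) :
    Matrix (Fin m → Fin n) (Fin m → Fin n) S :=
  Matrix.of fun I J => if ∀ r, r ≠ s → I r = J r then M (I s) (J s) else 0

/-- `tr_{1,…,k} (A^q_k M₀^{(1)} M₁^{(2)} ⋯ M_{k-1}^{(k)})`.  With `M_s = L(q^{2s} z)` this is the
transfer function `t_k(z)`. -/
def antisymmTrace {n : ℕ} (q : ℂ) (M : ℕ → Matrix (Fin n) (Fin n) S) (k : ℕ) : S :=
  (scalar S (qAntisymm n k q) * (List.ofFn fun s : Fin k => leg s (M s)).prod).trace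

end Legs

/-! ### `L`-operators whose spectral parameter is a complex number -/

section Functions

variable {S : Type*} [Ring S] [Algebra ℂ S] {n : ℕ}

/-- `R(z/w) L^{(1)}(z) L^{(2)}(w) = L^{(2)}(w) L^{(1)}(z) R(z/w)` for all distinct `z, w ∈ D`. -/
def RLLOn (q : ℂ) (D : Set ℂ) (L : ℂ → Matrix (Fin n) (Fin n) S) : Prop :=
  ∀ z ∈ D, ∀ w ∈ D, z ≠ w →
    scalar S (Rmat n q (z / w)) * (L z ⊗ₖ (1 : Matrix (Fin n) (Fin n) S))
        * ((1 : Matrix (Fin n) (Fin n) S) ⊗ₖ L w)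
      = ((1 : Matrix (Fin n) (Fin n) S) ⊗ₖ L w)
        * (L z ⊗ₖ (1 : Matrix (Fin n) (Fin n) S)) * scalar S (Rmat n q (z / w))

/-- `I_k(z) = tr L^{[k]}(z)`. -/
def I (q : ℂ) (L : ℂ → Matrix (Fin n) (Fin n) S) (k : ℕ) (z : ℂ) : S :=
  qPowTrace q (fun s => L (q ^ (2 * s) * z)) k

/-- `t_k(z) = tr_{1,…,k} (A^q_k L^{(1)}(z) L^{(2)}(q² z) ⋯ L^{(k)}(q^{2(k-1)} z))`. -/
def t (q : ℂ) (L : ℂ → Matrix (Fin n) (Fin n) S) (k : ℕ) (z : ℂ) : S :=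
  antisymmTrace q (fun s => L (q ^ (2 * s) * z)) k

end Functions

/-! ### `L`-operators that are formal Laurent series

The formal variable of `LaurentSeries S` stands for `z ^ ε`, where `ε = 1` or `ε = -1`; so
`ε = 1` gives the series in `S((z))` and `ε = -1` those in `S((z⁻¹))`. -/

section Formal

variable {S : Type*} [Ring S] [Algebra ℂ S] {n : ℕ}

/-- `f(x) ↦ f(c x)`. -/
def scale (c : ℂ) (f : LaurentSeries S) : LaurentSeries S where
  coeff m := c ^ m • f.coeff m
  isPWO_support' := f.isPWO_support.mono fun m hm h => hm (by
    show c ^ m • f.coeff m = 0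
    rw [h, smul_zero])

/-- The coefficient of `z ^ p` in `L(z)`. -/
def zCoeff (ε : ℤˣ) (L : Matrix (Fin n) (Fin n) (LaurentSeries S)) (p : ℤ) :
    Matrix (Fin n) (Fin n) S :=
  L.map fun f => f.coeff ((ε : ℤ) * p)

/-- The coefficient of `z ^ p * w ^ r` in `L^{(1)}(z) L^{(2)}(w)`. -/
def coeff12 (ε : ℤˣ) (L : Matrix (Fin n) (Fin n) (LaurentSeries S)) (p r : ℤ) :
    Matrix (Fin n × Fin n) (Fin n × Fin n) S :=
  (zCoeff ε L p ⊗ₖ (1 : Matrix (Fin n) (Fin n) S))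
    * ((1 : Matrix (Fin n) (Fin n) S) ⊗ₖ zCoeff ε L r)

/-- The coefficient of `z ^ p * w ^ r` in `L^{(2)}(w) L^{(1)}(z)`. -/
def coeff21 (ε : ℤˣ) (L : Matrix (Fin n) (Fin n) (LaurentSeries S)) (p r : ℤ) :
    Matrix (Fin n × Fin n) (Fin n × Fin n) S :=
  ((1 : Matrix (Fin n) (Fin n) S) ⊗ₖ zCoeff ε L r)
    * (zCoeff ε L p ⊗ₖ (1 : Matrix (Fin n) (Fin n) S))

/-- The relation `R(z/w) L^{(1)}(z) L^{(2)}(w) = L^{(2)}(w) L^{(1)}(z) R(z/w)` for formal Laurent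
series, multiplied by `z - w` (a non-zero-divisor here) and read off at each `z ^ p * w ^ r`; note
that `(z - w) R(z/w) = z * Rnum n q 1 0 + w * Rnum n q 0 1`. -/
def RLLFormal (q : ℂ) (ε : ℤˣ) (L : Matrix (Fin n) (Fin n) (LaurentSeries S)) : Prop :=
  ∀ p r : ℤ,
    scalar S (Rnum n q 1 0) * coeff12 ε L (p - 1) r
        + scalar S (Rnum n q 0 1) * coeff12 ε L p (r - 1)
      = coeff21 ε L (p - 1) r * scalar S (Rnum n q 1 0)
        + coeff21 ε L p (r - 1) * scalar S (Rnum n q 0 1)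

/-- The sequence `L(z), L(q² z), L(q⁴ z), …` of matrices of Laurent series in `z ^ ε`. -/
def formalShift (q : ℂ) (ε : ℤˣ) (L : Matrix (Fin n) (Fin n) (LaurentSeries S)) (s : ℕ) :
    Matrix (Fin n) (Fin n) (LaurentSeries S) :=
  L.map (scale ((q ^ (2 * s)) ^ (ε : ℤ)))

/-- The series `I_k(z) = tr L^{[k]}(z)`. -/
def formalI (q : ℂ) (ε : ℤˣ) (L : Matrix (Fin n) (Fin n) (LaurentSeries S)) (k : ℕ) :
    LaurentSeries S :=
  qPowTrace q (formalShift q ε L) k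

/-- The series `t_k(z) = tr_{1,…,k} (A^q_k L^{(1)}(z) L^{(2)}(q² z) ⋯ L^{(k)}(q^{2(k-1)} z))`. -/
def formalT (q : ℂ) (ε : ℤˣ) (L : Matrix (Fin n) (Fin n) (LaurentSeries S)) (k : ℕ) :
    LaurentSeries S :=
  antisymmTrace q (formalShift q ε L) k

end Formal

/-! ### `π_q` is the representation described above -/

section Rep

theorem prod_prod_eq_of_diag {m : ℕ} (F : Fin m → Fin m → ℂ) (hF : ∀ a, F a a = 1) :
    ∏ a, ∏ b, F a b = ∏ a, ∏ b, if a < b then F a b * F b a else 1 := by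
  have h1 : ∏ a, ∏ b, F a b
      = (∏ a, ∏ b, if a < b then F a b else 1) * ∏ a, ∏ b, if b < a then F a b else 1 := by
    simp only [← Finset.prod_mul_distrib]
    refine Finset.prod_congr rfl fun a _ => Finset.prod_congr rfl fun b _ => ?_
    rcases lt_trichotomy a b with h | h | h
    · simp [h, h.not_gt]
    · subst h; simp [hF]
    · simp [h, h.not_gt]
  rw [h1, Finset.prod_comm (f := fun a b => if b < a then F a b else 1)]
  simp only [← Finset.prod_mul_distrib]
  refine Finset.prod_congr rfl fun a _ => Finset.prod_congr rfl fun b _ => ?_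
  split_ifs <;> simp

theorem permWeight_mul {n m : ℕ} {q : ℂ} (hq : q ≠ 0) (σ τ : Equiv.Perm (Fin m))
    (J : Fin m → Fin n) :
    permWeight q (σ * τ) J = permWeight q σ (J ∘ τ.symm) * permWeight q τ J := by
  set g : Fin m → Fin m → ℂ := fun a b => q ^ (-Int.sign ((J a : ℤ) - (J b : ℤ))) with hg
  have hgg : ∀ a b, g a b * g b a = 1 := fun a b => by
    simp only [hg]
    rw [← zpow_add₀ hq, ← neg_sub (J a : ℤ) (J b : ℤ), Int.sign_neg]
    simp
  have hgg' : ∀ a b, 1 = g a b * g b a := fun a b => (hgg a b).symm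
  have h1 : permWeight q σ (J ∘ τ.symm)
      = ∏ a, ∏ b, if τ a < τ b ∧ σ (τ b) < σ (τ a) then g a b else 1 := by
    unfold permWeight
    rw [← Equiv.prod_comp τ]
    refine Finset.prod_congr rfl fun a _ => ?_
    rw [← Equiv.prod_comp τ]
    simp [hg]
  have h2 : permWeight q τ J = ∏ a, ∏ b, if a < b ∧ τ b < τ a then g a b else 1 := rfl
  have h3 : permWeight q (σ * τ) J
      = ∏ a, ∏ b, if a < b ∧ σ (τ b) < σ (τ a) then g a b else 1 := rfl
  rw [h1, h2, h3]
  simp only [← Finset.prod_mul_distrib]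
  rw [prod_prod_eq_of_diag _ (fun a => by simp), prod_prod_eq_of_diag
    (fun a b => (if τ a < τ b ∧ σ (τ b) < σ (τ a) then g a b else 1)
      * if a < b ∧ τ b < τ a then g a b else 1) (fun a => by simp)]
  refine Finset.prod_congr rfl fun a _ => Finset.prod_congr rfl fun b _ => ?_
  by_cases hab : a < b
  · have n1 : τ a ≠ τ b := fun h => hab.ne (τ.injective h)
    have n2 : σ (τ a) ≠ σ (τ b) := fun h => n1 (σ.injective h)
    rcases lt_or_gt_of_ne n1 with h | h <;> rcases lt_or_gt_of_ne n2 with h' | h' <;>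
      simp [hab, hab.not_gt, h, h.not_gt, h', h'.not_gt, hgg, mul_comm]
  · simp [hab]

theorem qPerm_mul (n : ℕ) {m : ℕ} {q : ℂ} (hq : q ≠ 0) (σ τ : Equiv.Perm (Fin m)) :
    qPerm n q (σ * τ) = qPerm n q σ * qPerm n q τ := by
  ext I J
  simp only [qPerm, Matrix.mul_apply, Matrix.of_apply, mul_ite, mul_zero, Finset.sum_ite_eq',
    Finset.mem_univ, if_true]
  rw [permWeight_mul hq]
  have : J ∘ (σ * τ).symm = (J ∘ τ.symm) ∘ σ.symm := by
    ext x; rfl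
  rw [this]
  split_ifs <;> simp

theorem qPerm_swap (n : ℕ) {m : ℕ} (q : ℂ) (a b : Fin m) (hab : (b : ℕ) = a + 1)
    (I J : Fin m → Fin n) :
    qPerm n q (Equiv.swap a b) I J
      = if I = J ∘ Equiv.swap a b then q ^ (-Int.sign ((J a : ℤ) - (J b : ℤ))) else 0 := by
  have hlt : a < b := by rw [Fin.lt_def]; omega
  have key : permWeight q (Equiv.swap a b) J = q ^ (-Int.sign ((J a : ℤ) - (J b : ℤ))) := by
    unfold permWeight
    rw [Finset.prod_eq_single a, Finset.prod_eq_single b]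
    · simp [hlt]
    · intro d _ hd
      refine if_neg ?_
      rintro ⟨h1, h2⟩
      rw [Equiv.swap_apply_left, Equiv.swap_apply_of_ne_of_ne h1.ne' hd] at h2
      rw [Fin.lt_def] at h1 h2
      omega
    · simp
    · intro c _ hc
      refine Finset.prod_eq_one fun d _ => if_neg ?_
      rintro ⟨h1, h2⟩
      have hcv : (c : ℕ) ≠ a := fun h => hc (Fin.ext h)
      rw [Equiv.swap_apply_def, Equiv.swap_apply_def] at h2
      split_ifs at h2 <;> simp only [Fin.lt_def, Fin.ext_iff] at * <;> omega
    · simp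
  simp only [qPerm, Matrix.of_apply, key, Equiv.symm_swap]

end Rep

end

end QLax

open scoped Kronecker

set_option linter.unusedSectionVars false

namespace QLax

noncomputable section

/-! The proof combines fusion of `R`-matrices with quantum Newton identities.

Suppose first that q² ≠ 1. At spectral ratio q⁻² the `R`-matrix degenerates to a multiple of 1 - P,
where P is the q-permutation (`rOp_degenerate`). The RLL relation between neighbouring points z, q²z
therefore lets 1 - P pass through L⁽¹⁾(z)L⁽²⁾(q²z) while reversing the product. Since (1 - P)(1 + P)
= 0, the antisymmetrizer A satisfies A X A = A X for X = L⁽¹⁾(z)L⁽²⁾(q²z)⋯ (`legProd_kill`,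
`altOf_absorb`). By Yang–Baxter the same absorption holds for the fused matrix R, an ordered product
of kl `R`-matrices, and for R⁻¹. Now R intertwines the products 𝓜 and 𝓝 belonging to z and w: R 𝓜 𝓝
= 𝓝 𝓜 R. With A the product of the two antisymmetrizers, tr(A 𝓜 𝓝) = tr(A R⁻¹ 𝓝 𝓜 R) = tr(A 𝓝 𝓜).
Cyclicity is legitimate although the coefficients do not commute, because A R has central entries
(`trace_eq_of_intertwiner`). Hence transfer functions commute (`transfer_commute`).

To pass to I_k, the antisymmetrizer on j + 1 factors is expanded along the cosets of the symmetric
group on j points. Under the trace over all factors but the last, a q-permutation of the last two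
factors becomes the product *_q. This yields k t_k(z) = ∑_{m<k} (-1)^{k+m+1} t_m(z) I_{k-m}(q^{2m}
z) (`newton_identity`). As t_0 = 1, induction writes I_k as a noncommutative polynomial in transfer
functions at shifted points, so commutativity is inherited (`qPowTrace_commute`).

If q² = 1 the degeneration is lost, but the `R`-matrix is diagonal and matrix entries commute up to
signs. The signs cancel in the traces (`qPow_mem_span`, `qPowTrace_commute_of_weights`).

All of this is carried out for two sequences of matrices with spectral parameters in a commutative
algebra K acting on the coefficients (`commute_of_RLL`). Functions use K = ℂ, formal series use the
field of complex Laurent series in two variables, and the continuous case follows by density. -/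

/-! ### Operators on tensor powers with noncommutative coefficients -/

section Operators

variable {T : Type*} [Ring T] {n : ℕ} {ι κ κ' : Type*} [Fintype ι] [DecidableEq ι]
  [Fintype κ] [DecidableEq κ] [Fintype κ'] [DecidableEq κ']

/-- The matrix `X` acting in the tensor factors labelled by the range of `e`. -/
def emb (e : κ → ι) (X : Matrix (κ → Fin n) (κ → Fin n) T) :
    Matrix (ι → Fin n) (ι → Fin n) T :=
  Matrix.of fun I J => if ∀ r, (∀ a, r ≠ e a) → I r = J r then X (I ∘ e) (J ∘ e) else 0

theorem emb_apply (e : κ → ι) (X : Matrix (κ → Fin n) (κ → Fin n) T) (I J : ι → Fin n) :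
    emb e X I J = if ∀ r, (∀ a, r ≠ e a) → I r = J r then X (I ∘ e) (J ∘ e) else 0 := rfl

theorem extend_off (e : κ → ι) (k : κ → Fin n) (I : ι → Fin n) {r : ι} (hr : ∀ a, r ≠ e a) :
    Function.extend e k I r = I r :=
  Function.extend_apply' _ _ _ (by rintro ⟨a, rfl⟩; exact hr a rfl)

/-- Only the intermediate multi-indices that agree with `I` off the range of `e` contribute, and
these are the extensions `Function.extend e k I`. -/
theorem emb_mul_apply {e : κ → ι} (he : e.Injective) (X : Matrix (κ → Fin n) (κ → Fin n) T)
    (Z : Matrix (ι → Fin n) (ι → Fin n) T) (I J : ι → Fin n) :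
    (emb e X * Z) I J = ∑ k : κ → Fin n, X (I ∘ e) k * Z (Function.extend e k I) J := by
  rw [Matrix.mul_apply]
  symm
  refine Finset.sum_of_injOn (fun k => Function.extend e k I) ?_ (by simp) ?_ ?_
  · intro k _ k' _ h
    have h' := congrArg (· ∘ e) h
    simpa only [Function.extend_comp he] using h'
  · intro K _ hK
    rw [emb_apply, if_neg, zero_mul]
    intro h
    apply hK
    refine ⟨K ∘ e, by simp, ?_⟩
    funext r
    by_cases hr : ∃ a, e a = r
    · obtain ⟨a, rfl⟩ := hr
      simp [he.extend_apply]
    · have hr' : ∀ a, r ≠ e a := fun a h => hr ⟨a, h.symm⟩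
      simp only [extend_off e _ I hr', h r hr']
  · intro k _
    rw [emb_apply, if_pos fun r hr => (extend_off e k I hr).symm, Function.extend_comp he]

theorem emb_mul {e : κ → ι} (he : e.Injective) (X Y : Matrix (κ → Fin n) (κ → Fin n) T) :
    emb e (X * Y) = emb e X * emb e Y := by
  ext I J
  rw [emb_mul_apply he, emb_apply, Matrix.mul_apply]
  have h : ∀ k : κ → Fin n, (∀ r, (∀ a, r ≠ e a) → Function.extend e k I r = J r) ↔
      ∀ r, (∀ a, r ≠ e a) → I r = J r := fun k =>
    forall₂_congr fun r hr => by rw [extend_off e k I hr]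
  simp only [emb_apply, h, Function.extend_comp he]
  split_ifs <;> simp

theorem emb_one {e : κ → ι} : emb e (1 : Matrix (κ → Fin n) (κ → Fin n) T) = 1 := by
  ext I J
  rw [emb_apply, Matrix.one_apply, Matrix.one_apply]
  by_cases h : I = J
  · subst h; simp
  · rw [if_neg h]
    split_ifs with h1 h2
    · refine absurd (funext fun r => ?_) h
      by_cases hr : ∃ a, e a = r
      · obtain ⟨a, rfl⟩ := hr
        exact congrFun h2 a
      · exact h1 r fun a h => hr ⟨a, h.symm⟩
    · rfl
    · rfl

theorem emb_add (e : κ → ι) (X Y : Matrix (κ → Fin n) (κ → Fin n) T) :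
    emb e (X + Y) = emb e X + emb e Y := by
  ext I J
  simp only [emb_apply, Matrix.add_apply]
  split_ifs <;> simp

theorem emb_smul {K : Type*} [CommRing K] [Algebra K T] (e : κ → ι) (c : K)
    (X : Matrix (κ → Fin n) (κ → Fin n) T) : emb e (c • X) = c • emb e X := by
  ext I J
  simp only [emb_apply, Matrix.smul_apply]
  split_ifs <;> simp

/-- `emb e` as a homomorphism of rings. -/
def embHom (T : Type*) [Ring T] (n : ℕ) {e : κ → ι} (he : e.Injective) :
    Matrix (κ → Fin n) (κ → Fin n) T →+* Matrix (ι → Fin n) (ι → Fin n) T where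
  toFun := emb e
  map_one' := emb_one
  map_mul' := emb_mul he
  map_zero' := by ext I J; simp [emb_apply]
  map_add' := emb_add e

theorem emb_mul_emb_apply {e : κ → ι} {e' : κ' → ι} (he : e.Injective)
    (hd : ∀ a b, e a ≠ e' b)
    (X : Matrix (κ → Fin n) (κ → Fin n) T) (Y : Matrix (κ' → Fin n) (κ' → Fin n) T)
    (I J : ι → Fin n) :
    (emb e X * emb e' Y) I J =
      if ∀ r, (∀ a, r ≠ e a) → (∀ a, r ≠ e' a) → I r = J r
      then X (I ∘ e) (J ∘ e) * Y (I ∘ e') (J ∘ e') else 0 := by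
  rw [emb_mul_apply he, Finset.sum_eq_single (J ∘ e)]
  · rw [emb_apply]
    have h1 : Function.extend e (J ∘ e) I ∘ e' = I ∘ e' := by
      funext b
      exact extend_off e _ I fun a h => hd a b h.symm
    have h2 : (∀ r, (∀ a, r ≠ e' a) → Function.extend e (J ∘ e) I r = J r) ↔
        ∀ r, (∀ a, r ≠ e a) → (∀ a, r ≠ e' a) → I r = J r := by
      refine forall_congr' fun r => ?_
      by_cases hr : ∃ a, e a = r
      · obtain ⟨a, rfl⟩ := hr
        refine iff_of_true (fun _ => by simp [he.extend_apply]) fun h => absurd rfl (h a)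
      · have hr' : ∀ a, r ≠ e a := fun a h => hr ⟨a, h.symm⟩
        rw [extend_off e _ I hr']
        exact ⟨fun h _ => h, fun h => h hr'⟩
    simp only [h1, h2, mul_ite, mul_zero]
  · intro k _ hk
    rw [emb_apply, if_neg, mul_zero]
    intro h
    refine hk (funext fun a => ?_)
    have := h (e a) fun b => hd a b
    rwa [he.extend_apply] at this
  · simp

/-- Disjoint tensor factors alone are not enough over a noncommutative ring: the entries of the two
matrices get multiplied in opposite orders, so those of `X` are required to be central. -/
theorem emb_commute_emb {e : κ → ι} {e' : κ' → ι} (he : e.Injective) (he' : e'.Injective)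
    (hd : ∀ a b, e a ≠ e' b)
    {X : Matrix (κ → Fin n) (κ → Fin n) T} (hX : ∀ I J t, Commute (X I J) t)
    (Y : Matrix (κ' → Fin n) (κ' → Fin n) T) : Commute (emb e X) (emb e' Y) := by
  ext I J
  rw [emb_mul_emb_apply he hd, emb_mul_emb_apply he' fun a b h => hd b a h.symm]
  have h2 : (∀ r, (∀ a, r ≠ e' a) → (∀ a, r ≠ e a) → I r = J r) ↔
      ∀ r, (∀ a, r ≠ e a) → (∀ a, r ≠ e' a) → I r = J r :=
    forall_congr' fun r => ⟨fun h h1 h2 => h h2 h1, fun h h1 h2 => h h2 h1⟩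
  simp only [h2, (hX _ _ _).eq]

/-- The matrix `A` acting in the tensor factor labelled by `a`. -/
def tleg (a : ι) (A : Matrix (Fin n) (Fin n) T) : Matrix (ι → Fin n) (ι → Fin n) T :=
  Matrix.of fun I J => if ∀ r, r ≠ a → I r = J r then A (I a) (J a) else 0

theorem tleg_apply (a : ι) (A : Matrix (Fin n) (Fin n) T) (I J : ι → Fin n) :
    tleg a A I J = if ∀ r, r ≠ a → I r = J r then A (I a) (J a) else 0 := rfl

theorem leg_eq_tleg {m : ℕ} (s : Fin m) (A : Matrix (Fin n) (Fin n) T) : leg s A = tleg s A := by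
  ext I J
  simp only [leg, tleg_apply, Matrix.of_apply]
  congr

theorem emb_tleg {e : κ → ι} (he : e.Injective) (a : κ) (A : Matrix (Fin n) (Fin n) T) :
    emb e (tleg a A) = tleg (e a) A := by
  ext I J
  simp only [emb_apply, tleg_apply, Function.comp_apply, ← ite_and]
  refine if_congr ⟨fun h r hr => ?_, fun h => ⟨fun r hr => h r (hr a), fun r hr => ?_⟩⟩ rfl rfl
  · by_cases hr' : ∃ b, e b = r
    · obtain ⟨b, rfl⟩ := hr'
      exact h.2 b fun hb => hr (hb ▸ rfl)
    · exact h.1 r fun b hb => hr' ⟨b, hb.symm⟩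
  · exact h _ fun hb => hr (he hb)

theorem tleg_eq_emb (a : ι) (A : Matrix (Fin n) (Fin n) T) :
    tleg a A = emb (fun _ : Unit => a)
      (Matrix.of fun I J : Unit → Fin n => A (I ()) (J ())) := by
  ext I J
  simp [emb_apply, tleg_apply]

theorem tleg_mul_tleg_apply {a b : ι} (hab : a ≠ b) (A B : Matrix (Fin n) (Fin n) T)
    (I J : ι → Fin n) :
    (tleg a A * tleg b B) I J = if ∀ r, r ≠ a → r ≠ b → I r = J r
      then A (I a) (J a) * B (I b) (J b) else 0 := by
  rw [tleg_eq_emb a, tleg_eq_emb b,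
    emb_mul_emb_apply (Function.injective_of_subsingleton _) (fun _ _ => hab)]
  simp

theorem emb_mul_tleg_apply {e : κ → ι} (he : e.Injective) {b : ι} (hb : ∀ a, e a ≠ b)
    (X : Matrix (κ → Fin n) (κ → Fin n) T) (B : Matrix (Fin n) (Fin n) T)
    (I J : ι → Fin n) :
    (emb e X * tleg b B) I J = if ∀ r, (∀ a, r ≠ e a) → r ≠ b → I r = J r
      then X (I ∘ e) (J ∘ e) * B (I b) (J b) else 0 := by
  rw [tleg_eq_emb b, emb_mul_emb_apply he fun a _ => hb a]
  simp

variable {K : Type*} [CommRing K] [Algebra K T]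

/-- The operator acting on functions of `I : ι → Fin n` by
`F ↦ f (I a) (I b) F(I) + g (I a) (I b) F(I ∘ swap a b)`. -/
def sw (T : Type*) [Ring T] [Algebra K T] (a b : ι) (f g : Fin n → Fin n → K) :
    Matrix (ι → Fin n) (ι → Fin n) T :=
  Matrix.of fun I J => (if J = I then algebraMap K T (f (I a) (I b)) else 0)
    + (if J = I ∘ Equiv.swap a b then algebraMap K T (g (I a) (I b)) else 0)

/-- Operator identities are checked below on an arbitrary `X`, where composing operators becomes
substitution into the row index. Taking `X = 1` recovers the identity itself. -/
theorem sw_mul_apply (a b : ι) (f g : Fin n → Fin n → K)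
    (X : Matrix (ι → Fin n) (ι → Fin n) T) (I J : ι → Fin n) :
    (sw T a b f g * X) I J
      = f (I a) (I b) • X I J + g (I a) (I b) • X (I ∘ Equiv.swap a b) J := by
  simp [sw, Matrix.mul_apply, add_mul, Finset.sum_add_distrib, Algebra.smul_def]

theorem comp_swap_swap (a b : ι) (I : ι → Fin n) :
    (I ∘ Equiv.swap a b) ∘ Equiv.swap a b = I := by
  funext r; simp

theorem eq_comp_swap_iff (a b : ι) (I J : ι → Fin n) :
    J = I ∘ Equiv.swap a b ↔ I = J ∘ Equiv.swap a b := by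
  constructor <;> (rintro rfl; rw [comp_swap_swap])

theorem mul_sw_apply (a b : ι) (f g : Fin n → Fin n → K)
    (X : Matrix (ι → Fin n) (ι → Fin n) T) (I J : ι → Fin n) :
    (X * sw T a b f g) I J
      = f (J a) (J b) • X I J + g (J b) (J a) • X I (J ∘ Equiv.swap a b) := by
  simp [sw, Matrix.mul_apply, mul_add, Finset.sum_add_distrib, Algebra.smul_def,
    eq_comp_swap_iff a b _ J, Algebra.commutes]

theorem sw_apply (a b : ι) (f g : Fin n → Fin n → K) (I J : ι → Fin n) :
    sw T a b f g I J = (if J = I then algebraMap K T (f (I a) (I b)) else 0)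
    + (if J = I ∘ Equiv.swap a b then algebraMap K T (g (I a) (I b)) else 0) := rfl

theorem sw_commute_tleg {a b c : ι} (hca : c ≠ a) (hcb : c ≠ b) (f g : Fin n → Fin n → K)
    (A : Matrix (Fin n) (Fin n) T) : Commute (sw T a b f g) (tleg c A) := by
  have hs : Equiv.swap a b c = c := Equiv.swap_apply_of_ne_of_ne hca hcb
  ext I J
  rw [sw_mul_apply, mul_sw_apply]
  congr 1
  · rw [tleg_apply]
    split_ifs with h
    · rw [h a hca.symm, h b hcb.symm]
    · simp
  · simp only [tleg_apply, Function.comp_apply, hs]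
    have : (∀ r, r ≠ c → I (Equiv.swap a b r) = J r) ↔
        ∀ r, r ≠ c → I r = J (Equiv.swap a b r) := by
      constructor
      · intro h r hr
        have := h (Equiv.swap a b r) fun h' => hr (by
          rw [← hs] at h'; exact (Equiv.swap a b).injective h')
        simpa using this
      · intro h r hr
        have := h (Equiv.swap a b r) fun h' => hr (by
          rw [← hs] at h'; exact (Equiv.swap a b).injective h')
        simpa using this
    simp only [this]
    split_ifs with h
    · have h1 := h a hca.symm
      have h2 := h b hcb.symm
      simp only [Equiv.swap_apply_left, Equiv.swap_apply_right] at h1 h2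
      rw [h1, h2]
    · simp

theorem sw_commute_sw {a b c d : ι} (hac : a ≠ c) (had : a ≠ d) (hbc : b ≠ c) (hbd : b ≠ d)
    (f g f' g' : Fin n → Fin n → K) : Commute (sw T a b f g) (sw T c d f' g') := by
  have key : ∀ X : Matrix (ι → Fin n) (ι → Fin n) T,
      sw T a b f g * (sw T c d f' g' * X) = sw T c d f' g' * (sw T a b f g * X) := by
    intro X
    ext I J
    have h : (I ∘ Equiv.swap a b) ∘ Equiv.swap c d = (I ∘ Equiv.swap c d) ∘ Equiv.swap a b := by
      funext r
      simp only [Function.comp_apply, Equiv.swap_apply_def]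
      split_ifs <;> simp_all
    simp only [sw_mul_apply, h, Function.comp_apply, Equiv.swap_apply_of_ne_of_ne hac.symm hbc.symm,
      Equiv.swap_apply_of_ne_of_ne had.symm hbd.symm, Equiv.swap_apply_of_ne_of_ne hac had,
      Equiv.swap_apply_of_ne_of_ne hbc hbd]
    module
  have h := key 1
  rwa [mul_one, mul_one] at h

/-- The relation `R^{(ab)}(u, v) A^{(a)} B^{(b)} = B^{(b)} A^{(a)} R^{(ab)}(u, v)`, entrywise, for
an `R`-matrix with diagonal coefficients `f` and permuting coefficients `g`. -/
def ExchangeRel (f g : Fin n → Fin n → K) (A B : Matrix (Fin n) (Fin n) T) : Prop :=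
  ∀ i j k l, f i k • (A i j * B k l) + g i k • (A k j * B i l)
    = f j l • (B k l * A i j) + g l j • (B k j * A i l)

theorem ExchangeRel.sw_mul {f g : Fin n → Fin n → K} {A B : Matrix (Fin n) (Fin n) T}
    (h : ExchangeRel f g A B) {a b : ι} (hab : a ≠ b) :
    sw T a b f g * (tleg a A * tleg b B) = tleg b B * tleg a A * sw T a b f g := by
  ext I J
  rw [sw_mul_apply, mul_sw_apply]
  simp only [tleg_mul_tleg_apply hab, tleg_mul_tleg_apply hab.symm, Function.comp_apply,
    Equiv.swap_apply_left, Equiv.swap_apply_right]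
  have e0 : (∀ r, r ≠ b → r ≠ a → I r = J r) ↔ ∀ r, r ≠ a → r ≠ b → I r = J r :=
    forall_congr' fun r => ⟨fun h h1 h2 => h h2 h1, fun h h1 h2 => h h2 h1⟩
  have e1 : (∀ r, r ≠ a → r ≠ b → I (Equiv.swap a b r) = J r) ↔
      ∀ r, r ≠ a → r ≠ b → I r = J r :=
    forall₃_congr fun r h1 h2 => by rw [Equiv.swap_apply_of_ne_of_ne h1 h2]
  have e2 : (∀ r, r ≠ b → r ≠ a → I r = J (Equiv.swap a b r)) ↔
      ∀ r, r ≠ a → r ≠ b → I r = J r := by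
    rw [← e0]
    exact forall₃_congr fun r h1 h2 => by rw [Equiv.swap_apply_of_ne_of_ne h2 h1]
  simp only [e0, e1, e2]
  split_ifs
  · exact h _ _ _ _
  · simp

/-! ### The `R`-matrix -/

/-- Diagonal coefficients of `q (u - v) R(u/v)`. -/
def rDiag (q u v : K) (i j : Fin n) : K := if i = j then q ^ 2 * u - v else q * (u - v)

/-- Permuting coefficients of `q (u - v) R(u/v)`. -/
def rPerm (q u v : K) (i j : Fin n) : K :=
  if i < j then (q ^ 2 - 1) * u else if j < i then (q ^ 2 - 1) * v else 0

/-- `q (u - v) R^{(ab)}(u/v)`. -/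
def rOp (T : Type*) [Ring T] [Algebra K T] (n : ℕ) (q : K) (a b : ι) (u v : K) :
    Matrix (ι → Fin n) (ι → Fin n) T :=
  sw T a b (rDiag q u v) (rPerm q u v)

theorem rOp_mul_apply (q : K) (a b : ι) (u v : K) (X : Matrix (ι → Fin n) (ι → Fin n) T)
    (I J : ι → Fin n) :
    (rOp T n q a b u v * X) I J = rDiag q u v (I a) (I b) • X I J
      + rPerm q u v (I a) (I b) • X (I ∘ Equiv.swap a b) J :=
  sw_mul_apply _ _ _ _ _ _ _

theorem comp_swap_of_eq {a b : ι} {I : ι → Fin n} (h : I a = I b) : I ∘ Equiv.swap a b = I := by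
  funext r
  simp only [Function.comp_apply, Equiv.swap_apply_def]
  split_ifs <;> simp_all

/-- Both sides send `I` into its orbit under permutations of the values at `a`, `b`, `c`, so the
identity compares coefficients of at most six entries of `X`, once for each relative order of `I a`,
`I b`, `I c`. -/
theorem rOp_yang_baxter (q u v w : K) {a b c : ι} (hab : a ≠ b) (hac : a ≠ c) (hbc : b ≠ c) :
    SemiconjBy (rOp T n q a b u v) (rOp T n q a c u w * rOp T n q b c v w)
      (rOp T n q b c v w * rOp T n q a c u w) := by
  have key : ∀ X : Matrix (ι → Fin n) (ι → Fin n) T,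
      rOp T n q a b u v * (rOp T n q a c u w * (rOp T n q b c v w * X))
        = rOp T n q b c v w * (rOp T n q a c u w * (rOp T n q a b u v * X)) := by
    intro X
    ext I J
    have e1 : ∀ I : ι → Fin n,
        (I ∘ Equiv.swap a c) ∘ Equiv.swap a b = (I ∘ Equiv.swap a b) ∘ Equiv.swap b c := by
      intro I; funext r
      simp only [Function.comp_apply, Equiv.swap_apply_def]
      split_ifs <;> simp_all
    have e2 : ∀ I : ι → Fin n,
        (I ∘ Equiv.swap a b) ∘ Equiv.swap a c = (I ∘ Equiv.swap b c) ∘ Equiv.swap a b := by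
      intro I; funext r
      simp only [Function.comp_apply, Equiv.swap_apply_def]
      split_ifs <;> simp_all
    have e3 : ∀ I : ι → Fin n,
        (I ∘ Equiv.swap a c) ∘ Equiv.swap b c = (I ∘ Equiv.swap b c) ∘ Equiv.swap a b := by
      intro I; funext r
      simp only [Function.comp_apply, Equiv.swap_apply_def]
      split_ifs <;> simp_all
    have e4 : ∀ I : ι → Fin n,
        (I ∘ Equiv.swap b c) ∘ Equiv.swap a c = (I ∘ Equiv.swap a b) ∘ Equiv.swap b c := by
      intro I; funext r
      simp only [Function.comp_apply, Equiv.swap_apply_def]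
      split_ifs <;> simp_all
    have e5 : ((I ∘ Equiv.swap b c) ∘ Equiv.swap a b) ∘ Equiv.swap b c = I ∘ Equiv.swap a c := by
      rw [← e3, comp_swap_swap]
    have e6 : ((I ∘ Equiv.swap a b) ∘ Equiv.swap b c) ∘ Equiv.swap a b = I ∘ Equiv.swap a c := by
      rw [← e1, comp_swap_swap]
    simp only [rOp_mul_apply, e1, e2, e3, e4, e5, e6, Function.comp_apply,
      Equiv.swap_apply_left, Equiv.swap_apply_right,
      Equiv.swap_apply_of_ne_of_ne hab.symm hbc,
      Equiv.swap_apply_of_ne_of_ne hac.symm hbc.symm, Equiv.swap_apply_of_ne_of_ne hab hac]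
    -- When two of the three values coincide, the six orbit points merge in pairs, and the
    -- coefficients have to be added before they are compared.
    have h12 : I a = I b → X (I ∘ Equiv.swap a b) J = X I J
        ∧ X ((I ∘ Equiv.swap b c) ∘ Equiv.swap a b) J = X (I ∘ Equiv.swap a c) J
        ∧ X ((I ∘ Equiv.swap a b) ∘ Equiv.swap b c) J = X (I ∘ Equiv.swap b c) J := by
      intro h
      rw [← e2, comp_swap_of_eq h]
      exact ⟨rfl, rfl, rfl⟩
    have h23 : I b = I c → X (I ∘ Equiv.swap b c) J = X I J
        ∧ X ((I ∘ Equiv.swap b c) ∘ Equiv.swap a b) J = X (I ∘ Equiv.swap a b) J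
        ∧ X ((I ∘ Equiv.swap a b) ∘ Equiv.swap b c) J = X (I ∘ Equiv.swap a c) J := by
      intro h
      rw [← e4, comp_swap_of_eq h]
      exact ⟨rfl, rfl, rfl⟩
    have h13 : I a = I c → X (I ∘ Equiv.swap a c) J = X I J
        ∧ X ((I ∘ Equiv.swap b c) ∘ Equiv.swap a b) J = X (I ∘ Equiv.swap b c) J
        ∧ X ((I ∘ Equiv.swap a b) ∘ Equiv.swap b c) J = X (I ∘ Equiv.swap a b) J := by
      intro h
      rw [← e3, ← e1, comp_swap_of_eq h]
      exact ⟨rfl, rfl, rfl⟩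
    generalize X I J = x0 at *
    generalize X (I ∘ Equiv.swap a b) J = x1 at *
    generalize X (I ∘ Equiv.swap b c) J = x2 at *
    generalize X (I ∘ Equiv.swap a c) J = x3 at *
    generalize X ((I ∘ Equiv.swap a b) ∘ Equiv.swap b c) J = x4 at *
    generalize X ((I ∘ Equiv.swap b c) ∘ Equiv.swap a b) J = x5 at *
    clear e1 e2 e3 e4 e5 e6
    generalize I a = i at *
    generalize I b = j at *
    generalize I c = k at *
    simp only [rDiag, rPerm]
    rcases lt_trichotomy i j with h1 | h1 | h1 <;> rcases lt_trichotomy j k with h2 | h2 | h2 <;>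
      rcases lt_trichotomy i k with h3 | h3 | h3 <;> first
      | (exfalso; omega)
      | (simp only [h1, h2, h3, h1.ne, h1.ne', h1.not_gt, h2.ne, h2.ne', h2.not_gt, h3.ne, h3.ne',
          h3.not_gt, if_true, if_false]
         module)
      | (obtain ⟨y1, y2, y3⟩ := h12 h1
         obtain ⟨z1, z2, z3⟩ := h23 h2
         subst h1 h2
         simp only [y1, y2, y3, z1, lt_irrefl, if_true, if_false]
         module)
      | (obtain ⟨y1, y2, y3⟩ := h12 h1
         subst h1
         simp only [y1, y2, y3, h2, h2.ne, h2.ne', h2.not_gt, lt_irrefl, if_true, if_false]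
         module)
      | (obtain ⟨y1, y2, y3⟩ := h23 h2
         subst h2
         simp only [y1, y2, y3, h1, h1.ne, h1.ne', h1.not_gt, lt_irrefl, if_true, if_false]
         module)
      | (obtain ⟨y1, y2, y3⟩ := h13 h3
         subst h3
         simp only [y1, y2, y3, h1, h1.ne, h1.ne', h1.not_gt, lt_irrefl, if_true, if_false]
         module)
  have h := key 1
  rw [mul_one, mul_one] at h
  rw [SemiconjBy, h, mul_assoc]

/-- This is unitarity: up to a scalar, the inverse of R₁₂(u/v) is R₂₁(v/u). -/
theorem rOp_isUnit {q u v : K} (h : IsUnit ((q ^ 2 * u - v) * (u - q ^ 2 * v))) (a b : ι) :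
    IsUnit (rOp T n q a b u v) := by
  obtain ⟨f, hf⟩ := h
  -- This is the negative of `rOp` with `a`, `b` exchanged and `u`, `v` exchanged, written out.
  set R' : Matrix (ι → Fin n) (ι → Fin n) T :=
    sw T a b (fun i j => if i = j then u - q ^ 2 * v else q * (u - v))
      (fun i j => - rPerm q u v i j) with hR'
  have h1 : ∀ X, rOp T n q a b u v * (R' * X) = (f : K) • X := by
    intro X
    ext I J
    simp only [hR', rOp_mul_apply, sw_mul_apply, comp_swap_swap, Function.comp_apply,
      Equiv.swap_apply_left, Equiv.swap_apply_right, Matrix.smul_apply, rDiag, rPerm, hf]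
    rcases lt_trichotomy (I a) (I b) with h | h | h
    · simp only [h, h.ne, h.ne', h.not_gt, if_true, if_false]
      module
    · simp only [h, lt_irrefl, if_true, if_false]
      module
    · simp only [h, h.ne, h.ne', h.not_gt, if_true, if_false]
      module
  have h2 : ∀ X, R' * (rOp T n q a b u v * X) = (f : K) • X := by
    intro X
    ext I J
    simp only [hR', rOp_mul_apply, sw_mul_apply, comp_swap_swap, Function.comp_apply,
      Equiv.swap_apply_left, Equiv.swap_apply_right, Matrix.smul_apply, rDiag, rPerm, hf]
    rcases lt_trichotomy (I a) (I b) with h | h | h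
    · simp only [h, h.ne, h.ne', h.not_gt, if_true, if_false]
      module
    · simp only [h, lt_irrefl, if_true, if_false]
      module
    · simp only [h, h.ne, h.ne', h.not_gt, if_true, if_false]
      module
  have h1' := h1 1
  have h2' := h2 1
  rw [mul_one] at h1' h2'
  refine ⟨⟨rOp T n q a b u v, (↑f⁻¹ : K) • R', ?_, ?_⟩, rfl⟩
  · rw [mul_smul_comm, h1', smul_smul, Units.inv_mul, one_smul]
  · rw [smul_mul_assoc, h2', smul_smul, Units.inv_mul, one_smul]

variable [Algebra ℂ T]

/-- The `q`-permutation of the tensor factors `a` and `b`. -/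
def pOp (T : Type*) [Ring T] [Algebra ℂ T] (n : ℕ) (q : ℂ) (a b : ι) :
    Matrix (ι → Fin n) (ι → Fin n) T :=
  sw T a b (fun _ _ => (0 : ℂ)) (fun i j => q ^ Int.sign ((i : ℤ) - (j : ℤ)))

theorem pOp_mul_apply (q : ℂ) (a b : ι) (X : Matrix (ι → Fin n) (ι → Fin n) T)
    (I J : ι → Fin n) :
    (pOp T n q a b * X) I J
      = q ^ Int.sign ((I a : ℤ) - (I b : ℤ)) • X (I ∘ Equiv.swap a b) J := by
  rw [pOp, sw_mul_apply, zero_smul, zero_add]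

theorem pOp_mul_self {q : ℂ} (hq : q ≠ 0) (a b : ι) : pOp T n q a b * pOp T n q a b = 1 := by
  have h : ∀ X, pOp T n q a b * (pOp T n q a b * X) = X := by
    intro X
    ext I J
    rw [pOp_mul_apply, pOp_mul_apply, comp_swap_swap, smul_smul, ← zpow_add₀ hq]
    simp only [Function.comp_apply, Equiv.swap_apply_left, Equiv.swap_apply_right]
    rw [← neg_sub (I a : ℤ) (I b : ℤ), Int.sign_neg]
    simp
  simpa using h 1

/-- At v = q²u the coefficient of equal indices vanishes, and the remaining ones share the factor
q(1 - q²)u. This is the source of every antisymmetry below. -/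
theorem rOp_degenerate [Algebra ℂ K] [IsScalarTower ℂ K T] {q : ℂ} (hq : q ≠ 0) (a b : ι)
    (u : K) :
    rOp T n (algebraMap ℂ K q) a b u (algebraMap ℂ K q ^ 2 * u)
      = (u * algebraMap ℂ K (q * (1 - q ^ 2))) • (1 - pOp T n q a b) := by
  have hQ : algebraMap ℂ K q * algebraMap ℂ K q⁻¹ = 1 := by
    rw [← map_mul, mul_inv_cancel₀ hq, map_one]
  have hz : ∀ (c : ℂ) (x : T), c • x = algebraMap ℂ K c • x :=
    fun c x => (algebraMap_smul K c x).symm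
  have key : ∀ X, rOp T n (algebraMap ℂ K q) a b u (algebraMap ℂ K q ^ 2 * u) * X
      = ((u * algebraMap ℂ K (q * (1 - q ^ 2))) • (1 - pOp T n q a b)) * X := by
    intro X
    ext I J
    rw [smul_mul_assoc, sub_mul, one_mul]
    simp only [rOp_mul_apply, Matrix.smul_apply, Matrix.sub_apply, pOp_mul_apply,
      rDiag, rPerm, hz, smul_sub, smul_smul]
    simp only [map_mul, map_sub, map_one, map_pow]
    rcases lt_trichotomy (I a) (I b) with h | h | h
    · have hs : Int.sign ((I a : ℤ) - (I b : ℤ)) = -1 :=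
        Int.sign_eq_neg_one_of_neg (by have := Fin.lt_def.1 h; omega)
      have hc : u * (algebraMap ℂ K q * (1 - algebraMap ℂ K q ^ 2)) * algebraMap ℂ K q⁻¹
          = u * (1 - algebraMap ℂ K q ^ 2) := by
        linear_combination u * (1 - algebraMap ℂ K q ^ 2) * hQ
      simp only [hs, zpow_neg, zpow_one, hc, h, h.ne, if_true, if_false]
      module
    · rw [comp_swap_of_eq h]
      simp only [h, sub_self, Int.sign_zero, zpow_zero, map_one, lt_irrefl, if_true, if_false]
      module
    · have hs : Int.sign ((I a : ℤ) - (I b : ℤ)) = 1 :=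
        Int.sign_eq_one_of_pos (by have := Fin.lt_def.1 h; omega)
      simp only [hs, zpow_one, h, h.ne', h.not_gt, if_true, if_false]
      module
  simpa using key 1

end Operators

/-! ### Antisymmetrizers of representations of symmetric groups -/

section Alternating

variable {A : Type*} [Ring A] [Algebra ℂ A] {k : ℕ}

/-- The image of the normalized antisymmetrizer under a representation of the symmetric group. -/
def altOf (ρ : Equiv.Perm (Fin k) →* A) : A :=
  ((k.factorial : ℂ)⁻¹) • ∑ τ : Equiv.Perm (Fin k), ((Equiv.Perm.sign τ : ℤ) : ℂ) • ρ τ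

theorem sign_mul_sign (σ : Equiv.Perm (Fin k)) :
    ((Equiv.Perm.sign σ : ℤ) : ℂ) * ((Equiv.Perm.sign σ : ℤ) : ℂ) = 1 := by
  rw [← Int.cast_mul, ← Units.val_mul, Int.units_mul_self]; simp

theorem altOf_mul (ρ : Equiv.Perm (Fin k) →* A) (σ : Equiv.Perm (Fin k)) :
    altOf ρ * ρ σ = ((Equiv.Perm.sign σ : ℤ) : ℂ) • altOf ρ := by
  rw [altOf, smul_mul_assoc, smul_comm _ (k.factorial : ℂ)⁻¹, Finset.sum_mul]
  congr 1
  rw [Finset.smul_sum]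
  refine Fintype.sum_equiv (Equiv.mulRight σ) _ _ fun τ => ?_
  rw [Equiv.coe_mulRight, map_mul, map_mul, smul_mul_assoc, smul_smul, Units.val_mul, Int.cast_mul,
    mul_comm, mul_assoc, sign_mul_sign, mul_one]

theorem mul_altOf (ρ : Equiv.Perm (Fin k) →* A) (σ : Equiv.Perm (Fin k)) :
    ρ σ * altOf ρ = ((Equiv.Perm.sign σ : ℤ) : ℂ) • altOf ρ := by
  rw [altOf, mul_smul_comm, smul_comm _ (k.factorial : ℂ)⁻¹, Finset.mul_sum]
  congr 1
  rw [Finset.smul_sum]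
  refine Fintype.sum_equiv (Equiv.mulLeft σ) _ _ fun τ => ?_
  rw [Equiv.coe_mulLeft, map_mul, map_mul, mul_smul_comm, smul_smul, Units.val_mul, Int.cast_mul,
    ← mul_assoc, sign_mul_sign, one_mul]

theorem mul_altOf_eq (ρ : Equiv.Perm (Fin k) →* A) {Y : A}
    (h : ∀ σ, Y * ρ σ = ((Equiv.Perm.sign σ : ℤ) : ℂ) • Y) : Y * altOf ρ = Y := by
  rw [altOf, mul_smul_comm, Finset.mul_sum]
  simp only [mul_smul_comm, h, smul_smul, sign_mul_sign, one_smul]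
  rw [Finset.sum_const, Finset.card_univ, Fintype.card_perm, Fintype.card_fin,
    ← Nat.cast_smul_eq_nsmul ℂ, smul_smul, inv_mul_cancel₀, one_smul]
  exact_mod_cast k.factorial_ne_zero

theorem altOf_mul_self (ρ : Equiv.Perm (Fin k) →* A) : altOf ρ * altOf ρ = altOf ρ :=
  mul_altOf_eq ρ (altOf_mul ρ)

/-- Adjacent transpositions generate the symmetric group, and each of them is odd. -/
theorem mul_rep_of_adjacent (ρ : Equiv.Perm (Fin k) →* A) {Y : A}
    (h : ∀ a b : Fin k, (b : ℕ) = a + 1 → Y * ρ (Equiv.swap a b) = -Y) (σ : Equiv.Perm (Fin k)) :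
    Y * ρ σ = ((Equiv.Perm.sign σ : ℤ) : ℂ) • Y := by
  cases k with
  | zero => rw [Subsingleton.elim σ 1]; simp
  | succ k =>
    have hσ : σ ∈ Submonoid.closure
        (Set.range fun i : Fin k => Equiv.swap i.castSucc i.succ) := by
      rw [Equiv.Perm.mclosure_swap_castSucc_succ]; trivial
    induction hσ using Submonoid.closure_induction with
    | mem x hx =>
      obtain ⟨i, rfl⟩ := hx
      rw [h _ _ (by simp), Equiv.Perm.sign_swap (by simp [Fin.ext_iff])]
      simp
    | one => simp
    | mul x y _ _ hx hy =>
      rw [map_mul, ← mul_assoc, hx, smul_mul_assoc, hy, smul_smul, map_mul, Units.val_mul,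
        Int.cast_mul]

/-- For an adjacent transposition s the antisymmetrizer A equals A(1 - ρ(s))/2, so the hypothesis
gives A X (1 + ρ(s)) = 0. The matrix A X thus changes sign under each s from the right. -/
theorem altOf_mul_rep (ρ : Equiv.Perm (Fin k) →* A) {X : A}
    (h : ∀ a b : Fin k, (b : ℕ) = a + 1 →
      (1 - ρ (Equiv.swap a b)) * X * (1 + ρ (Equiv.swap a b)) = 0) (σ : Equiv.Perm (Fin k)) :
    altOf ρ * X * ρ σ = ((Equiv.Perm.sign σ : ℤ) : ℂ) • (altOf ρ * X) := by
  refine mul_rep_of_adjacent ρ (fun a b hab => ?_) σ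
  have hne : a ≠ b := by rintro rfl; omega
  have h1 : altOf ρ * ρ (Equiv.swap a b) = - altOf ρ := by
    rw [altOf_mul, Equiv.Perm.sign_swap hne]; simp
  have h2 : altOf ρ * (1 - ρ (Equiv.swap a b)) = (2 : ℂ) • altOf ρ := by
    rw [mul_sub, h1, mul_one, two_smul, sub_neg_eq_add]
  have h3 := congrArg (altOf ρ * ·) (h a b hab)
  simp only [mul_zero, ← mul_assoc, h2, smul_mul_assoc, mul_add, mul_one] at h3
  rw [← smul_add, two_smul ℂ, ← two_smul ℂ] at h3
  have h4 := congrArg ((2 : ℂ)⁻¹ • ·) h3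
  simp only [smul_zero, smul_smul, inv_mul_cancel₀ (two_ne_zero (α := ℂ)), one_smul] at h4
  exact eq_neg_of_add_eq_zero_right h4

theorem altOf_absorb (ρ : Equiv.Perm (Fin k) →* A) {X : A}
    (h : ∀ a b : Fin k, (b : ℕ) = a + 1 →
      (1 - ρ (Equiv.swap a b)) * X * (1 + ρ (Equiv.swap a b)) = 0) :
    altOf ρ * X * altOf ρ = altOf ρ * X :=
  mul_altOf_eq ρ (altOf_mul_rep ρ h)

end Alternating

/-! ### Ordered products -/

section Products

variable {A : Type*} [Ring A] {β : Type*} [DecidableEq β]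

/-- `p x = y p` for a unit `y`. -/
def Transports (p x : A) : Prop := ∃ y, IsUnit y ∧ SemiconjBy p x y

theorem Transports.mul {p x x' : A} (h : Transports p x) (h' : Transports p x') :
    Transports p (x * x') := by
  obtain ⟨y, hy, hp⟩ := h
  obtain ⟨y', hy', hp'⟩ := h'
  exact ⟨y * y', hy.mul hy', hp.mul_right hp'⟩

theorem Transports.of_commute {p x : A} (hx : IsUnit x) (h : Commute p x) : Transports p x :=
  ⟨x, hx, h⟩

theorem Transports.list_prod {p : A} {l : List A} (h : ∀ x ∈ l, Transports p x) :
    Transports p l.prod := by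
  induction l with
  | nil => exact .of_commute isUnit_one (Commute.one_right p)
  | cons x l ih =>
    rw [List.prod_cons]
    exact (h x (by simp)).mul (ih fun y hy => h y (by simp [hy]))

theorem Transports.kill {p r x : A} (hr : p * r = 0) (h : Transports p x) : p * x * r = 0 := by
  obtain ⟨y, -, hy⟩ := h
  rw [hy.eq, mul_assoc, hr, mul_zero]

/-- Here the invertibility of `y` is needed: p x = y p turns into p x⁻¹ = y⁻¹ p. -/
theorem Transports.kill_inv {p r : A} {x : Aˣ} (hr : p * r = 0) (h : Transports p (x : A)) :
    p * ↑x⁻¹ * r = 0 := by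
  obtain ⟨_, ⟨y, rfl⟩, hy⟩ := h
  rw [hy.units_inv_right.eq, mul_assoc, hr, mul_zero]

theorem isUnit_list_prod {l : List A} (h : ∀ x ∈ l, IsUnit x) : IsUnit l.prod := by
  induction l with
  | nil => exact isUnit_one
  | cons x l ih =>
    rw [List.prod_cons]
    exact (h x (by simp)).mul (ih fun y hy => h y (by simp [hy]))

theorem commute_list_prod {x : A} {l : List A} (h : ∀ y ∈ l, Commute x y) :
    Commute x l.prod := by
  induction l with
  | nil => exact Commute.one_right x
  | cons y l ih =>
    rw [List.prod_cons]
    exact (h y (by simp)).mul_right (ih fun z hz => h z (by simp [hz]))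

/-- Moving an element through an ordered product. -/
theorem exchange_list_prod {m : A} {r x : β → A} (l : List β) (hl : l.Nodup)
    (h : ∀ b ∈ l, r b * m * x b = x b * m * r b)
    (hc : ∀ b ∈ l, ∀ c ∈ l, b ≠ c → Commute (r b) (x c)) :
    (l.map r).reverse.prod * m * (l.map x).prod
      = (l.map x).prod * m * (l.map r).reverse.prod := by
  induction l with
  | nil => simp
  | cons b l ih =>
    rw [List.nodup_cons] at hl
    have h1 := ih hl.2 (fun c hc => h c (by simp [hc]))
      (fun c hc' d hd => hc c (by simp [hc']) d (by simp [hd]))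
    have h2 : Commute (l.map r).reverse.prod (x b) := by
      refine (commute_list_prod fun y hy => ?_).symm
      rw [List.mem_reverse, List.mem_map] at hy
      obtain ⟨c, hc', rfl⟩ := hy
      exact (hc c (by simp [hc']) b (by simp) (by rintro rfl; exact hl.1 hc')).symm
    have h3 : Commute (r b) (l.map x).prod := by
      refine commute_list_prod fun y hy => ?_
      rw [List.mem_map] at hy
      obtain ⟨c, hc', rfl⟩ := hy
      exact hc b (by simp) c (by simp [hc']) (by rintro rfl; exact hl.1 hc')
    simp only [List.map_cons, List.reverse_cons, List.prod_append, List.prod_cons, List.prod_nil,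
      mul_one]
    calc (l.map r).reverse.prod * r b * m * (x b * (l.map x).prod)
        = (l.map r).reverse.prod * (r b * m * x b) * (l.map x).prod := by noncomm_ring
      _ = (l.map r).reverse.prod * x b * m * (r b * (l.map x).prod) := by
          rw [h b (by simp)]; noncomm_ring
      _ = x b * ((l.map r).reverse.prod * m * (l.map x).prod) * r b := by
          rw [h2.eq, h3.eq]; noncomm_ring
      _ = _ := by rw [h1]; noncomm_ring

/-- Interleaving two ordered products. -/
theorem list_prod_mul_list_prod {f g : β → A} (l : List β) (hl : l.Nodup)
    (hc : ∀ b ∈ l, ∀ c ∈ l, b ≠ c → Commute (f b) (g c)) :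
    (l.map f).prod * (l.map g).prod = (l.map fun b => f b * g b).prod := by
  induction l with
  | nil => simp
  | cons b l ih =>
    rw [List.nodup_cons] at hl
    have h1 := ih hl.2 (fun c hc' d hd => hc c (by simp [hc']) d (by simp [hd]))
    have h2 : Commute (l.map f).prod (g b) := by
      refine (commute_list_prod fun y hy => ?_).symm
      rw [List.mem_map] at hy
      obtain ⟨c, hc', rfl⟩ := hy
      exact (hc c (by simp [hc']) b (by simp) (by rintro rfl; exact hl.1 hc')).symm
    simp only [List.map_cons, List.prod_cons]
    rw [← h1]
    calc f b * (l.map f).prod * (g b * (l.map g).prod)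
        = f b * ((l.map f).prod * g b) * (l.map g).prod := by noncomm_ring
      _ = _ := by rw [h2.eq]; noncomm_ring

/-- Isolates two neighbouring factors of an ordered product; all other factors will commute with the
operator that is moved through. -/
theorem finRange_eq_append {k : ℕ} {a b : Fin k} (hab : (b : ℕ) = a + 1) :
    ∃ l₁ l₂ : List (Fin k), List.finRange k = l₁ ++ a :: b :: l₂ ∧
      ∀ c ∈ l₁ ++ l₂, c ≠ a ∧ c ≠ b := by
  have hb := b.2
  have h : List.finRange k = (List.finRange k).take a
      ++ a :: b :: (List.finRange k).drop (a + 2) := by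
    conv_lhs => rw [← List.take_append_drop a (List.finRange k)]
    congr 1
    rw [List.drop_eq_getElem_cons (by simp), List.drop_eq_getElem_cons (by simp; omega)]
    congr 1
    · simp
    · congr 1
      simp [Fin.ext_iff, hab]
  refine ⟨_, _, h, fun c hc => ?_⟩
  have hn := List.nodup_finRange k
  rw [h] at hn
  have hn' := (List.perm_append_comm (l₁ := (List.finRange k).take a)
    (l₂ := a :: b :: (List.finRange k).drop (a + 2))).nodup_iff.1 hn
  simp only [List.cons_append, List.nodup_cons, List.mem_cons, List.mem_append, not_or] at hn'
  rw [List.mem_append] at hc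
  refine ⟨?_, ?_⟩ <;> rintro rfl <;> tauto

end Products

/-! ### Moving an operator through an ordered product with two distinguished neighbouring factors -/

section SplitProducts

variable {A : Type*} [Ring A] {k : ℕ} {f : Fin k → A} {p : A} {a b : Fin k}

theorem exists_semiconjBy_prod (hab : (b : ℕ) = a + 1)
    (hc : ∀ c, c ≠ a → c ≠ b → Commute p (f c)) (h : ∃ y, SemiconjBy p (f a * f b) y) :
    ∃ y, SemiconjBy p ((List.finRange k).map f).prod y := by
  obtain ⟨l₁, l₂, hl, hn⟩ := finRange_eq_append hab
  obtain ⟨y, hy⟩ := h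
  have h1 : Commute p (l₁.map f).prod := commute_list_prod fun z hz => by
    obtain ⟨c, hc', rfl⟩ := List.mem_map.1 hz
    have := hn c (by simp [hc'])
    exact hc c this.1 this.2
  have h2 : Commute p (l₂.map f).prod := commute_list_prod fun z hz => by
    obtain ⟨c, hc', rfl⟩ := List.mem_map.1 hz
    have := hn c (by simp [hc'])
    exact hc c this.1 this.2
  rw [hl]
  simp only [List.map_append, List.prod_append, List.map_cons, List.prod_cons]
  rw [← mul_assoc (f a)]
  exact ⟨_, SemiconjBy.mul_right h1 (hy.mul_right h2)⟩

theorem transports_prod (hab : (b : ℕ) = a + 1) (hf : ∀ c, IsUnit (f c))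
    (hc : ∀ c, c ≠ a → c ≠ b → Commute p (f c)) (h : Transports p (f a * f b)) :
    Transports p ((List.finRange k).map f).prod := by
  obtain ⟨l₁, l₂, hl, hn⟩ := finRange_eq_append hab
  rw [hl]
  simp only [List.map_append, List.prod_append, List.map_cons, List.prod_cons]
  rw [← mul_assoc (f a)]
  refine (Transports.list_prod fun z hz => ?_).mul (h.mul (Transports.list_prod fun z hz => ?_))
  all_goals
    obtain ⟨c, hc', rfl⟩ := List.mem_map.1 hz
    have := hn c (by simp [hc'])
    exact .of_commute (hf c) (hc c this.1 this.2)

theorem transports_reverse_prod (hab : (b : ℕ) = a + 1) (hf : ∀ c, IsUnit (f c))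
    (hc : ∀ c, c ≠ a → c ≠ b → Commute p (f c)) (h : Transports p (f b * f a)) :
    Transports p ((List.finRange k).map f).reverse.prod := by
  obtain ⟨l₁, l₂, hl, hn⟩ := finRange_eq_append hab
  rw [hl]
  simp only [List.map_append, List.prod_append, List.map_cons, List.reverse_append,
    List.reverse_cons, List.prod_cons, List.prod_nil, mul_one]
  rw [mul_assoc _ (f b)]
  refine ((Transports.list_prod fun z hz => ?_).mul h).mul (Transports.list_prod fun z hz => ?_)
  all_goals
    obtain ⟨c, hc', rfl⟩ := List.mem_map.1 (List.mem_reverse.1 hz)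
    have := hn c (by simp [hc'])
    exact .of_commute (hf c) (hc c this.1 this.2)

theorem semiconjBy_list_prod {β : Type*} {x : A} {f g : β → A} (l : List β)
    (h : ∀ b ∈ l, SemiconjBy x (f b) (g b)) : SemiconjBy x (l.map f).prod (l.map g).prod := by
  induction l with
  | nil => exact SemiconjBy.one_right x
  | cons b l ih =>
    simp only [List.map_cons, List.prod_cons]
    exact (h b (by simp)).mul_right (ih fun c hc => h c (by simp [hc]))

end SplitProducts

/-! ### Matrices with central entries -/

section Central

variable {T : Type*} [Ring T] {I : Type*} [Fintype I] [DecidableEq I]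

/-- All entries of the matrix are central. -/
def CentralEntries (X : Matrix I I T) : Prop := ∀ i j t, Commute (X i j) t

theorem CentralEntries.mul {X Y : Matrix I I T} (hX : CentralEntries X) (hY : CentralEntries Y) :
    CentralEntries (X * Y) := by
  intro i j t
  rw [Matrix.mul_apply]
  exact Commute.sum_left _ _ _ fun k _ => (hX i k t).mul_left (hY k j t)

theorem CentralEntries.list_prod {l : List (Matrix I I T)} (h : ∀ X ∈ l, CentralEntries X) :
    CentralEntries l.prod := by
  induction l with
  | nil =>
    intro i j t
    rw [List.prod_nil, Matrix.one_apply]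
    split_ifs
    · exact Commute.one_left t
    · exact Commute.zero_left t
  | cons x l ih =>
    rw [List.prod_cons]
    exact (h x (by simp)).mul (ih fun y hy => h y (by simp [hy]))

theorem CentralEntries.trace_mul_comm {X : Matrix I I T} (hX : CentralEntries X)
    (Y : Matrix I I T) : (X * Y).trace = (Y * X).trace := by
  simp only [Matrix.trace, Matrix.diag_apply, Matrix.mul_apply]
  rw [Finset.sum_comm]
  simp only [(hX _ _ _).eq]

theorem centralEntries_scalar [Algebra ℂ T] (X : Matrix I I ℂ) : CentralEntries (scalar T X) :=
  fun _ _ t => Algebra.commutes _ t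

/-- If `a` absorbs on the right whatever stands behind `r`, `r⁻¹` and `y`, and `r` intertwines
`x` and `y`, then `a x` and `a y` have the same trace. -/
theorem trace_eq_of_intertwiner {a x y : Matrix I I T} {r : (Matrix I I T)ˣ}
    (ha : a * a = a) (hc : CentralEntries (a * (r : Matrix I I T)))
    (hr : a * r * a = a * r) (hri : a * (r⁻¹).val * a = a * (r⁻¹).val) (hy : a * y * a = a * y)
    (h : r * x = y * r) : (a * x).trace = (a * y).trace := by
  have h1 : x = (r⁻¹).val * (y * r) := by rw [← h, Units.inv_mul_cancel_left]
  have h2 : a * x = a * (r⁻¹).val * a * y * (a * r) := by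
    rw [h1]
    calc a * ((r⁻¹).val * (y * r)) = a * (r⁻¹).val * (y * r) := by noncomm_ring
      _ = a * (r⁻¹).val * a * (y * r) := by rw [hri]
      _ = a * (r⁻¹).val * (a * y) * r := by noncomm_ring
      _ = a * (r⁻¹).val * (a * y * a) * r := by rw [hy]
      _ = _ := by noncomm_ring
  -- The last factor `a * r` has central entries, so it may be brought to the front under the trace.
  rw [h2, ← hc.trace_mul_comm]
  have h3 : a * r * (a * (r⁻¹).val * a * y) = a * y := by
    calc a * r * (a * (r⁻¹).val * a * y) = a * r * a * (r⁻¹).val * (a * y) := by noncomm_ring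
      _ = a * (r * (r⁻¹).val) * (a * y) := by rw [hr]; noncomm_ring
      _ = a * a * y := by rw [Units.mul_inv]; noncomm_ring
      _ = a * y := by rw [ha]
  rw [h3]

end Central

/-! ### The `q`-permutation representation on some of the tensor factors -/

section Representation

variable {T : Type*} [Ring T] [Algebra ℂ T] {n : ℕ} {ι : Type*} [Fintype ι] [DecidableEq ι]
  {k : ℕ}

/-- The representation `π_q` acting in the tensor factors labelled by the range of `e`. -/
def repOp (T : Type*) [Ring T] [Algebra ℂ T] (n : ℕ) {q : ℂ} (hq : q ≠ 0) {e : Fin k → ι}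
    (he : e.Injective) :
    Equiv.Perm (Fin k) →* Matrix (ι → Fin n) (ι → Fin n) T where
  toFun τ := emb e (scalar T (qPerm n q τ))
  map_one' := by
    have h : qPerm n q (1 : Equiv.Perm (Fin k)) = 1 := by
      ext I J
      have : permWeight q (1 : Equiv.Perm (Fin k)) J = 1 :=
        Finset.prod_eq_one fun a _ => Finset.prod_eq_one fun b _ =>
          if_neg fun h => h.1.not_gt h.2
      simp only [qPerm, Matrix.of_apply, this, Matrix.one_apply]
      rfl
    rw [h, scalar, Matrix.map_one _ (map_zero _) (map_one _), emb_one]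
  map_mul' σ τ := by
    rw [qPerm_mul n hq, scalar, Matrix.map_mul, emb_mul he]

theorem repOp_apply {q : ℂ} (hq : q ≠ 0) {e : Fin k → ι} (he : e.Injective)
    (τ : Equiv.Perm (Fin k)) : repOp T n hq he τ = emb e (scalar T (qPerm n q τ)) := rfl

theorem repOp_swap {q : ℂ} (hq : q ≠ 0) {e : Fin k → ι} (he : e.Injective) {a b : Fin k}
    (hab : (b : ℕ) = a + 1) : repOp T n hq he (Equiv.swap a b) = pOp T n q (e a) (e b) := by
  ext I J
  rw [repOp_apply, emb_apply, pOp, sw_apply, map_zero, ite_self, zero_add]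
  simp only [scalar, Matrix.map_apply, qPerm_swap n q a b hab]
  have h : (J = I ∘ Equiv.swap (e a) (e b)) ↔ (∀ r, (∀ a, r ≠ e a) → I r = J r) ∧
      I ∘ e = (J ∘ e) ∘ Equiv.swap a b := by
    have hsw : ∀ c, Equiv.swap (e a) (e b) (e c) = e (Equiv.swap a b c) := fun c => by
      simp only [Equiv.swap_apply_def, he.eq_iff]
      split_ifs <;> rfl
    rw [eq_comp_swap_iff]
    constructor
    · rintro rfl
      refine ⟨fun r hr => ?_, ?_⟩
      · rw [Function.comp_apply, Equiv.swap_apply_of_ne_of_ne (hr a) (hr b)]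
      · funext c
        simp only [Function.comp_apply, hsw]
    · rintro ⟨h1, h2⟩
      funext r
      by_cases hr : ∃ c, e c = r
      · obtain ⟨c, rfl⟩ := hr
        simpa only [Function.comp_apply, hsw] using congrFun h2 c
      · have hr' : ∀ a, r ≠ e a := fun a h => hr ⟨a, h.symm⟩
        rw [Function.comp_apply, Equiv.swap_apply_of_ne_of_ne (hr' a) (hr' b), h1 r hr']
  simp only [h, ite_and]
  split_ifs with h1 h2
  · have e1 := congrFun h2 a
    have e2 := congrFun h2 b
    simp only [Function.comp_apply, Equiv.swap_apply_left, Equiv.swap_apply_right] at e1 e2 ⊢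
    -- The weight in `qPerm` is read off the column index and that in `pOp` off the row index. The
    -- two indices differ by the swap, which accounts for the opposite sign in the exponent.
    rw [e1, e2, ← Int.sign_neg, neg_sub]
  · exact map_zero _
  · rfl

theorem emb_scalar_qAntisymm {q : ℂ} (hq : q ≠ 0) {e : Fin k → ι} (he : e.Injective) :
    emb e (scalar T (qAntisymm n k q)) = altOf (repOp T n hq he) := by
  have hs : ∀ (c : ℂ) (X : Matrix (Fin k → Fin n) (Fin k → Fin n) ℂ),
      scalar T (c • X) = c • scalar T X := fun c X => by
    ext I J
    change algebraMap ℂ T (c * X I J) = c • algebraMap ℂ T (X I J)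
    rw [map_mul, Algebra.smul_def]
  rw [qAntisymm, hs, emb_smul, altOf]
  congr 1
  have h : scalar T (∑ τ : Equiv.Perm (Fin k), ((Equiv.Perm.sign τ : ℤ) : ℂ) • qPerm n q τ)
      = ∑ τ : Equiv.Perm (Fin k), ((Equiv.Perm.sign τ : ℤ) : ℂ) • scalar T (qPerm n q τ) := by
    simp only [← hs]
    exact map_sum (AddMonoidHom.mapMatrix (algebraMap ℂ T : ℂ →+ T)) _ _
  rw [h]
  change embHom T n he _ = _
  rw [map_sum]
  exact Finset.sum_congr rfl fun τ _ => emb_smul _ _ _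

theorem CentralEntries.emb {κ : Type*} [Fintype κ] [DecidableEq κ]
    {X : Matrix (κ → Fin n) (κ → Fin n) T} (hX : CentralEntries X) (e : κ → ι) :
    CentralEntries (emb e X) := by
  intro I J t
  rw [emb_apply]
  split_ifs
  · exact hX _ _ _
  · exact Commute.zero_left t

theorem centralEntries_sw {K : Type*} [CommRing K] [Algebra K T] (a b : ι)
    (f g : Fin n → Fin n → K) : CentralEntries (sw T a b f g) := by
  intro I J t
  rw [sw_apply]
  refine Commute.add_left ?_ ?_ <;> split_ifs <;>
    first | exact Algebra.commutes _ _ | exact Commute.zero_left t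

theorem one_sub_mul_one_add {q : ℂ} (hq : q ≠ 0) (a b : ι) :
    (1 - pOp T n q a b) * (1 + pOp T n q a b) = 0 := by
  rw [sub_mul, mul_add, mul_add, pOp_mul_self hq, one_mul, mul_one, one_mul]
  abel

/-- `M₀^{(1)} ⋯ M_{k-1}^{(k)}` in the tensor factors labelled by `e`. -/
def legProd (e : Fin k → ι) (M : ℕ → Matrix (Fin n) (Fin n) T) :
    Matrix (ι → Fin n) (ι → Fin n) T :=
  ((List.finRange k).map fun s => tleg (e s) (M s)).prod

theorem emb_legProd {e : Fin k → ι} (he : e.Injective) (M : ℕ → Matrix (Fin n) (Fin n) T) :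
    emb e (legProd id M) = legProd e M := by
  change embHom T n he _ = _
  rw [legProd, legProd, map_list_prod, List.map_map]
  congr 2
  funext s
  exact emb_tleg he s (M s)

theorem antisymmTrace_eq (q : ℂ) (M : ℕ → Matrix (Fin n) (Fin n) T) (k : ℕ) :
    antisymmTrace q M k = (scalar T (qAntisymm n k q) * legProd (id : Fin k → Fin k) M).trace := by
  rw [antisymmTrace, legProd, List.ofFn_eq_map]
  simp only [leg_eq_tleg, id]

variable {l : ℕ}

/-- The order of the two embedded operators is the order in which their coefficients are multiplied,
so the two products of traces correspond to two different traces over the k + l factors. -/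
theorem trace_emb_inl_mul_emb_inr (X : Matrix (Fin k → Fin n) (Fin k → Fin n) T)
    (Y : Matrix (Fin l → Fin n) (Fin l → Fin n) T) :
    (emb (Sum.inl : Fin k → Fin k ⊕ Fin l) X * emb Sum.inr Y).trace = X.trace * Y.trace := by
  simp only [Matrix.trace, Matrix.diag_apply,
    emb_mul_emb_apply Sum.inl_injective (fun a b => Sum.inl_ne_inr)]
  rw [Finset.sum_mul_sum, ← Fintype.sum_prod_type']
  refine Fintype.sum_equiv (Equiv.sumArrowEquivProdArrow (Fin k) (Fin l) (Fin n)) _ _ fun I => ?_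
  rw [if_pos fun _ _ _ => trivial]
  rfl

theorem trace_emb_inr_mul_emb_inl (X : Matrix (Fin k → Fin n) (Fin k → Fin n) T)
    (Y : Matrix (Fin l → Fin n) (Fin l → Fin n) T) :
    (emb (Sum.inr : Fin l → Fin k ⊕ Fin l) Y * emb Sum.inl X).trace = Y.trace * X.trace := by
  simp only [Matrix.trace, Matrix.diag_apply,
    emb_mul_emb_apply Sum.inr_injective (fun a b => Sum.inr_ne_inl)]
  rw [Finset.sum_mul_sum, Finset.sum_comm, ← Fintype.sum_prod_type']
  refine Fintype.sum_equiv (Equiv.sumArrowEquivProdArrow (Fin k) (Fin l) (Fin n)) _ _ fun I => ?_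
  rw [if_pos fun _ _ _ => trivial]
  rfl

end Representation

/-! ### Transfer functions commute -/

section Transfer

variable {T : Type*} [Ring T] [Algebra ℂ T] {n : ℕ} {ι : Type*} [Fintype ι] [DecidableEq ι]
  {K : Type*} [CommRing K] [Algebra K T] [Algebra ℂ K] [IsScalarTower ℂ K T] {k l : ℕ} {q : ℂ}

/-- The exchange relation with the `R`-matrix at spectral parameters `u`, `v`. -/
abbrev RLL (q u v : K) (A B : Matrix (Fin n) (Fin n) T) : Prop :=
  ExchangeRel (rDiag q u v) (rPerm q u v) A B

theorem isUnit_degenerate (hq : q ≠ 0) (hq2 : q ^ 2 ≠ 1) {u : K} (hu : IsUnit u) :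
    IsUnit (u * algebraMap ℂ K (q * (1 - q ^ 2))) :=
  hu.mul ((IsUnit.mk0 _ (mul_ne_zero hq (sub_ne_zero.2 hq2.symm))).map _)

/-- The scalar in `rOp_degenerate` is a unit when q² ≠ 1, so it can be divided out of any
intertwining relation of the degenerate `R`-matrix. -/
theorem semiconjBy_one_sub_pOp (hq : q ≠ 0) (hq2 : q ^ 2 ≠ 1) {u : K} (hu : IsUnit u)
    {a b : ι} {X Y : Matrix (ι → Fin n) (ι → Fin n) T}
    (h : SemiconjBy (rOp T n (algebraMap ℂ K q) a b u (algebraMap ℂ K q ^ 2 * u)) X Y) :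
    SemiconjBy (1 - pOp T n q a b) X Y := by
  obtain ⟨c, hc⟩ := isUnit_degenerate (K := K) hq hq2 hu
  rw [rOp_degenerate hq, ← hc] at h
  have h1 := congrArg ((↑c⁻¹ : K) • ·) h.eq
  simp only [smul_mul_assoc, mul_smul_comm, smul_smul, Units.inv_mul, one_smul] at h1
  exact h1

theorem one_commute_pOp_sub {a b : ι} {X : Matrix (ι → Fin n) (ι → Fin n) T}
    (h : Commute (pOp T n q a b) X) : Commute (1 - pOp T n q a b) X :=
  (Commute.one_left X).sub_left h

theorem pOp_commute_tleg {a b c : ι} (hca : c ≠ a) (hcb : c ≠ b)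
    (A : Matrix (Fin n) (Fin n) T) : Commute (1 - pOp T n q a b) (tleg c A) :=
  one_commute_pOp_sub (sw_commute_tleg hca hcb _ _ A)

theorem pOp_commute_rOp {a b c d : ι} (hac : a ≠ c) (had : a ≠ d) (hbc : b ≠ c) (hbd : b ≠ d)
    (Q u v : K) : Commute (1 - pOp T n q a b) (rOp T n Q c d u v) := by
  refine one_commute_pOp_sub ?_
  -- The q-permutation has coefficients in ℂ and `rOp` has coefficients in `K`; `sw_commute_sw`
  -- needs both over the same ring.
  have h : ∀ f g : Fin n → Fin n → ℂ, sw T a b f g = sw T a b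
      (fun i j => algebraMap ℂ K (f i j)) (fun i j => algebraMap ℂ K (g i j)) := by
    intro f g
    ext I J
    simp only [sw_apply, ← IsScalarTower.algebraMap_apply]
  rw [pOp, h, rOp]
  exact sw_commute_sw hac had hbc hbd _ _ _ _

/-- The parameters at neighbouring places `a`, `b` have ratio q⁻², so the RLL relation there is a
relation for 1 - P; the other factors act elsewhere and commute with it. -/
theorem exists_semiconjBy_legProd (hq : q ≠ 0) (hq2 : q ^ 2 ≠ 1) {e : Fin k → ι}
    (he : e.Injective) {M : ℕ → Matrix (Fin n) (Fin n) T} {u : ℕ → K}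
    (hu0 : ∀ i < k, IsUnit (u i))
    (hu : ∀ i, i + 1 < k → u (i + 1) = algebraMap ℂ K q ^ 2 * u i)
    (hM : ∀ i, i + 1 < k → RLL (algebraMap ℂ K q) (u i) (u (i + 1)) (M i) (M (i + 1)))
    {a b : Fin k} (hab : (b : ℕ) = a + 1) :
    ∃ y, SemiconjBy (1 - pOp T n q (e a) (e b)) (legProd e M) y := by
  have hb := b.2
  refine exists_semiconjBy_prod hab
    (fun c hca hcb => pOp_commute_tleg (he.ne hca) (he.ne hcb) _)
    ⟨tleg (e b) (M b) * tleg (e a) (M a), ?_⟩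
  refine semiconjBy_one_sub_pOp hq hq2 (hu0 a a.2) ?_
  have h := hM a (by omega)
  rw [hu a (by omega), ← hab] at h
  exact h.sw_mul (he.ne (by rintro rfl; omega))

theorem legProd_kill (hq : q ≠ 0) (hq2 : q ^ 2 ≠ 1) {e : Fin k → ι}
    (he : e.Injective) {M : ℕ → Matrix (Fin n) (Fin n) T} {u : ℕ → K}
    (hu0 : ∀ i < k, IsUnit (u i))
    (hu : ∀ i, i + 1 < k → u (i + 1) = algebraMap ℂ K q ^ 2 * u i)
    (hM : ∀ i, i + 1 < k → RLL (algebraMap ℂ K q) (u i) (u (i + 1)) (M i) (M (i + 1)))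
    (a b : Fin k) (hab : (b : ℕ) = a + 1) :
    (1 - repOp T n hq he (Equiv.swap a b)) * legProd e M
      * (1 + repOp T n hq he (Equiv.swap a b)) = 0 := by
  obtain ⟨y, hy⟩ := exists_semiconjBy_legProd hq hq2 he hu0 hu hM hab
  rw [repOp_swap hq he hab, hy.eq, mul_assoc, one_sub_mul_one_add hq, mul_zero]

/-- `R^{(a l)}(u, v_{l-1}) ⋯ R^{(a 1)}(u, v_0)`, where the first leg `a` is one of the first `k`
tensor factors and the second legs are the last `l` tensor factors. -/
def fusedRow (T : Type*) [Ring T] [Algebra K T] (n k l : ℕ) (q : K) (u : K) (v : ℕ → K)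
    (a : Fin k) : Matrix (Fin k ⊕ Fin l → Fin n) (Fin k ⊕ Fin l → Fin n) T :=
  ((List.finRange l).map fun b : Fin l => rOp T n q (Sum.inl a) (Sum.inr b) u (v b)).reverse.prod

/-- The fused `R`-matrix intertwining `k` and `l` tensor factors. -/
def fusedR (T : Type*) [Ring T] [Algebra K T] (n k l : ℕ) (q : K) (u v : ℕ → K) :
    Matrix (Fin k ⊕ Fin l → Fin n) (Fin k ⊕ Fin l → Fin n) T :=
  ((List.finRange k).map fun a : Fin k => fusedRow T n k l q (u a) v a).prod

/-! ### Invertibility, exchange and antisymmetry of the fused `R`-matrix -/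

section Fused

variable {Q : K} {u v : ℕ → K}

theorem fusedRow_isUnit {u : K} (hR : ∀ j < l, IsUnit ((Q ^ 2 * u - v j) * (u - Q ^ 2 * v j)))
    (a : Fin k) : IsUnit (fusedRow T n k l Q u v a) :=
  isUnit_list_prod fun z hz => by
    obtain ⟨b, -, rfl⟩ := List.mem_map.1 (List.mem_reverse.1 hz)
    exact rOp_isUnit (hR b b.2) _ _

theorem fusedR_isUnit (hR : ∀ i < k, ∀ j < l,
    IsUnit ((Q ^ 2 * u i - v j) * (u i - Q ^ 2 * v j))) : IsUnit (fusedR T n k l Q u v) :=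
  isUnit_list_prod fun z hz => by
    obtain ⟨a, -, rfl⟩ := List.mem_map.1 hz
    exact fusedRow_isUnit (hR a a.2) a

theorem fusedR_centralEntries : CentralEntries (fusedR T n k l Q u v) := by
  refine CentralEntries.list_prod fun z hz => ?_
  obtain ⟨a, -, rfl⟩ := List.mem_map.1 hz
  refine CentralEntries.list_prod fun z hz => ?_
  obtain ⟨b, -, rfl⟩ := List.mem_map.1 (List.mem_reverse.1 hz)
  exact centralEntries_sw _ _ _ _

theorem fusedRow_commute_tleg {a c : Fin k} (hac : a ≠ c) (u : K)
    (A : Matrix (Fin n) (Fin n) T) :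
    Commute (fusedRow T n k l Q u v a) (tleg (Sum.inl c) A) :=
  (commute_list_prod fun z hz => by
    obtain ⟨b, -, rfl⟩ := List.mem_map.1 (List.mem_reverse.1 hz)
    exact (sw_commute_tleg (Sum.inl_injective.ne hac.symm) Sum.inl_ne_inr _ _ _).symm).symm

theorem fusedRow_mul {u : K} {A : Matrix (Fin n) (Fin n) T} {N : ℕ → Matrix (Fin n) (Fin n) T}
    (h : ∀ j < l, RLL Q u (v j) A (N j)) (a : Fin k) :
    fusedRow T n k l Q u v a * tleg (Sum.inl a) A * legProd Sum.inr N
      = legProd Sum.inr N * tleg (Sum.inl a) A * fusedRow T n k l Q u v a := by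
  refine exchange_list_prod _ (List.nodup_finRange l) (fun b _ => ?_) fun b _ c _ hbc => ?_
  · rw [mul_assoc]
    exact (h b b.2).sw_mul Sum.inl_ne_inr
  · exact sw_commute_tleg Sum.inr_ne_inl (Sum.inr_injective.ne hbc.symm) _ _ _

/-- Rows and matrices with different first legs commute, so they can be interleaved; then each block
`fusedRow * tleg` passes through the product of the `N`'s by `fusedRow_mul`. -/
theorem fusedR_mul {M N : ℕ → Matrix (Fin n) (Fin n) T}
    (h : ∀ i < k, ∀ j < l, RLL Q (u i) (v j) (M i) (N j)) :
    fusedR T n k l Q u v * (legProd Sum.inl M * legProd Sum.inr N)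
      = legProd Sum.inr N * legProd Sum.inl M * fusedR T n k l Q u v := by
  have h1 : fusedR T n k l Q u v * legProd Sum.inl M
      = ((List.finRange k).map fun a : Fin k =>
        fusedRow T n k l Q (u a) v a * tleg (Sum.inl a) (M a)).prod :=
    list_prod_mul_list_prod _ (List.nodup_finRange k)
      fun a _ c _ hac => fusedRow_commute_tleg hac _ _
  have h2 : legProd Sum.inl M * fusedR T n k l Q u v
      = ((List.finRange k).map fun a : Fin k =>
        tleg (Sum.inl a) (M a) * fusedRow T n k l Q (u a) v a).prod :=
    list_prod_mul_list_prod _ (List.nodup_finRange k)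
      fun a _ c _ hac => (fusedRow_commute_tleg hac.symm _ _).symm
  rw [← mul_assoc, h1, mul_assoc _ _ (fusedR T n k l Q u v), h2]
  refine (semiconjBy_list_prod _ fun a _ => ?_).eq.symm
  rw [SemiconjBy, ← mul_assoc, fusedRow_mul (h a a.2)]

theorem fusedRow_mul_fusedRow {a b : Fin k} (hab : a ≠ b) (u u' : K) :
    fusedRow T n k l Q u v a * fusedRow T n k l Q u' v b
      = ((List.finRange l).reverse.map fun c : Fin l =>
          rOp T n Q (Sum.inl a) (Sum.inr c) u (v c)
            * rOp T n Q (Sum.inl b) (Sum.inr c) u' (v c)).prod := by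
  rw [fusedRow, fusedRow, ← List.map_reverse, ← List.map_reverse]
  exact list_prod_mul_list_prod _ (List.nodup_reverse.2 (List.nodup_finRange l))
    fun c _ d _ hcd => sw_commute_sw (Sum.inl_injective.ne hab) Sum.inl_ne_inr Sum.inr_ne_inl
      (Sum.inr_injective.ne hcd) _ _ _ _

/-- Only the rows of `a` and `b` meet 1 - P. Interleaving them into pairs with a common second leg,
Yang–Baxter at the degenerate ratio exchanges each pair. -/
theorem fusedR_transports_inl (hq : q ≠ 0) (hq2 : q ^ 2 ≠ 1)
    (hu0 : ∀ i < k, IsUnit (u i))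
    (hu : ∀ i, i + 1 < k → u (i + 1) = algebraMap ℂ K q ^ 2 * u i)
    (hR : ∀ i < k, ∀ j < l, IsUnit ((algebraMap ℂ K q ^ 2 * u i - v j)
      * (u i - algebraMap ℂ K q ^ 2 * v j))) {a b : Fin k} (hab : (b : ℕ) = a + 1) :
    Transports (1 - pOp T n q (Sum.inl a) (Sum.inl b))
      (fusedR T n k l (algebraMap ℂ K q) u v) := by
  have hb := b.2
  have hne : a ≠ b := by rintro rfl; omega
  refine transports_prod hab (fun c => fusedRow_isUnit (hR c c.2) c) (fun c hca hcb => ?_)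
    ⟨fusedRow T n k l _ (u b) v b * fusedRow T n k l _ (u a) v a,
      (fusedRow_isUnit (hR b b.2) b).mul (fusedRow_isUnit (hR a a.2) a), ?_⟩
  · refine commute_list_prod fun z hz => ?_
    obtain ⟨d, -, rfl⟩ := List.mem_map.1 (List.mem_reverse.1 hz)
    exact pOp_commute_rOp (Sum.inl_injective.ne hca.symm) Sum.inl_ne_inr
      (Sum.inl_injective.ne hcb.symm) Sum.inl_ne_inr _ _ _
  · rw [fusedRow_mul_fusedRow hne, fusedRow_mul_fusedRow hne.symm]
    refine semiconjBy_list_prod _ fun c _ => semiconjBy_one_sub_pOp hq hq2 (hu0 a a.2) ?_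
    rw [← hu a (by omega), ← hab]
    exact rOp_yang_baxter _ _ _ _ (Sum.inl_injective.ne hne) Sum.inl_ne_inr Sum.inl_ne_inr

/-- The second legs are handled inside each row separately, where the factors of `b` and `a` are
neighbours. -/
theorem fusedR_transports_inr (hq : q ≠ 0) (hq2 : q ^ 2 ≠ 1)
    (hv0 : ∀ j < l, IsUnit (v j))
    (hv : ∀ j, j + 1 < l → v (j + 1) = algebraMap ℂ K q ^ 2 * v j)
    (hR : ∀ i < k, ∀ j < l, IsUnit ((algebraMap ℂ K q ^ 2 * u i - v j)
      * (u i - algebraMap ℂ K q ^ 2 * v j))) {a b : Fin l} (hab : (b : ℕ) = a + 1) :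
    Transports (1 - pOp T n q (Sum.inr a) (Sum.inr b))
      (fusedR T n k l (algebraMap ℂ K q) u v) := by
  have hb := b.2
  have hne : a ≠ b := by rintro rfl; omega
  refine .list_prod fun z hz => ?_
  obtain ⟨c, -, rfl⟩ := List.mem_map.1 hz
  have hru : ∀ d : Fin l, IsUnit (rOp T n (algebraMap ℂ K q)
      (Sum.inl c : Fin k ⊕ Fin l) (Sum.inr d) (u c) (v d)) := fun d => rOp_isUnit (hR c c.2 d d.2) _ _
  refine transports_reverse_prod hab hru (fun d hda hdb => ?_)
    ⟨_, (hru a).mul (hru b), ?_⟩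
  · exact pOp_commute_rOp Sum.inr_ne_inl (Sum.inr_injective.ne hda.symm)
      Sum.inr_ne_inl (Sum.inr_injective.ne hdb.symm) _ _ _
  · refine semiconjBy_one_sub_pOp hq hq2 (hv0 a a.2) ?_
    rw [← hv a (by omega), ← hab]
    -- Yang–Baxter is used here for the legs `c`, `a`, `b` and read as a relation for its last
    -- factor R_{ab}: R_{ab} R_{cb} R_{ca} = R_{ca} R_{cb} R_{ab}.
    have h := (rOp_yang_baxter (T := T) (n := n) (algebraMap ℂ K q) (u c) (v a) (v b)
      (Sum.inl_ne_inr (a := c) (b := a)) (Sum.inl_ne_inr (b := b))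
      (Sum.inr_injective.ne hne)).eq
    rw [← mul_assoc, mul_assoc _ _ (rOp T n (algebraMap ℂ K q) (Sum.inl c) (Sum.inr a) _ _)] at h
    exact h.symm

end Fused

/-- On k + l tensor factors the two products of transfer functions are the traces of A 𝓜 𝓝 and A 𝓝
𝓜, with A = `Ak * Al`. The fused `R`-matrix intertwines 𝓜 𝓝 and 𝓝 𝓜, and `trace_eq_of_intertwiner`
applies once A absorbs behind R, R⁻¹ and 𝓝 𝓜. -/
theorem transfer_commute (hq : q ≠ 0) (hq2 : q ^ 2 ≠ 1)
    {M N : ℕ → Matrix (Fin n) (Fin n) T} {u v : ℕ → K}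
    (hu0 : ∀ i < k, IsUnit (u i)) (hv0 : ∀ j < l, IsUnit (v j))
    (hu : ∀ i, i + 1 < k → u (i + 1) = algebraMap ℂ K q ^ 2 * u i)
    (hv : ∀ j, j + 1 < l → v (j + 1) = algebraMap ℂ K q ^ 2 * v j)
    (hM : ∀ i, i + 1 < k → RLL (algebraMap ℂ K q) (u i) (u (i + 1)) (M i) (M (i + 1)))
    (hN : ∀ j, j + 1 < l → RLL (algebraMap ℂ K q) (v j) (v (j + 1)) (N j) (N (j + 1)))
    (hR : ∀ i < k, ∀ j < l, IsUnit ((algebraMap ℂ K q ^ 2 * u i - v j)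
      * (u i - algebraMap ℂ K q ^ 2 * v j)))
    (hMN : ∀ i < k, ∀ j < l, RLL (algebraMap ℂ K q) (u i) (v j) (M i) (N j)) :
    Commute (antisymmTrace q M k) (antisymmTrace q N l) := by
  have hinl : (Sum.inl : Fin k → Fin k ⊕ Fin l).Injective := Sum.inl_injective
  have hinr : (Sum.inr : Fin l → Fin k ⊕ Fin l).Injective := Sum.inr_injective
  set 𝓜 := legProd (Sum.inl : Fin k → Fin k ⊕ Fin l) M with h𝓜
  set 𝓝 := legProd (Sum.inr : Fin l → Fin k ⊕ Fin l) N with h𝓝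
  obtain ⟨R, hRR⟩ := fusedR_isUnit (T := T) (n := n) hR
  have hinter : R.val * (𝓜 * 𝓝) = 𝓝 * 𝓜 * R.val := by rw [hRR]; exact fusedR_mul hMN
  have hk1 : ∀ a b : Fin k, (b : ℕ) = a + 1 →
      Transports (1 - pOp T n q (Sum.inl a) (Sum.inl b)) R.val := fun a b hab => by
    rw [hRR]; exact fusedR_transports_inl hq hq2 hu0 hu hR hab
  have hl1 : ∀ a b : Fin l, (b : ℕ) = a + 1 →
      Transports (1 - pOp T n q (Sum.inr a) (Sum.inr b)) R.val := fun a b hab => by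
    rw [hRR]; exact fusedR_transports_inr hq hq2 hv0 hv hR hab
  have hk2 : ∀ a b : Fin k, (b : ℕ) = a + 1 →
      (1 - repOp T n hq hinl (Equiv.swap a b)) * (𝓝 * 𝓜)
        * (1 + repOp T n hq hinl (Equiv.swap a b)) = 0 := by
    intro a b hab
    have hc : Commute (1 - pOp T n q (Sum.inl a) (Sum.inl b)) 𝓝 :=
      commute_list_prod fun z hz => by
        obtain ⟨c, -, rfl⟩ := List.mem_map.1 hz
        exact pOp_commute_tleg Sum.inr_ne_inl Sum.inr_ne_inl _
    have h := legProd_kill hq hq2 hinl hu0 hu hM a b hab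
    rw [repOp_swap hq hinl hab] at h ⊢
    rw [← mul_assoc, hc.eq, mul_assoc 𝓝, mul_assoc 𝓝, h, mul_zero]
  have hl2 : ∀ a b : Fin l, (b : ℕ) = a + 1 →
      (1 - repOp T n hq hinr (Equiv.swap a b)) * (𝓝 * 𝓜)
        * (1 + repOp T n hq hinr (Equiv.swap a b)) = 0 := by
    intro a b hab
    have hc : Commute (1 - pOp T n q (Sum.inr a) (Sum.inr b)) 𝓜 :=
      commute_list_prod fun z hz => by
        obtain ⟨c, -, rfl⟩ := List.mem_map.1 hz
        exact pOp_commute_tleg Sum.inl_ne_inr Sum.inl_ne_inr _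
    obtain ⟨y, hy⟩ := exists_semiconjBy_legProd hq hq2 hinr hv0 hv hN hab
    rw [repOp_swap hq hinr hab, (hy.mul_right hc).eq, mul_assoc, one_sub_mul_one_add hq, mul_zero]
  set Ak := altOf (repOp T n hq hinl) with hAk
  set Al := altOf (repOp T n hq hinr) with hAl
  have hcenk : CentralEntries Ak := by
    rw [hAk, ← emb_scalar_qAntisymm]; exact (centralEntries_scalar _).emb _
  have hcenl : CentralEntries Al := by
    rw [hAl, ← emb_scalar_qAntisymm]; exact (centralEntries_scalar _).emb _
  have hcomm : Commute Ak Al := by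
    rw [hAk, hAl, ← emb_scalar_qAntisymm, ← emb_scalar_qAntisymm]
    exact emb_commute_emb hinl hinr (fun a b => Sum.inl_ne_inr) (centralEntries_scalar _) _
  -- The two antisymmetrizers commute, so absorption may be verified for each of them separately.
  have habs : ∀ X, Ak * X * Ak = Ak * X → Al * X * Al = Al * X →
      (Ak * Al) * X * (Ak * Al) = (Ak * Al) * X := by
    intro X h1 h2
    calc (Ak * Al) * X * (Ak * Al) = (Al * Ak) * X * (Ak * Al) := by rw [hcomm.eq]
      _ = Al * (Ak * X * Ak) * Al := by noncomm_ring
      _ = (Al * Ak) * X * Al := by rw [h1]; noncomm_ring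
      _ = Ak * (Al * X * Al) := by rw [← hcomm.eq]; noncomm_ring
      _ = _ := by rw [h2]; noncomm_ring
  have hidem : (Ak * Al) * (Ak * Al) = Ak * Al := by
    have := habs 1 (by rw [mul_one, altOf_mul_self]) (by rw [mul_one, altOf_mul_self])
    simpa using this
  have hkill := one_sub_mul_one_add (T := T) (n := n) (ι := Fin k ⊕ Fin l) hq
  have htr := trace_eq_of_intertwiner (a := Ak * Al) (r := R) hidem
    ((hcenk.mul hcenl).mul (by rw [hRR]; exact fusedR_centralEntries))
    (habs _
      (altOf_absorb _ fun a b hab => by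
        rw [repOp_swap hq hinl hab]; exact (hk1 a b hab).kill (hkill _ _))
      (altOf_absorb _ fun a b hab => by
        rw [repOp_swap hq hinr hab]; exact (hl1 a b hab).kill (hkill _ _)))
    (habs _
      (altOf_absorb _ fun a b hab => by
        rw [repOp_swap hq hinl hab]; exact (hk1 a b hab).kill_inv (hkill _ _))
      (altOf_absorb _ fun a b hab => by
        rw [repOp_swap hq hinr hab]; exact (hl1 a b hab).kill_inv (hkill _ _)))
    (habs _ (altOf_absorb _ hk2) (altOf_absorb _ hl2)) hinter
  have hc1 : Commute Al 𝓜 := by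
    rw [hAl, ← emb_scalar_qAntisymm, h𝓜, ← emb_legProd hinl]
    exact emb_commute_emb hinr hinl (fun a b => Sum.inr_ne_inl) (centralEntries_scalar _) _
  have hc2 : Commute Ak 𝓝 := by
    rw [hAk, ← emb_scalar_qAntisymm, h𝓝, ← emb_legProd hinr]
    exact emb_commute_emb hinl hinr (fun a b => Sum.inl_ne_inr) (centralEntries_scalar _) _
  rw [Commute, SemiconjBy, antisymmTrace_eq, antisymmTrace_eq, ← trace_emb_inl_mul_emb_inr,
    ← trace_emb_inr_mul_emb_inl, emb_mul hinl, emb_mul hinr, emb_scalar_qAntisymm hq hinl,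
    emb_scalar_qAntisymm hq hinr, emb_legProd hinl, emb_legProd hinr, ← hAk, ← hAl, ← h𝓜, ← h𝓝]
  calc (Ak * 𝓜 * (Al * 𝓝)).trace = (Ak * Al * (𝓜 * 𝓝)).trace := by
        congr 1
        calc Ak * 𝓜 * (Al * 𝓝) = Ak * (𝓜 * Al) * 𝓝 := by noncomm_ring
          _ = _ := by rw [← hc1.eq]; noncomm_ring
    _ = (Ak * Al * (𝓝 * 𝓜)).trace := htr
    _ = (Al * 𝓝 * (Ak * 𝓜)).trace := by
        congr 1
        calc Ak * Al * (𝓝 * 𝓜) = Al * (Ak * 𝓝) * 𝓜 := by rw [hcomm.eq]; noncomm_ring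
          _ = _ := by rw [hc2.eq]; noncomm_ring

end Transfer

/-! ### Splitting off the last tensor factor -/

section ExtPerm

variable {j : ℕ}

/-- The extension of a permutation fixing the last point. -/
def extPerm (τ : Equiv.Perm (Fin j)) : Equiv.Perm (Fin (j + 1)) :=
  finSuccEquivLast.symm.permCongr τ.optionCongr

theorem extPerm_castSucc (τ : Equiv.Perm (Fin j)) (i : Fin j) :
    extPerm τ i.castSucc = (τ i).castSucc := by
  simp [extPerm, Equiv.permCongr_apply]

theorem extPerm_last (τ : Equiv.Perm (Fin j)) : extPerm τ (Fin.last j) = Fin.last j := by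
  simp [extPerm, Equiv.permCongr_apply]

theorem sign_extPerm (τ : Equiv.Perm (Fin j)) :
    Equiv.Perm.sign (extPerm τ) = Equiv.Perm.sign τ := by
  rw [extPerm, Equiv.Perm.sign_permCongr, Equiv.optionCongr_sign]

theorem extPerm_symm (τ : Equiv.Perm (Fin j)) : (extPerm τ).symm = extPerm τ.symm := by
  refine Equiv.ext fun i => ?_
  rw [Equiv.symm_apply_eq]
  refine Fin.lastCases ?_ (fun i => ?_) i
  · rw [extPerm_last, extPerm_last]
  · rw [extPerm_castSucc, extPerm_castSucc, Equiv.apply_symm_apply]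

/-- Coset decomposition: the representative `Equiv.swap (Fin.last j) a` is determined by the image
`a` of the last point. -/
theorem sum_perm_succ {A : Type*} [AddCommMonoid A] (f : Equiv.Perm (Fin (j + 1)) → A) :
    ∑ τ, f τ = ∑ a : Fin (j + 1), ∑ τ : Equiv.Perm (Fin j),
      f (Equiv.swap (Fin.last j) a * extPerm τ) := by
  rw [← Fintype.sum_prod_type']
  symm
  refine Function.Bijective.sum_comp (e := fun p : Fin (j + 1) × Equiv.Perm (Fin j) =>
    Equiv.swap (Fin.last j) p.1 * extPerm p.2) ?_ f
  rw [Fintype.bijective_iff_injective_and_card]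
  constructor
  · rintro ⟨a, τ⟩ ⟨b, σ⟩ h
    have h1 := congrArg (· (Fin.last j)) h
    simp only [Equiv.Perm.mul_apply, extPerm_last, Equiv.swap_apply_left] at h1
    subst h1
    have h2 := mul_left_cancel h
    congr 1
    ext i
    have h3 := congrArg (· i.castSucc) h2
    simp only [extPerm_castSucc, Fin.castSucc_inj] at h3
    rw [h3]
  · simp [Fintype.card_perm, Nat.factorial_succ]

end ExtPerm

/-! ### Branching of the antisymmetrizer and partial traces -/

section Newton

variable {T : Type*} [Ring T] [Algebra ℂ T] {n j : ℕ} {q : ℂ}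

theorem emb_id {κ : Type*} [Fintype κ] [DecidableEq κ] (X : Matrix (κ → Fin n) (κ → Fin n) T) :
    emb id X = X := by
  ext I J
  rw [emb_apply, if_pos fun r hr => absurd rfl (hr r)]
  rfl

/-- A fixed last point takes part in no inversion. -/
theorem permWeight_extPerm (τ : Equiv.Perm (Fin j)) (J : Fin (j + 1) → Fin n) :
    permWeight q (extPerm τ) J = permWeight q τ (J ∘ Fin.castSucc) := by
  unfold permWeight
  rw [Fin.prod_univ_castSucc]
  have h1 : ∀ b : Fin (j + 1), ¬ Fin.last j < b := fun b => (Fin.le_last b).not_gt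
  simp only [Fin.prod_univ_castSucc (n := j), extPerm_last, extPerm_castSucc, h1, false_and,
    and_false, if_false, mul_one, Fin.castSucc_lt_castSucc_iff, Finset.prod_const_one,
    Function.comp_apply]

theorem emb_castSucc_qPerm (τ : Equiv.Perm (Fin j)) :
    emb Fin.castSucc (scalar T (qPerm n q τ)) = scalar T (qPerm n q (extPerm τ)) := by
  ext I J
  rw [emb_apply]
  simp only [scalar, Matrix.map_apply, qPerm, Matrix.of_apply, permWeight_extPerm, extPerm_symm]
  have h : I = J ∘ extPerm τ.symm ↔ (∀ r : Fin (j + 1), (∀ a : Fin j, r ≠ a.castSucc) → I r = J r)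
      ∧ I ∘ Fin.castSucc = (J ∘ Fin.castSucc) ∘ τ.symm := by
    constructor
    · rintro rfl
      refine ⟨fun r hr => ?_, funext fun i => by simp [extPerm_castSucc]⟩
      obtain rfl : r = Fin.last j := by
        by_contra h
        exact hr _ (Fin.castSucc_castPred r h).symm
      simp [extPerm_last]
    · rintro ⟨h1, h2⟩
      funext r
      refine Fin.lastCases ?_ (fun i => ?_) r
      · rw [h1 _ fun a => (Fin.castSucc_lt_last a).ne']; simp [extPerm_last]
      · simpa [extPerm_castSucc] using congrFun h2 i
  simp only [h, ite_and]
  split_ifs <;> simp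

/-- The coset of the trivial representative gives the 1, every other representative is an odd
transposition, and (j + 1)/(j + 1)! = 1/j!. -/
theorem smul_qAntisymm_succ (hq : q ≠ 0) :
    ((j + 1 : ℕ) : ℂ) • scalar T (qAntisymm n (j + 1) q)
      = (1 - ∑ a : Fin j, scalar T (qPerm n q (Equiv.swap (Fin.last j) a.castSucc)))
        * emb Fin.castSucc (scalar T (qAntisymm n j q)) := by
  have hid := (Function.injective_id : (id : Fin (j + 1) → Fin (j + 1)).Injective)
  have hrep : ∀ τ, repOp T n hq hid τ = scalar T (qPerm n q τ) := fun τ => by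
    rw [repOp_apply, emb_id]
  have hcs := Fin.castSucc_injective j
  rw [← emb_id (scalar T (qAntisymm n (j + 1) q)), emb_scalar_qAntisymm hq hid,
    emb_scalar_qAntisymm hq hcs, altOf, altOf, smul_smul, mul_smul_comm]
  have hc : ((j + 1 : ℕ) : ℂ) * ((j + 1).factorial : ℂ)⁻¹ = (j.factorial : ℂ)⁻¹ := by
    rw [Nat.factorial_succ, Nat.cast_mul, mul_inv, ← mul_assoc,
      mul_inv_cancel₀ (Nat.cast_ne_zero.2 j.succ_ne_zero), one_mul]
  rw [hc]
  congr 1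
  rw [sum_perm_succ, Fin.sum_univ_castSucc, add_comm (∑ a : Fin j, _)]
  have h1 : ∀ a, ∑ τ : Equiv.Perm (Fin j),
      ((Equiv.Perm.sign (Equiv.swap (Fin.last j) a * extPerm τ) : ℤ) : ℂ)
        • repOp T n hq hid (Equiv.swap (Fin.last j) a * extPerm τ)
      = ((Equiv.Perm.sign (Equiv.swap (Fin.last j) a) : ℤ) : ℂ)
        • (scalar T (qPerm n q (Equiv.swap (Fin.last j) a))
        * ∑ τ : Equiv.Perm (Fin j), ((Equiv.Perm.sign τ : ℤ) : ℂ) • repOp T n hq hcs τ) := by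
    intro a
    rw [Finset.mul_sum, Finset.smul_sum]
    refine Finset.sum_congr rfl fun τ _ => ?_
    rw [map_mul, map_mul, hrep, hrep, ← emb_castSucc_qPerm, sign_extPerm, repOp_apply,
      Units.val_mul, Int.cast_mul, mul_smul, mul_smul_comm]
  simp only [h1]
  rw [Equiv.swap_self, sub_mul, Finset.sum_mul, sub_eq_add_neg, ← Finset.sum_neg_distrib]
  congr 1
  · rw [← hrep, ← Equiv.Perm.one_def, map_one, map_one]
    simp
  · refine Finset.sum_congr rfl fun a _ => ?_
    rw [Equiv.Perm.sign_swap (Fin.castSucc_lt_last a).ne']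
    simp

/-- Appending an index. -/
def snocIdx (I : Fin j → Fin n) (i : Fin n) : Fin (j + 1) → Fin n :=
  Fin.snoc (α := fun _ => Fin n) I i

theorem snocIdx_castSucc (I : Fin j → Fin n) (i : Fin n) (a : Fin j) :
    snocIdx I i a.castSucc = I a := by simp [snocIdx]

theorem snocIdx_last (I : Fin j → Fin n) (i : Fin n) : snocIdx I i (Fin.last j) = i := by
  simp [snocIdx]

theorem snocIdx_comp_castSucc (I : Fin j → Fin n) (i : Fin n) :
    snocIdx I i ∘ Fin.castSucc = I := funext fun a => snocIdx_castSucc I i a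

theorem extend_snocIdx (K I : Fin j → Fin n) (i : Fin n) :
    Function.extend Fin.castSucc K (snocIdx I i) = snocIdx K i := by
  funext r
  refine Fin.lastCases ?_ (fun a => ?_) r
  · rw [extend_off _ _ _ fun a => (Fin.castSucc_lt_last a).ne', snocIdx_last, snocIdx_last]
  · rw [(Fin.castSucc_injective j).extend_apply, snocIdx_castSucc]

theorem sum_snocIdx {A : Type*} [AddCommMonoid A] (f : (Fin (j + 1) → Fin n) → A) :
    ∑ I, f I = ∑ i : Fin n, ∑ I : Fin j → Fin n, f (snocIdx I i) := by
  rw [← Fintype.sum_prod_type', ← (Fin.snocEquiv fun _ : Fin (j + 1) => Fin n).sum_comp]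
  rfl

/-- The trace over all tensor factors but the last. -/
def partialTrace (X : Matrix (Fin (j + 1) → Fin n) (Fin (j + 1) → Fin n) T) :
    Matrix (Fin n) (Fin n) T :=
  Matrix.of fun i k => ∑ I : Fin j → Fin n, X (snocIdx I i) (snocIdx I k)

theorem partialTrace_apply (X : Matrix (Fin (j + 1) → Fin n) (Fin (j + 1) → Fin n) T)
    (i k : Fin n) :
    partialTrace X i k = ∑ I : Fin j → Fin n, X (snocIdx I i) (snocIdx I k) := rfl

theorem trace_partialTrace (X : Matrix (Fin (j + 1) → Fin n) (Fin (j + 1) → Fin n) T) :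
    (partialTrace X).trace = X.trace := by
  simp only [Matrix.trace, Matrix.diag_apply, partialTrace_apply]
  exact (sum_snocIdx fun I => X I I).symm

theorem partialTrace_smul (c : ℂ) (X : Matrix (Fin (j + 1) → Fin n) (Fin (j + 1) → Fin n) T) :
    partialTrace (c • X) = c • partialTrace X := by
  ext i k
  simp only [partialTrace_apply, Matrix.smul_apply, Finset.smul_sum]

theorem partialTrace_sub (X Y : Matrix (Fin (j + 1) → Fin n) (Fin (j + 1) → Fin n) T) :
    partialTrace (X - Y) = partialTrace X - partialTrace Y := by
  ext i k
  simp only [partialTrace_apply, Matrix.sub_apply, Finset.sum_sub_distrib]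

theorem partialTrace_sum {β : Type*} (s : Finset β)
    (X : β → Matrix (Fin (j + 1) → Fin n) (Fin (j + 1) → Fin n) T) :
    partialTrace (∑ b ∈ s, X b) = ∑ b ∈ s, partialTrace (X b) := by
  ext i k
  simp only [partialTrace_apply, Matrix.sum_apply]
  exact Finset.sum_comm

/-- A partial trace is cyclic for operators acting only in the traced factors, provided that their
entries are central. -/
theorem partialTrace_emb_mul_comm {C : Matrix (Fin j → Fin n) (Fin j → Fin n) T}
    (hC : CentralEntries C) (X : Matrix (Fin (j + 1) → Fin n) (Fin (j + 1) → Fin n) T) :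
    partialTrace (emb Fin.castSucc C * X) = partialTrace (X * emb Fin.castSucc C) := by
  have hcs := Fin.castSucc_injective j
  ext i k
  have h : ∀ I J, (X * emb Fin.castSucc C) I J = (emb Fin.castSucc C.transpose * X.transpose) J I := by
    intro I J
    rw [Matrix.mul_apply, Matrix.mul_apply]
    refine Finset.sum_congr rfl fun K _ => ?_
    rw [((hC.emb _) K J (X I K)).eq.symm, Matrix.transpose_apply]
    congr 1
    simp only [emb_apply, Matrix.transpose_apply, eq_comm]
    congr
  simp only [partialTrace_apply, h, emb_mul_apply hcs, snocIdx_comp_castSucc, extend_snocIdx,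
    Matrix.transpose_apply]
  exact Finset.sum_comm

theorem emb_mul_tleg_last (Y : Matrix (Fin j → Fin n) (Fin j → Fin n) T)
    (N : Matrix (Fin n) (Fin n) T) (I J : Fin j → Fin n) (i k : Fin n) :
    (emb Fin.castSucc Y * tleg (Fin.last j) N) (snocIdx I i) (snocIdx J k) = Y I J * N i k := by
  rw [emb_mul_tleg_apply (Fin.castSucc_injective j) fun a => (Fin.castSucc_lt_last a).ne,
    if_pos, snocIdx_comp_castSucc, snocIdx_comp_castSucc, snocIdx_last, snocIdx_last]
  exact fun r => Fin.lastCases (fun _ h => absurd rfl h) (fun a h => absurd rfl (h a)) r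

theorem partialTrace_emb_mul_tleg (Y : Matrix (Fin j → Fin n) (Fin j → Fin n) T)
    (N : Matrix (Fin n) (Fin n) T) (i k : Fin n) :
    partialTrace (emb Fin.castSucc Y * tleg (Fin.last j) N) i k = Y.trace * N i k := by
  simp only [partialTrace_apply, emb_mul_tleg_last, Matrix.trace, Matrix.diag_apply,
    Finset.sum_mul]

/-- This is the origin of the product *_q. The swap links the free index of `Y` to the row index of
`N`, and summing over the link `c` leaves the weight q^{sgn(c - i)} of the q-permutation. -/
theorem partialTrace_pOp_mul (Y : Matrix (Fin (j + 1) → Fin n) (Fin (j + 1) → Fin n) T)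
    (N : Matrix (Fin n) (Fin n) T) :
    partialTrace (pOp T n q (Fin.last j).castSucc (Fin.last (j + 1))
      * (emb Fin.castSucc Y * tleg (Fin.last (j + 1)) N)) = qMul q (partialTrace Y) N := by
  ext i k
  have hs : ∀ (I : Fin j → Fin n) (c : Fin n),
      snocIdx (snocIdx I c) i ∘ Equiv.swap (Fin.last j).castSucc (Fin.last (j + 1))
        = snocIdx (snocIdx I i) c := by
    intro I c
    funext r
    refine Fin.lastCases ?_ (fun r => Fin.lastCases ?_ (fun r => ?_) r) r
    · simp [snocIdx_last, snocIdx_castSucc]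
    · simp [snocIdx_last, snocIdx_castSucc]
    · rw [Function.comp_apply, Equiv.swap_apply_of_ne_of_ne]
      · simp [snocIdx_castSucc]
      · rw [Ne, Fin.castSucc_inj]; exact (Fin.castSucc_lt_last r).ne
      · exact (Fin.castSucc_lt_last _).ne
  simp only [partialTrace_apply, qMul, Matrix.of_apply]
  rw [sum_snocIdx]
  refine Finset.sum_congr rfl fun c _ => ?_
  rw [Finset.sum_mul, Finset.smul_sum]
  refine Finset.sum_congr rfl fun I _ => ?_
  rw [pOp_mul_apply, hs, emb_mul_tleg_last, snocIdx_castSucc, snocIdx_last, snocIdx_last]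

theorem legProd_succ (M : ℕ → Matrix (Fin n) (Fin n) T) :
    legProd (id : Fin (j + 1) → Fin (j + 1)) M
      = emb Fin.castSucc (legProd id M) * tleg (Fin.last j) (M j) := by
  rw [emb_legProd (Fin.castSucc_injective j), legProd, List.finRange_succ_last, List.map_append,
    List.prod_append, List.map_map, legProd]
  simp [Function.comp_def]

end Newton

/-! ### Newton identities -/

section NewtonIdentities

variable {T : Type*} [Ring T] [Algebra ℂ T] {n j : ℕ} {q : ℂ}

theorem qMul_smul_left (c : ℂ) (A B : Matrix (Fin n) (Fin n) T) :
    qMul q (c • A) B = c • qMul q A B := by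
  ext i k
  simp only [qMul, Matrix.of_apply, Matrix.smul_apply, Finset.smul_sum, smul_mul_assoc]
  exact Finset.sum_congr rfl fun _ _ => smul_comm _ _ _

theorem qMul_mul_left (x : T) (A B : Matrix (Fin n) (Fin n) T) :
    qMul q (x • A) B = x • qMul q A B := by
  ext i k
  simp only [qMul, Matrix.of_apply, Matrix.smul_apply, smul_eq_mul, Finset.mul_sum,
    mul_smul_comm, mul_assoc]

theorem qMul_sum_left {β : Type*} (s : Finset β) (A : β → Matrix (Fin n) (Fin n) T)
    (B : Matrix (Fin n) (Fin n) T) : qMul q (∑ b ∈ s, A b) B = ∑ b ∈ s, qMul q (A b) B := by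
  ext i k
  simp only [qMul, Matrix.of_apply, Matrix.sum_apply, Finset.sum_mul, Finset.smul_sum]
  exact Finset.sum_comm

theorem qMul_zero_left (B : Matrix (Fin n) (Fin n) T) : qMul q 0 B = 0 := by
  ext i k
  simp [qMul]

theorem one_qMul (B : Matrix (Fin n) (Fin n) T) : qMul q 1 B = B := by
  ext i k
  simp [qMul, Matrix.one_apply]

/-- The matrix `tr_{1,…,j}(A_{j+1} M₀^{(1)} ⋯ M_j^{(j+1)})`. -/
def antisymmPartial (q : ℂ) (M : ℕ → Matrix (Fin n) (Fin n) T) (j : ℕ) :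
    Matrix (Fin n) (Fin n) T :=
  partialTrace (scalar T (qAntisymm n (j + 1) q) * legProd (id : Fin (j + 1) → Fin (j + 1)) M)

theorem trace_antisymmPartial (M : ℕ → Matrix (Fin n) (Fin n) T) (j : ℕ) :
    (antisymmPartial q M j).trace = antisymmTrace q M (j + 1) := by
  rw [antisymmPartial, trace_partialTrace, antisymmTrace_eq]

/-- The antisymmetrizer absorbs `q`-permutations to the right of the product `M₀^{(1)} M₁^{(2)} ⋯`
of the first `j` matrices. -/
def IsAntisymmetric (q : ℂ) (M : ℕ → Matrix (Fin n) (Fin n) T) (j : ℕ) : Prop :=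
  ∀ σ : Equiv.Perm (Fin j), scalar T (qAntisymm n j q) * legProd (id : Fin j → Fin j) M
      * scalar T (qPerm n q σ)
    = ((Equiv.Perm.sign σ : ℤ) : ℂ) • (scalar T (qAntisymm n j q) * legProd id M)

theorem scalar_qPerm_mul (hq : q ≠ 0) (σ τ : Equiv.Perm (Fin j)) :
    scalar T (qPerm n q (σ * τ)) = scalar T (qPerm n q σ) * scalar T (qPerm n q τ) := by
  rw [qPerm_mul n hq, scalar, Matrix.map_mul]

theorem scalar_qPerm_mul_qAntisymm (hq : q ≠ 0) (σ : Equiv.Perm (Fin j)) :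
    scalar T (qPerm n q σ) * scalar T (qAntisymm n j q)
      = ((Equiv.Perm.sign σ : ℤ) : ℂ) • scalar T (qAntisymm n j q) := by
  have h := mul_altOf (repOp T n hq (Function.injective_id (α := Fin j))) σ
  rwa [← emb_scalar_qAntisymm, repOp_apply, emb_id, emb_id] at h

/-- The transposition of `a` with the last point is conjugate to the adjacent transposition of the
last two points, by a permutation σ of the earlier points. One copy of σ is absorbed by the
antisymmetrizer on the left, the other is carried around the partial trace and absorbed on the
right. Hence the result does not depend on `a`. -/
theorem partialTrace_swap_mul (hq : q ≠ 0) {M : ℕ → Matrix (Fin n) (Fin n) T}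
    (hM : IsAntisymmetric q M (j + 1)) (a : Fin (j + 1)) :
    partialTrace (scalar T (qPerm n q (Equiv.swap (Fin.last (j + 1)) a.castSucc))
      * (emb Fin.castSucc (scalar T (qAntisymm n (j + 1) q) * legProd id M)
        * tleg (Fin.last (j + 1)) (M (j + 1))))
      = qMul q (antisymmPartial q M j) (M (j + 1)) := by
  have hcs := Fin.castSucc_injective (j + 1)
  set σ : Equiv.Perm (Fin (j + 1)) := Equiv.swap a (Fin.last j) with hσ
  set A := scalar T (qAntisymm n (j + 1) q) with hA
  set L := legProd (id : Fin (j + 1) → Fin (j + 1)) M with hL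
  set N := tleg (Fin.last (j + 1)) (M (j + 1)) with hN
  set P := pOp T n q (Fin.last j).castSucc (Fin.last (j + 1)) with hP
  set E := emb (Fin.castSucc : Fin (j + 1) → Fin (j + 2)) (scalar T (qPerm n q σ)) with hE
  have hsw : Equiv.swap (Fin.last (j + 1)) a.castSucc
      = extPerm σ * Equiv.swap (Fin.last j).castSucc (Fin.last (j + 1)) * extPerm σ := by
    have h1 := Equiv.swap_apply_apply (extPerm σ) (Fin.last j).castSucc (Fin.last (j + 1))
    have h2 : (extPerm σ)⁻¹ = extPerm σ := by
      change (extPerm σ).symm = _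
      rw [extPerm_symm, hσ, Equiv.symm_swap]
    rw [extPerm_last, extPerm_castSucc, hσ, Equiv.swap_apply_right, ← hσ, h2] at h1
    rw [Equiv.swap_comm, h1]
  have hPs : scalar T (qPerm n q (Equiv.swap (Fin.last j).castSucc (Fin.last (j + 1)))) = P := by
    have h := repOp_swap (T := T) (n := n) hq
      (Function.injective_id (α := Fin (j + 2))) (a := (Fin.last j).castSucc)
      (b := Fin.last (j + 1)) (by simp)
    rwa [repOp_apply, emb_id] at h
  have hcomm : Commute E N := by
    rw [hE, hN, tleg_eq_emb]
    exact emb_commute_emb hcs (Function.injective_of_subsingleton _)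
      (fun a _ => (Fin.castSucc_lt_last a).ne) (centralEntries_scalar _) _
  rw [hsw, scalar_qPerm_mul hq, scalar_qPerm_mul hq, hPs, ← emb_castSucc_qPerm, ← hE]
  have e1 : E * (emb Fin.castSucc (A * L) * N)
      = ((Equiv.Perm.sign σ : ℤ) : ℂ) • (emb Fin.castSucc (A * L) * N) := by
    rw [hE, ← mul_assoc, ← emb_mul hcs, ← mul_assoc, scalar_qPerm_mul_qAntisymm hq,
      smul_mul_assoc, emb_smul, smul_mul_assoc]
  have e2 : emb Fin.castSucc (A * L) * N * E
      = ((Equiv.Perm.sign σ : ℤ) : ℂ) • (emb Fin.castSucc (A * L) * N) := by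
    rw [mul_assoc, ← hcomm.eq, hE, ← mul_assoc, ← emb_mul hcs, hM σ, emb_smul, smul_mul_assoc]
  -- Each copy of σ contributes its sign, and the two signs cancel.
  rw [mul_assoc (E * P), e1, mul_assoc, partialTrace_emb_mul_comm (centralEntries_scalar _),
    ← hE, mul_assoc, smul_mul_assoc, e2, smul_smul, sign_mul_sign, one_smul,
    partialTrace_pOp_mul, antisymmPartial]

/-- The identity in the expansion of the antisymmetrizer produces the first term; the j + 1
transpositions produce equal contributions, whence the factor in the second. -/
theorem smul_antisymmPartial (hq : q ≠ 0) {M : ℕ → Matrix (Fin n) (Fin n) T}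
    (hM : IsAntisymmetric q M (j + 1)) :
    ((j + 2 : ℕ) : ℂ) • antisymmPartial q M (j + 1)
      = antisymmTrace q M (j + 1) • M (j + 1)
        - qMul q (((j + 1 : ℕ) : ℂ) • antisymmPartial q M j) (M (j + 1)) := by
  have hcs := Fin.castSucc_injective (j + 1)
  rw [antisymmPartial, ← partialTrace_smul, ← smul_mul_assoc, smul_qAntisymm_succ hq,
    legProd_succ, mul_assoc, ← mul_assoc (emb _ _) (emb _ _), ← emb_mul hcs, sub_mul, one_mul,
    Finset.sum_mul, partialTrace_sub, partialTrace_sum]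
  simp only [partialTrace_swap_mul hq hM]
  congr 1
  · ext i k
    rw [partialTrace_emb_mul_tleg, antisymmTrace_eq]
    rfl
  · rw [qMul_smul_left, Finset.sum_const, Finset.card_univ, Fintype.card_fin,
      ← Nat.cast_smul_eq_nsmul ℂ]

theorem antisymmTrace_zero (M : ℕ → Matrix (Fin n) (Fin n) T) : antisymmTrace q M 0 = 1 := by
  have h : qAntisymm n 0 q = 1 := by
    ext I J
    simp [qAntisymm, qPerm, permWeight, Matrix.one_apply, Subsingleton.elim I J]
    exact Subsingleton.elim _ _
  rw [antisymmTrace_eq, h, legProd, scalar, Matrix.map_one _ (map_zero _) (map_one _)]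
  simp [Matrix.trace]

theorem antisymmPartial_zero (hq : q ≠ 0) (M : ℕ → Matrix (Fin n) (Fin n) T) :
    antisymmPartial q M 0 = M 0 := by
  have h := smul_qAntisymm_succ (T := T) (n := n) (j := 0) hq
  simp only [zero_add, Nat.cast_one, one_smul, Finset.univ_eq_empty, Finset.sum_empty, sub_zero,
    one_mul] at h
  rw [antisymmPartial, h, legProd_succ, ← mul_assoc, ← emb_mul (Fin.castSucc_injective 0)]
  ext i k
  rw [partialTrace_emb_mul_tleg, ← antisymmTrace_eq, antisymmTrace_zero, one_mul]

/-- `j tr_{1,…,j-1}(A_j M₀^{(1)} ⋯ M_{j-1}^{(j)})`. -/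
def newtonMatrix (q : ℂ) (M : ℕ → Matrix (Fin n) (Fin n) T) : ℕ → Matrix (Fin n) (Fin n) T
  | 0 => 0
  | j + 1 => ((j + 1 : ℕ) : ℂ) • antisymmPartial q M j

/-- The value 0 of `newtonMatrix` at index 0, together with t_0 = 1, makes the recursion valid from
the start. -/
theorem newtonMatrix_succ (hq : q ≠ 0) {M : ℕ → Matrix (Fin n) (Fin n) T}
    (hM : IsAntisymmetric q M j) :
    newtonMatrix q M (j + 1)
      = antisymmTrace q M j • M j - qMul q (newtonMatrix q M j) (M j) := by
  cases j with
  | zero =>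
    rw [newtonMatrix, newtonMatrix, qMul_zero_left, sub_zero, antisymmTrace_zero,
      antisymmPartial_zero hq]
    simp
  | succ j => exact smul_antisymmPartial hq hM

/-- Unrolling the recursion: the term created at stage m is afterwards *_q-multiplied by the later
matrices, so it grows into the quantum power of the sequence starting at `M m`, with a sign change
at each further step. -/
theorem newtonMatrix_eq_sum (hq : q ≠ 0) {M : ℕ → Matrix (Fin n) (Fin n) T} (k : ℕ)
    (hM : ∀ j < k, IsAntisymmetric q M j) :
    newtonMatrix q M k = ∑ m ∈ Finset.range k, ((-1 : ℂ) ^ (k + m + 1)) •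
      (antisymmTrace q M m • qPow q (fun s => M (m + s)) (k - m)) := by
  induction k with
  | zero => simp [newtonMatrix]
  | succ k ih =>
    rw [newtonMatrix_succ hq (hM k k.lt_succ_self), ih fun j hj => hM j (hj.trans k.lt_succ_self),
      Finset.sum_range_succ, qMul_sum_left, sub_eq_add_neg, add_comm (_ • M k),
      ← Finset.sum_neg_distrib]
    congr 1
    · refine Finset.sum_congr rfl fun m hm => ?_
      have hm' := Finset.mem_range.1 hm
      rw [qMul_smul_left, qMul_mul_left, Nat.succ_sub hm'.le, qPow, ← neg_smul]
      congr 2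
      · rw [show k + 1 + m + 1 = (k + m + 1) + 1 by ring, pow_succ (-1 : ℂ) (k + m + 1)]
        ring
      · rw [Nat.add_sub_cancel' hm'.le]
    · rw [Nat.add_sub_cancel_left, qPow, qPow, one_qMul, add_zero,
        show k + 1 + k + 1 = 2 * (k + 1) by ring, pow_mul]
      simp

/-- The Newton identities. -/
theorem newton_identity (hq : q ≠ 0) {M : ℕ → Matrix (Fin n) (Fin n) T} (k : ℕ)
    (hM : ∀ j < k, IsAntisymmetric q M j) :
    (k : ℂ) • antisymmTrace q M k = ∑ m ∈ Finset.range k, ((-1 : ℂ) ^ (k + m + 1)) •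
      (antisymmTrace q M m * qPowTrace q (fun s => M (m + s)) (k - m)) := by
  have h1 : (newtonMatrix q M k).trace = (k : ℂ) • antisymmTrace q M k := by
    cases k with
    | zero => simp [newtonMatrix]
    | succ k => rw [newtonMatrix, Matrix.trace_smul, trace_antisymmPartial]
  rw [← h1, newtonMatrix_eq_sum hq k hM, Matrix.trace_sum]
  simp only [Matrix.trace_smul, qPowTrace, smul_eq_mul]

/-- The Newton identity is solved for its term m = 0, which is ±I_k. The other terms involve shorter
quantum powers of shifted sequences, so the induction must let `M` vary. -/
theorem qPowTrace_commute (hq : q ≠ 0) {y : T} (k : ℕ) (M : ℕ → Matrix (Fin n) (Fin n) T)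
    (hM : ∀ s j, s + j ≤ k → IsAntisymmetric q (fun i => M (s + i)) j)
    (hy : ∀ s j, s + j ≤ k → Commute (antisymmTrace q (fun i => M (s + i)) j) y) :
    Commute (qPowTrace q M k) y := by
  induction k using Nat.strong_induction_on generalizing M with
  | _ k ih =>
    cases k with
    | zero =>
      rw [qPowTrace, qPow, Matrix.trace_one]
      exact Nat.cast_commute _ _
    | succ k =>
      have h := newton_identity hq (M := M) (k + 1)
        fun j hj => by simpa using hM 0 j (by omega)
      -- Splits off the summand m = 0.
      rw [Finset.sum_range_succ'] at h
      have h0 : Commute (((-1 : ℂ) ^ (k + 1 + 0 + 1)) • (antisymmTrace q M 0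
          * qPowTrace q (fun s => M (0 + s)) (k + 1 - 0))) y := by
        rw [← sub_eq_iff_eq_add'] at h
        rw [← h]
        refine Commute.sub_left (.smul_left (by simpa using hy 0 (k + 1) (by omega)) _) ?_
        refine Commute.sum_left _ _ _ fun m hm => .smul_left (.mul_left ?_ ?_) _
        · have := Finset.mem_range.1 hm
          simpa using hy 0 (m + 1) (by omega)
        · have := Finset.mem_range.1 hm
          refine ih _ (by omega) _ (fun s j hsj => ?_) fun s j hsj => ?_
          · simpa only [add_assoc] using hM (m + 1 + s) j (by omega)
          · simpa only [add_assoc] using hy (m + 1 + s) j (by omega)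
      rw [antisymmTrace_zero, one_mul] at h0
      simp only [zero_add, Nat.sub_zero] at h0
      have h1 := h0.smul_left ((-1 : ℂ) ^ (k + 1 + 0 + 1))
      rw [smul_smul, ← mul_pow, neg_one_mul, neg_neg, one_pow, one_smul] at h1
      exact h1

end NewtonIdentities

/-! ### The case q² = 1: entries that commute up to signs -/

section Graded

variable {T : Type*} [Ring T] [Algebra ℂ T] {n k l : ℕ} {q : ℂ}

/-- `x` commutes with the entry `X I J` up to the factor `Φ I * Φ J`. -/
def Graded {β : Type*} (x : T) (Φ : β → ℂ) (X : Matrix β β T) : Prop :=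
  ∀ I J, x * X I J = (Φ I * Φ J) • (X I J * x)

section

variable {β : Type*} [Fintype β] [DecidableEq β] {x : T} {Φ : β → ℂ}

theorem Graded.one (hΦ : ∀ I, Φ I * Φ I = 1) : Graded x Φ (1 : Matrix β β T) := by
  intro I J
  rw [Matrix.one_apply]
  split_ifs with h
  · subst h; rw [hΦ, one_smul, mul_one, one_mul]
  · simp

theorem Graded.mul (hΦ : ∀ I, Φ I * Φ I = 1) {X Y : Matrix β β T} (hX : Graded x Φ X)
    (hY : Graded x Φ Y) : Graded x Φ (X * Y) := by
  intro I J
  simp only [Matrix.mul_apply, Finset.mul_sum, Finset.sum_mul, Finset.smul_sum]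
  refine Finset.sum_congr rfl fun K _ => ?_
  rw [← mul_assoc, hX, smul_mul_assoc, mul_assoc, hY, mul_smul_comm, smul_smul,
    ← mul_assoc (X I K)]
  congr 1
  linear_combination Φ I * Φ J * hΦ K

theorem Graded.list_prod (hΦ : ∀ I, Φ I * Φ I = 1) {L : List (Matrix β β T)}
    (h : ∀ X ∈ L, Graded x Φ X) : Graded x Φ L.prod := by
  induction L with
  | nil => exact Graded.one hΦ
  | cons X L ih =>
    rw [List.prod_cons]
    exact (h X (by simp)).mul hΦ (ih fun Y hY => h Y (by simp [hY]))

theorem Graded.commute_trace (hΦ : ∀ I, Φ I * Φ I = 1) {X : Matrix β β T} (hX : Graded x Φ X) :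
    Commute x X.trace := by
  refine Commute.sum_right _ _ _ fun I _ => ?_
  rw [Matrix.diag_apply, Commute, SemiconjBy, hX, hΦ, one_smul]

end

theorem Graded.qPow {x : T} {φ : Fin n → ℂ} (hφ : ∀ i, φ i * φ i = 1)
    {N : ℕ → Matrix (Fin n) (Fin n) T} (l : ℕ) (hN : ∀ b < l, Graded x φ (N b)) :
    Graded x φ (qPow q N l) := by
  induction l with
  | zero => exact Graded.one hφ
  | succ l ih =>
    have h1 := ih fun b hb => hN b (hb.trans l.lt_succ_self)
    have h2 := hN l l.lt_succ_self
    intro i j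
    simp only [QLax.qPow, qMul, Matrix.of_apply, Finset.mul_sum, Finset.sum_mul, Finset.smul_sum]
    refine Finset.sum_congr rfl fun a _ => ?_
    rw [mul_smul_comm, smul_mul_assoc, smul_comm (φ i * φ j)]
    congr 1
    rw [← mul_assoc, h1, smul_mul_assoc, mul_assoc, h2, mul_smul_comm, smul_smul,
      ← mul_assoc (QLax.qPow q N l i a)]
    congr 1
    linear_combination φ i * φ j * hφ a

theorem Graded.tleg {ι : Type*} [Fintype ι] [DecidableEq ι] {x : T} {φ : Fin n → ℂ}
    (hφ : ∀ i, φ i * φ i = 1) {A : Matrix (Fin n) (Fin n) T} (hA : Graded x φ A) (a : ι) :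
    Graded x (fun I : ι → Fin n => ∏ s, φ (I s)) (tleg a A) := by
  intro I J
  rw [tleg_apply]
  split_ifs with h
  · rw [hA]
    congr 1
    rw [← Finset.prod_mul_distrib, Finset.prod_eq_single a]
    · intro b _ hb
      rw [h b hb, hφ]
    · simp
  · simp

/-- A nonzero entry joins two multi-indices that are permutations of each other; their products of
signs agree and have square 1. -/
theorem Graded.scalar_qAntisymm {x : T} {φ : Fin n → ℂ} (hφ : ∀ i, φ i * φ i = 1) (l : ℕ) :
    Graded x (fun I : Fin l → Fin n => ∏ s, φ (I s)) (scalar T (qAntisymm n l q)) := by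
  have h : ∀ I J : Fin l → Fin n, qAntisymm n l q I J
      = ((∏ s, φ (I s)) * ∏ s, φ (J s)) * qAntisymm n l q I J := by
    intro I J
    simp only [QLax.qAntisymm, Matrix.smul_apply, Matrix.sum_apply, smul_eq_mul, Finset.mul_sum]
    refine Finset.sum_congr rfl fun τ _ => ?_
    by_cases hIJ : I = J ∘ τ.symm
    · have h1 : ∏ s, φ (I s) = ∏ s, φ (J s) := by
        rw [hIJ]
        exact Equiv.prod_comp τ.symm fun s => φ (J s)
      rw [h1, ← Finset.prod_mul_distrib]
      simp [hφ]
    · simp [qPerm, hIJ]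
  intro I J
  simp only [scalar, Matrix.map_apply]
  rw [← Algebra.smul_def', ← Algebra.commutes, ← Algebra.smul_def, smul_smul, ← h]

theorem Graded.commute_antisymmTrace {x : T} {φ : Fin n → ℂ} (hφ : ∀ i, φ i * φ i = 1)
    {N : ℕ → Matrix (Fin n) (Fin n) T} (l : ℕ) (hN : ∀ b < l, Graded x φ (N b)) :
    Commute x (antisymmTrace q N l) := by
  have hΦ : ∀ I : Fin l → Fin n, (∏ s, φ (I s)) * ∏ s, φ (I s) = 1 := fun I => by
    rw [← Finset.prod_mul_distrib]; simp [hφ]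
  rw [antisymmTrace_eq]
  refine Graded.commute_trace hΦ (.mul hΦ (.scalar_qAntisymm hφ l) (.list_prod hΦ fun X hX => ?_))
  obtain ⟨s, -, rfl⟩ := List.mem_map.1 hX
  exact (hN s s.2).tleg hφ s

/-- `φ(k) x N_{kl} = ψ(l) N_{kl} x` for all entries of the first `l` matrices of a sequence. -/
def HasWeight (N : ℕ → Matrix (Fin n) (Fin n) T) (l : ℕ) (φ ψ : Fin n → ℂ) (x : T) : Prop :=
  ∀ b < l, ∀ i j, φ i • (x * N b i j) = ψ j • (N b i j * x)

theorem HasWeight.mul {N : ℕ → Matrix (Fin n) (Fin n) T} {φ ψ φ' ψ' : Fin n → ℂ} {x y : T}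
    (hx : HasWeight N l φ ψ x) (hy : HasWeight N l φ' ψ' y) :
    HasWeight N l (fun i => φ i * φ' i) (fun j => ψ j * ψ' j) (x * y) := by
  intro b hb i j
  calc (φ i * φ' i) • (x * y * N b i j) = φ i • (x * (φ' i • (y * N b i j))) := by
        rw [mul_smul_comm, smul_smul, mul_assoc]
    _ = ψ' j • ((φ i • (x * N b i j)) * y) := by
        rw [hy b hb, mul_smul_comm, smul_comm, smul_mul_assoc, mul_assoc]
    _ = _ := by rw [hx b hb, smul_mul_assoc, smul_smul, mul_assoc, mul_comm (ψ' j)]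

/-- The diagonal coefficients of `R` up to a common factor when `q ^ 2 = 1`. -/
def diagWeight (q : ℂ) (i j : Fin n) : ℂ := if i = j then 1 else q

theorem diagWeight_mul_self (hq2 : q ^ 2 = 1) (i j : Fin n) :
    diagWeight q i j * diagWeight q i j = 1 := by
  unfold diagWeight
  split_ifs
  · exact one_mul 1
  · rw [← sq, hq2]

/-- The entry (i, j) of a quantum power is a combination of monomials along index paths from i to j.
The inner indices of a path enter both sides of the weight equally and form the common factor φ;
only the end points i and j distinguish left from right. -/
theorem qPow_mem_span (hq2 : q ^ 2 = 1) {M N : ℕ → Matrix (Fin n) (Fin n) T} (k : ℕ)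
    (h : ∀ a < k, ∀ i j, HasWeight N l (diagWeight q i) (diagWeight q j) (M a i j))
    (i j : Fin n) :
    qPow q M k i j ∈ Submodule.span ℂ {x : T | ∃ φ : Fin n → ℂ, (∀ r, φ r * φ r = 1) ∧
      HasWeight N l (fun r => φ r * diagWeight q i r) (fun r => φ r * diagWeight q j r) x} := by
  induction k generalizing j with
  | zero =>
    rw [qPow, Matrix.one_apply]
    split_ifs with hij
    · subst hij
      -- The unit has trivial weights, so φ must cancel the weight of the end point i; the weight is
      -- its own inverse.
      refine Submodule.subset_span ⟨diagWeight q i, diagWeight_mul_self hq2 i, ?_⟩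
      intro b _ r s
      simp only [diagWeight_mul_self hq2, one_mul, mul_one]
    · exact Submodule.zero_mem _
  | succ k ih =>
    simp only [qPow, qMul, Matrix.of_apply]
    refine Submodule.sum_mem _ fun a _ => Submodule.smul_mem _ _ ?_
    have h1 := ih (fun b hb => h b (hb.trans k.lt_succ_self)) a
    have h2 := h k k.lt_succ_self a j
    generalize qPow q M k i a = y at h1 ⊢
    induction h1 using Submodule.span_induction with
    | mem x hx =>
      obtain ⟨φ, hφ, hw⟩ := hx
      -- The index a, until now the end of the path, becomes an inner one and its weight joins φ.
      refine Submodule.subset_span ⟨fun r => φ r * diagWeight q a r, fun r => ?_, ?_⟩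
      · linear_combination diagWeight q a r * diagWeight q a r * hφ r
          + diagWeight_mul_self hq2 a r
      · have := hw.mul h2
        simpa only [mul_right_comm] using this
    | zero => rw [zero_mul]; exact Submodule.zero_mem _
    | add x y _ _ hx hy => rw [add_mul]; exact Submodule.add_mem _ hx hy
    | smul c x _ hx => rw [smul_mul_assoc]; exact Submodule.smul_mem _ _ hx

/-- On the diagonal the left and right weights coincide and square to 1, which turns `HasWeight`
into `Graded`. -/
theorem qPowTrace_commute_of_weights (hq2 : q ^ 2 = 1) {M N : ℕ → Matrix (Fin n) (Fin n) T}
    (h : ∀ a < k, ∀ i j, HasWeight N l (diagWeight q i) (diagWeight q j) (M a i j)) {y : T}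
    (hy : ∀ (x : T) (φ : Fin n → ℂ), (∀ r, φ r * φ r = 1) → (∀ b < l, Graded x φ (N b)) →
      Commute x y) : Commute (qPowTrace q M k) y := by
  rw [qPowTrace, Matrix.trace]
  refine Commute.sum_left _ _ _ fun i _ => ?_
  rw [Matrix.diag_apply]
  have h1 := qPow_mem_span hq2 k h i i
  generalize qPow q M k i i = z at h1 ⊢
  induction h1 using Submodule.span_induction with
  | mem x hx =>
    obtain ⟨φ, hφ, hw⟩ := hx
    have hφ' : ∀ r, (φ r * diagWeight q i r) * (φ r * diagWeight q i r) = 1 := fun r => by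
      linear_combination diagWeight q i r * diagWeight q i r * hφ r + diagWeight_mul_self hq2 i r
    refine hy x _ hφ' fun b hb r s => ?_
    have h2 := congrArg ((φ r * diagWeight q i r) • ·) (hw b hb r s)
    simpa only [smul_smul, hφ', one_smul] using h2
  | zero => exact Commute.zero_left y
  | add x y _ _ hx hy => exact hx.add_left hy
  | smul c x _ hx => exact hx.smul_left c

end Graded

/-! ### The commutation theorem for sequences of matrices -/

section Sequences

variable {T : Type*} [Ring T] [Algebra ℂ T] {n : ℕ} {K : Type*} [CommRing K] [Algebra K T]
  [Algebra ℂ K] [IsScalarTower ℂ K T] {k l : ℕ} {q : ℂ}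

theorem isAntisymmetric_of_RLL (hq : q ≠ 0) (hq2 : q ^ 2 ≠ 1)
    {M : ℕ → Matrix (Fin n) (Fin n) T} {u : ℕ → K} (hu0 : ∀ i < k, IsUnit (u i))
    (hu : ∀ i, i + 1 < k → u (i + 1) = algebraMap ℂ K q ^ 2 * u i)
    (hM : ∀ i, i + 1 < k → RLL (algebraMap ℂ K q) (u i) (u (i + 1)) (M i) (M (i + 1))) :
    IsAntisymmetric q M k := by
  intro σ
  have h := altOf_mul_rep _ (legProd_kill hq hq2 Function.injective_id hu0 hu hM) σ
  rwa [← emb_scalar_qAntisymm, repOp_apply, emb_id, emb_id] at h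

/-- For q² = 1 the permuting part of the `R`-matrix vanishes and its diagonal is u - v times
`diagWeight`. The hypothesis `hR` then says that (u - v)² is a unit, so u - v can be cancelled. -/
theorem weight_of_RLL (hq2 : q ^ 2 = 1) {u v : K} {A B : Matrix (Fin n) (Fin n) T}
    (hR : IsUnit ((algebraMap ℂ K q ^ 2 * u - v) * (u - algebraMap ℂ K q ^ 2 * v)))
    (h : RLL (algebraMap ℂ K q) u v A B) (i j r s : Fin n) :
    diagWeight q i r • (A i j * B r s) = diagWeight q j s • (B r s * A i j) := by
  have hQ : algebraMap ℂ K q ^ 2 = 1 := by rw [← map_pow, hq2, map_one]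
  have hd : ∀ i j : Fin n, rDiag (algebraMap ℂ K q) u v i j
      = (u - v) * algebraMap ℂ K (diagWeight q i j) := fun i j => by
    unfold rDiag diagWeight
    rw [hQ]
    split_ifs
    · simp
    · ring
  have hp : ∀ i j : Fin n, rPerm (algebraMap ℂ K q) u v i j = 0 := fun i j => by
    simp [rPerm, hQ]
  rw [hQ, one_mul, one_mul] at hR
  obtain ⟨c, hc⟩ := isUnit_of_mul_isUnit_left hR
  have h1 := h i j r s
  simp only [hd, hp, zero_smul, add_zero, mul_smul, algebraMap_smul, ← hc] at h1
  have h2 := congrArg ((↑c⁻¹ : K) • ·) h1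
  simpa only [smul_smul, ← mul_assoc, Units.inv_mul, one_smul] using h2

/-- The relations within each sequence serve only for fusion, and for q² = 1 consecutive parameters
coincide; they are therefore demanded only when q² ≠ 1. In that case all transfer functions of
segments of `M` and `N` commute, and the Newton identities are applied first to `M` and then to `N`.
-/
theorem commute_of_RLL (hq : q ≠ 0) {M N : ℕ → Matrix (Fin n) (Fin n) T} {u v : ℕ → K}
    (hu0 : ∀ i < k, IsUnit (u i)) (hv0 : ∀ j < l, IsUnit (v j))
    (hu : ∀ i, i + 1 < k → u (i + 1) = algebraMap ℂ K q ^ 2 * u i)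
    (hv : ∀ j, j + 1 < l → v (j + 1) = algebraMap ℂ K q ^ 2 * v j)
    (hM : q ^ 2 ≠ 1 → ∀ i, i + 1 < k →
      RLL (algebraMap ℂ K q) (u i) (u (i + 1)) (M i) (M (i + 1)))
    (hN : q ^ 2 ≠ 1 → ∀ j, j + 1 < l →
      RLL (algebraMap ℂ K q) (v j) (v (j + 1)) (N j) (N (j + 1)))
    (hR : ∀ i < k, ∀ j < l, IsUnit ((algebraMap ℂ K q ^ 2 * u i - v j)
      * (u i - algebraMap ℂ K q ^ 2 * v j)))
    (hMN : ∀ i < k, ∀ j < l, RLL (algebraMap ℂ K q) (u i) (v j) (M i) (N j)) :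
    Commute (qPowTrace q M k) (qPowTrace q N l) ∧
      Commute (qPowTrace q M k) (antisymmTrace q N l) := by
  by_cases hq2 : q ^ 2 = 1
  · have hw : ∀ a < k, ∀ i j, HasWeight N l (diagWeight q i) (diagWeight q j) (M a i j) :=
      fun a ha i j b hb r s => weight_of_RLL hq2 (hR a ha b hb) (hMN a ha b hb) i j r s
    exact ⟨qPowTrace_commute_of_weights hq2 hw fun x φ hφ hx =>
        Graded.commute_trace hφ (.qPow hφ l hx),
      qPowTrace_commute_of_weights hq2 hw fun x φ hφ hx =>
        Graded.commute_antisymmTrace hφ l hx⟩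
  · have hMa : ∀ s i, s + i ≤ k → IsAntisymmetric q (fun a => M (s + a)) i := fun s i hs =>
      isAntisymmetric_of_RLL (u := fun a => u (s + a)) hq hq2 (fun a ha => hu0 _ (by omega))
        (fun a ha => hu (s + a) (by omega)) (fun a ha => hM hq2 (s + a) (by omega))
    have hNa : ∀ s i, s + i ≤ l → IsAntisymmetric q (fun a => N (s + a)) i := fun s i hs =>
      isAntisymmetric_of_RLL (u := fun a => v (s + a)) hq hq2 (fun a ha => hv0 _ (by omega))
        (fun a ha => hv (s + a) (by omega)) (fun a ha => hN hq2 (s + a) (by omega))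
    have htt : ∀ s i, s + i ≤ k → ∀ s' j, s' + j ≤ l →
        Commute (antisymmTrace q (fun a => M (s + a)) i)
          (antisymmTrace q (fun a => N (s' + a)) j) := fun s i hs s' j hs' =>
      transfer_commute (u := fun a => u (s + a)) (v := fun a => v (s' + a)) hq hq2
        (fun a ha => hu0 _ (by omega)) (fun a ha => hv0 _ (by omega))
        (fun a ha => hu (s + a) (by omega)) (fun a ha => hv (s' + a) (by omega))
        (fun a ha => hM hq2 (s + a) (by omega)) (fun a ha => hN hq2 (s' + a) (by omega))
        (fun a ha b hb => hR _ (by omega) _ (by omega))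
        (fun a ha b hb => hMN _ (by omega) _ (by omega))
    have hIt : ∀ s' j, s' + j ≤ l →
        Commute (qPowTrace q M k) (antisymmTrace q (fun a => N (s' + a)) j) := fun s' j hs' =>
      qPowTrace_commute hq k M hMa fun s i hs => htt s i hs s' j hs'
    refine ⟨(qPowTrace_commute hq l N hNa fun s' j hs' => (hIt s' j hs').symm).symm, ?_⟩
    simpa using hIt 0 l (by omega)

end Sequences

/-! ### Entries of the `R`-matrix -/

section Entries

variable {S : Type*} [Ring S] [Algebra ℂ S] {n : ℕ} {q : ℂ}

theorem E_apply (i j a b : Fin n) : E i j a b = if a = i ∧ b = j then 1 else 0 := by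
  simp only [E, Matrix.single_apply, eq_comm]

/-- Identifies the tensor form of the `R`-matrix with the coefficients `rDiag` and `rPerm`; the
factor q clears q⁻¹, so that they are polynomial in q. -/
theorem mul_Rnum_apply (hq : q ≠ 0) (u v : ℂ) (i k a b : Fin n) :
    q * Rnum n q u v (i, k) (a, b)
      = (if (a, b) = (i, k) then rDiag q u v i k else 0)
        + (if (a, b) = (k, i) then rPerm q u v i k else 0) := by
  have h1 : (∑ x : Fin n, (E x x ⊗ₖ E x x)) (i, k) (a, b)
      = if i = k ∧ a = i ∧ b = k then (1 : ℂ) else 0 := by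
    rw [Matrix.sum_apply, Finset.sum_eq_single i]
    · simp only [Matrix.kronecker_apply, E_apply]
      grind
    · intro x _ hx
      simp [E_apply, hx.symm]
    · simp
  have h2 : (∑ x : Fin n, ∑ y : Fin n, (if x ≠ y then E x x ⊗ₖ E y y else 0)) (i, k) (a, b)
      = if i ≠ k ∧ a = i ∧ b = k then (1 : ℂ) else 0 := by
    rw [Matrix.sum_apply, Finset.sum_eq_single i]
    · rw [Matrix.sum_apply, Finset.sum_eq_single k]
      · by_cases h : i = k
        · simp [h]
        · simp only [ne_eq, h, not_false_eq_true, if_true, Matrix.kronecker_apply, E_apply]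
          split_ifs <;> simp_all
      · intro y _ hy
        split_ifs
        · simp [E_apply, hy.symm]
        · rfl
      · simp
    · intro x _ hx
      rw [Matrix.sum_apply]
      refine Finset.sum_eq_zero fun y _ => ?_
      split_ifs
      · simp [E_apply, hx.symm]
      · rfl
    · simp
  have h3 : (∑ x : Fin n, ∑ y : Fin n,
        (if x < y then u • (E x y ⊗ₖ E y x) + v • (E y x ⊗ₖ E x y) else 0)) (i, k) (a, b)
      = if a = k ∧ b = i then (if i < k then u else if k < i then v else 0) else 0 := by
    have e : ∀ x y : Fin n,
        (if x < y then u • (E x y ⊗ₖ E y x) + v • (E y x ⊗ₖ E x y) else 0) (i, k) (a, b)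
        = (if x = i then if y = k then if x < y ∧ a = k ∧ b = i then u else 0 else 0 else 0)
          + (if x = k then if y = i then if x < y ∧ a = k ∧ b = i then v else 0 else 0
            else 0) := by
      intro x y
      split_ifs <;> simp_all [E_apply] <;> grind
    simp only [Matrix.sum_apply, e, Finset.sum_add_distrib]
    simp only [Finset.sum_ite_irrel, Finset.sum_ite_eq', Finset.mem_univ, if_true,
      Finset.sum_const_zero]
    grind
  rw [Rnum, Matrix.add_apply, Matrix.add_apply, Matrix.smul_apply, Matrix.smul_apply,
    Matrix.smul_apply, h1, h2, h3]
  simp only [smul_eq_mul, rDiag, rPerm, Prod.mk.injEq]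
  have hqq : q * q⁻¹ = 1 := mul_inv_cancel₀ hq
  by_cases hik : i = k
  · subst hik
    simp only [true_and, lt_irrefl, if_false, ne_eq, not_true, false_and, if_true]
    split_ifs
    · linear_combination -v * hqq
    · ring
  · simp only [hik, false_and, if_false, ne_eq, not_false_eq_true, true_and]
    rcases lt_or_gt_of_ne hik with h | h
    · simp only [h, if_true]
      split_ifs <;> first | ring1 | linear_combination -u * hqq
    · simp only [h, h.not_gt, if_true, if_false]
      split_ifs <;> first | ring1 | linear_combination -v * hqq

theorem smul_Rnum_mul_apply (hq : q ≠ 0) (u v : ℂ)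
    (X : Matrix (Fin n × Fin n) (Fin n × Fin n) S) (i k : Fin n) (r : Fin n × Fin n) :
    q • (scalar S (Rnum n q u v) * X) (i, k) r
      = rDiag q u v i k • X (i, k) r + rPerm q u v i k • X (k, i) r := by
  have h : ∀ s : Fin n × Fin n, q • (algebraMap ℂ S (Rnum n q u v (i, k) s) * X s r)
      = (if s = (i, k) then rDiag q u v i k • X s r else 0)
        + (if s = (k, i) then rPerm q u v i k • X s r else 0) := by
    rintro ⟨a, b⟩
    rw [← Algebra.smul_def, smul_smul, mul_Rnum_apply hq, add_smul, ite_smul, ite_smul, zero_smul]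
  simp only [Matrix.mul_apply, Finset.smul_sum, scalar, Matrix.map_apply, h,
    Finset.sum_add_distrib, Finset.sum_ite_eq', Finset.mem_univ, if_true]

theorem smul_mul_Rnum_apply (hq : q ≠ 0) (u v : ℂ)
    (X : Matrix (Fin n × Fin n) (Fin n × Fin n) S) (r : Fin n × Fin n) (j l : Fin n) :
    q • (X * scalar S (Rnum n q u v)) r (j, l)
      = rDiag q u v j l • X r (j, l) + rPerm q u v l j • X r (l, j) := by
  have h : ∀ s : Fin n × Fin n, q • (X r s * algebraMap ℂ S (Rnum n q u v s (j, l)))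
      = (if s = (j, l) then rDiag q u v j l • X r s else 0)
        + (if s = (l, j) then rPerm q u v l j • X r s else 0) := by
    rintro ⟨a, b⟩
    rw [← Algebra.commutes, ← Algebra.smul_def, smul_smul, mul_Rnum_apply hq, add_smul, ite_smul,
      ite_smul, zero_smul]
    congr 1
    · refine if_ctx_congr ?_ (fun h => ?_) fun _ => rfl
      · rw [eq_comm]
      · obtain ⟨rfl, rfl⟩ := Prod.mk.inj h; rfl
    · refine if_ctx_congr ?_ (fun h => ?_) fun _ => rfl
      · simp only [Prod.mk.injEq]; tauto
      · obtain ⟨rfl, rfl⟩ := Prod.mk.inj h; rfl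
  simp only [Matrix.mul_apply, Finset.smul_sum, scalar, Matrix.map_apply, h,
    Finset.sum_add_distrib, Finset.sum_ite_eq', Finset.mem_univ, if_true]

theorem kronecker_one_mul_apply (A B : Matrix (Fin n) (Fin n) S) (i k j l : Fin n) :
    ((A ⊗ₖ (1 : Matrix (Fin n) (Fin n) S)) * ((1 : Matrix (Fin n) (Fin n) S) ⊗ₖ B)) (i, k) (j, l)
      = A i j * B k l := by
  rw [Matrix.mul_apply, Fintype.sum_prod_type]
  simp [Matrix.one_apply]

theorem one_kronecker_mul_apply (A B : Matrix (Fin n) (Fin n) S) (i k j l : Fin n) :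
    (((1 : Matrix (Fin n) (Fin n) S) ⊗ₖ B) * (A ⊗ₖ (1 : Matrix (Fin n) (Fin n) S))) (i, k) (j, l)
      = B k l * A i j := by
  rw [Matrix.mul_apply, Fintype.sum_prod_type]
  simp [Matrix.one_apply]

theorem scalar_smul {ι κ : Type*} (c : ℂ) (X : Matrix ι κ ℂ) :
    scalar S (c • X) = c • scalar S X := by
  ext I J
  change algebraMap ℂ S (c * X I J) = c • algebraMap ℂ S (X I J)
  rw [map_mul, Algebra.smul_def]

end Entries

/-! ### Functions of a complex parameter -/

section Functions

variable {S : Type*} [Ring S] [Algebra ℂ S] {n : ℕ} {q : ℂ}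

theorem RLLOn.rll (hq : q ≠ 0) {D : Set ℂ} {L : ℂ → Matrix (Fin n) (Fin n) S}
    (h : RLLOn q D L) (h0 : (0 : ℂ) ∉ D) {z w : ℂ} (hz : z ∈ D) (hw : w ∈ D) (hzw : z ≠ w) :
    RLL q z w (L z) (L w) := by
  have h1 := congrArg (fun X => (z - w) • X) (h z hz w hw hzw)
  have hw0 : w ≠ 0 := by rintro rfl; exact h0 hw
  simp only at h1
  rw [mul_assoc, ← smul_mul_assoc, ← mul_smul_comm, ← scalar_smul, smul_Rmat_div n q z w hw0 hzw]
    at h1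
  intro i j k l
  have h2 := congrArg (fun X => q • X (i, k) (j, l)) h1
  simp only [smul_Rnum_mul_apply hq, smul_mul_Rnum_apply hq, kronecker_one_mul_apply,
    one_kronecker_mul_apply] at h2
  exact h2

/-- The excluded values of w are exactly those that `hpair` must avoid: c + i - j with |c| ≤ 1, i <
k, j < l stays between -l and k. -/
theorem commute_of_RLLOn (hq : q ≠ 0) {D : Set ℂ} {L : ℂ → Matrix (Fin n) (Fin n) S}
    (h0 : (0 : ℂ) ∉ D) (h : RLLOn q D L) {k l : ℕ} {z w : ℂ}
    (hz : ∀ i < k, q ^ (2 * i) * z ∈ D) (hw : ∀ j < l, q ^ (2 * j) * w ∈ D)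
    (hzw : ∀ s : ℤ, -(l : ℤ) ≤ s → s ≤ k → w ≠ q ^ (2 * s) * z) :
    Commute (I q L k z) (I q L l w) ∧ Commute (I q L k z) (t q L l w) := by
  have hne : ∀ x ∈ D, x ≠ 0 := by rintro x hx rfl; exact h0 hx
  have hshift : ∀ (x : ℂ) (i : ℕ), q ^ (2 * (i + 1)) * x = q ^ 2 * (q ^ (2 * i) * x) := by
    intro x i; ring
  have hnext : q ^ 2 ≠ 1 → ∀ (x : ℂ) (i : ℕ), q ^ (2 * i) * x ≠ 0 →
      q ^ (2 * i) * x ≠ q ^ (2 * (i + 1)) * x := by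
    intro hq2 x i hx he
    rw [hshift] at he
    exact hq2 (mul_right_cancel₀ hx (by rw [← he, one_mul]))
  -- The case c = 0 makes the two points distinct, so that the RLL relation is available; c = ±1
  -- makes the `R`-matrix between them invertible.
  have hpair : ∀ i < k, ∀ j < l, ∀ c : ℤ, -1 ≤ c → c ≤ 1 →
      q ^ (2 * c) * (q ^ (2 * i) * z) ≠ q ^ (2 * j) * w := by
    intro i hi j hj c hc1 hc2 he
    refine hzw (c + i - j) (by omega) (by omega) ?_
    have h1 : q ^ (2 * (c + i - j) : ℤ) * q ^ (2 * j) = q ^ (2 * c) * q ^ (2 * i) := by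
      rw [← zpow_natCast q (2 * j), ← zpow_natCast q (2 * i), ← zpow_add₀ hq, ← zpow_add₀ hq]
      congr 1
      push_cast
      ring
    refine mul_left_cancel₀ (pow_ne_zero (2 * j) hq) ?_
    rw [← he]
    linear_combination -z * h1
  refine commute_of_RLL (K := ℂ) (u := fun i => q ^ (2 * i) * z) (v := fun j => q ^ (2 * j) * w)
    hq (fun i hi => (hne _ (hz i hi)).isUnit) (fun j hj => (hne _ (hw j hj)).isUnit)
    (fun i _ => hshift z i) (fun j _ => hshift w j)
    (fun hq2 i hi => h.rll hq h0 (hz i (by omega)) (hz (i + 1) hi)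
      (hnext hq2 z i (hne _ (hz i (by omega)))))
    (fun hq2 j hj => h.rll hq h0 (hw j (by omega)) (hw (j + 1) hj)
      (hnext hq2 w j (hne _ (hw j (by omega)))))
    (fun i hi j hj => ?_) (fun i hi j hj => h.rll hq h0 (hz i hi) (hw j hj) ?_)
  · simp only [Algebra.algebraMap_self, RingHom.id_apply]
    refine (mul_ne_zero (sub_ne_zero.2 ?_) (sub_ne_zero.2 fun he => ?_)).isUnit
    · simpa using! hpair i hi j hj 1 (by norm_num) (by norm_num)
    · refine hpair i hi j hj (-1) (by norm_num) (by norm_num) ?_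
      rw [he, ← mul_assoc, show (2 * (-1) : ℤ) = -((2 : ℕ) : ℤ) by norm_num, zpow_neg,
        zpow_natCast, inv_mul_cancel₀ (pow_ne_zero 2 hq), one_mul]
  · simpa using hpair i hi j hj 0 (by norm_num) (by norm_num)

end Functions

/-! ### Continuous functions -/

section Continuous

variable {S : Type*} [Ring S] [Algebra ℂ S] [TopologicalSpace S] [IsTopologicalRing S]
  {n : ℕ} {q : ℂ} {α : Type*} {f : Filter α}

open Filter Topology

/-- No topology relating ℂ and `S` is needed: a fixed scalar acts as multiplication by a fixed
element of the ring. -/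
theorem tendsto_complex_smul {g : α → S} {x : S} (c : ℂ) (h : Tendsto g f (𝓝 x)) :
    Tendsto (fun a => c • g a) f (𝓝 (c • x)) := by
  simp only [Algebra.smul_def]
  exact h.const_mul _

theorem tendsto_qPow {M : α → ℕ → Matrix (Fin n) (Fin n) S} {N : ℕ → Matrix (Fin n) (Fin n) S}
    (l : ℕ) (h : ∀ s < l, Tendsto (fun a => M a s) f (𝓝 (N s))) :
    Tendsto (fun a => qPow q (M a) l) f (𝓝 (qPow q N l)) := by
  induction l with
  | zero => exact tendsto_const_nhds
  | succ l ih =>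
    have h1 := ih fun s hs => h s (hs.trans l.lt_succ_self)
    have h2 := h l l.lt_succ_self
    refine tendsto_pi_nhds.2 fun i => tendsto_pi_nhds.2 fun k => ?_
    simp only [qPow, qMul, Matrix.of_apply]
    refine tendsto_finsetSum _ fun j _ => tendsto_complex_smul (S := S) _ ?_
    have h3 : Tendsto (fun a => qPow q (M a) l i j) f (𝓝 (qPow q N l i j)) :=
      (tendsto_pi_nhds.1 ((tendsto_pi_nhds.1 h1) i)) j
    have h4 : Tendsto (fun a => M a l j k) f (𝓝 (N l j k)) :=
      (tendsto_pi_nhds.1 ((tendsto_pi_nhds.1 h2) j)) k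
    exact h3.mul h4

theorem tendsto_trace {ι : Type*} [Fintype ι] {M : α → Matrix ι ι S} {N : Matrix ι ι S}
    (h : Tendsto M f (𝓝 N)) : Tendsto (fun a => (M a).trace) f (𝓝 N.trace) :=
  tendsto_finsetSum _ fun i _ => (tendsto_pi_nhds.1 ((tendsto_pi_nhds.1 h) i)) i

theorem tendsto_antisymmTrace {M : α → ℕ → Matrix (Fin n) (Fin n) S}
    {N : ℕ → Matrix (Fin n) (Fin n) S} (l : ℕ)
    (h : ∀ s < l, Tendsto (fun a => M a s) f (𝓝 (N s))) :
    Tendsto (fun a => antisymmTrace q (M a) l) f (𝓝 (antisymmTrace q N l)) := by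
  simp only [antisymmTrace_eq]
  refine tendsto_trace (Tendsto.mul tendsto_const_nhds ?_)
  refine tendsto_list_prod _ fun s _ => ?_
  refine tendsto_pi_nhds.2 fun I => tendsto_pi_nhds.2 fun J => ?_
  simp only [tleg_apply]
  split_ifs
  · exact (tendsto_pi_nhds.1 ((tendsto_pi_nhds.1 (h s s.2)) _)) _
  · exact tendsto_const_nhds

theorem commute_of_tendsto [T2Space S] [f.NeBot] {x : S} {g : α → S} {y : S}
    (h : Tendsto g f (𝓝 y)) (hc : ∀ᶠ a in f, Commute x (g a)) : Commute x y :=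
  tendsto_nhds_unique_of_eventuallyEq (h.const_mul x) (h.mul_const x) hc

theorem commute_of_continuousOn [T2Space S] (hq : q ≠ 0) {D : Set ℂ}
    {L : ℂ → Matrix (Fin n) (Fin n) S} (hD : IsOpen D) (h0 : (0 : ℂ) ∉ D)
    (hL : ContinuousOn L D) (h : RLLOn q D L) {k l : ℕ} {z w : ℂ}
    (hz : ∀ i < k, q ^ (2 * i) * z ∈ D) (hw : ∀ j < l, q ^ (2 * j) * w ∈ D) :
    Commute (I q L k z) (I q L l w) ∧ Commute (I q L k z) (t q L l w) := by
  -- The exceptional values of w form a finite set. With z fixed, w is approached through the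
  -- complement, and commuting with a fixed element is a closed condition.
  set B : Set ℂ := (fun s : ℤ => q ^ (2 * s) * z) '' Set.Icc (-(l : ℤ)) k with hB
  have hBf : B.Finite := (Set.finite_Icc _ _).image _
  have hdense : Dense Bᶜ := hBf.countable.dense_compl ℝ
  have : (𝓝[Bᶜ] w).NeBot := mem_closure_iff_nhdsWithin_neBot.1 (hdense w)
  have hcont : ∀ j < l, Tendsto (fun w' : ℂ => q ^ (2 * j) * w') (𝓝[Bᶜ] w)
      (𝓝 (q ^ (2 * j) * w)) := fun j _ =>
    ((continuous_const_mul (q ^ (2 * j))).tendsto w).mono_left nhdsWithin_le_nhds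
  have hLt : ∀ j < l, Tendsto (fun w' : ℂ => L (q ^ (2 * j) * w')) (𝓝[Bᶜ] w)
      (𝓝 (L (q ^ (2 * j) * w))) := fun j hj =>
    (hL.continuousAt (hD.mem_nhds (hw j hj))).tendsto.comp (hcont j hj)
  have hev : ∀ᶠ w' in 𝓝[Bᶜ] w, ∀ j < l, q ^ (2 * j) * w' ∈ D :=
    (Set.finite_Iio l).eventually_all.2 fun j hj => (hcont j hj).eventually (hD.mem_nhds (hw j hj))
  have hcomm : ∀ᶠ w' in 𝓝[Bᶜ] w,
      Commute (I q L k z) (I q L l w') ∧ Commute (I q L k z) (t q L l w') := by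
    filter_upwards [hev, self_mem_nhdsWithin] with w' h1 h2
    refine commute_of_RLLOn hq h0 h hz h1 fun s hs1 hs2 he => h2 ⟨s, ⟨hs1, hs2⟩, he.symm⟩
  exact ⟨commute_of_tendsto (tendsto_trace (tendsto_qPow l hLt)) (hcomm.mono fun _ h => h.1),
    commute_of_tendsto (tendsto_antisymmTrace l hLt) (hcomm.mono fun _ h => h.2)⟩

end Continuous

/-! ### The defect of an exchange relation -/

section Defect

variable {S : Type*} [Ring S] [Algebra ℂ S] {n : ℕ} {q : ℂ}

/-- The entries of `q R L⁽¹⁾ L⁽²⁾ - q L⁽²⁾ L⁽¹⁾ R` for the homogeneous `R`-matrix `R` with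
parameters `u, v`. -/
def defect (q u v : ℂ) (A B : Matrix (Fin n) (Fin n) S) (i j k l : Fin n) : S :=
  rDiag q u v i k • (A i j * B k l) + rPerm q u v i k • (A k j * B i l)
    - (rDiag q u v j l • (B k l * A i j) + rPerm q u v l j • (B k j * A i l))

theorem defect_smul (u v c d : ℂ) (A B : Matrix (Fin n) (Fin n) S) (i j k l : Fin n) :
    defect q u v (c • A) (d • B) i j k l = (c * d) • defect q u v A B i j k l := by
  simp only [defect, Matrix.smul_apply, smul_sub, smul_add, smul_mul_smul_comm]
  simp only [smul_comm (c * d), mul_comm d c]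

theorem map_defect {T : Type*} [Ring T] [Algebra ℂ T] (φ : S →ₐ[ℂ] T) (u v : ℂ)
    (A B : Matrix (Fin n) (Fin n) S) (i j k l : Fin n) :
    defect q u v (A.map φ) (B.map φ) i j k l = φ (defect q u v A B i j k l) := by
  simp [defect]

/-- The homogeneous `R`-matrix is linear in (u, v), so the parameters can be taken out; for series
they then act as shifts of coefficients. -/
theorem RLL_iff_defect {K : Type*} [CommRing K] [Algebra K S] [Algebra ℂ K] [IsScalarTower ℂ K S]
    (u v : K) (A B : Matrix (Fin n) (Fin n) S) :
    RLL (algebraMap ℂ K q) u v A B ↔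
      ∀ i j k l, u • defect q 1 0 A B i j k l + v • defect q 0 1 A B i j k l = 0 := by
  have h1 : ∀ (i j : Fin n) (X : S), rDiag (algebraMap ℂ K q) u v i j • X
      = u • rDiag q 1 0 i j • X + v • rDiag q 0 1 i j • X := fun i j X => by
    rw [← algebraMap_smul K (rDiag q 1 0 i j), ← algebraMap_smul K (rDiag q 0 1 i j), smul_smul,
      smul_smul, ← add_smul]
    congr 1
    simp only [rDiag]
    split_ifs <;> simp <;> ring
  have h2 : ∀ (i j : Fin n) (X : S), rPerm (algebraMap ℂ K q) u v i j • X
      = u • rPerm q 1 0 i j • X + v • rPerm q 0 1 i j • X := fun i j X => by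
    rw [← algebraMap_smul K (rPerm q 1 0 i j), ← algebraMap_smul K (rPerm q 0 1 i j), smul_smul,
      smul_smul, ← add_smul]
    congr 1
    simp only [rPerm]
    split_ifs <;> simp <;> ring
  refine forall₄_congr fun i j k l => ?_
  rw [← sub_eq_zero]
  refine Eq.congr_left ?_
  simp only [defect, h1, h2, smul_sub, smul_add]
  abel

theorem RLL_of_defect {K : Type*} [CommRing K] [Algebra K S] [Algebra ℂ K] [IsScalarTower ℂ K S]
    {α β : ℂ} (X : K) {A B : Matrix (Fin n) (Fin n) S}
    (h : ∀ i j k l, α • defect q 1 0 A B i j k l + β • defect q 0 1 A B i j k l = 0) :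
    RLL (algebraMap ℂ K q) (algebraMap ℂ K α * X) (algebraMap ℂ K β * X) A B := by
  refine (RLL_iff_defect _ _ _ _).2 fun i j k l => ?_
  rw [mul_comm, mul_comm _ X, mul_smul, mul_smul, ← smul_add, algebraMap_smul, algebraMap_smul,
    h, smul_zero]

end Defect

/-! ### Formal series -/

section Formal

variable {R S : Type*} [Ring R] [Ring S] [Algebra ℂ S] {n : ℕ} {q : ℂ}

/-- The ring homomorphism of Laurent series induced by one of coefficients. -/
def seriesMap (φ : R →+* S) : LaurentSeries R →+* LaurentSeries S where
  toFun f := f.map φ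
  map_one' := HahnSeries.map_one φ.toMonoidWithZeroHom
  map_mul' _ _ := HahnSeries.map_mul φ.toNonUnitalRingHom
  map_zero' := HahnSeries.map_zero φ.toMonoidWithZeroHom.toZeroHom
  map_add' _ _ := HahnSeries.map_add φ.toAddMonoidHom

theorem commute_of_coeff {f g : LaurentSeries R} (h : ∀ a b, Commute (f.coeff a) (g.coeff b)) :
    Commute f g := by
  ext N
  rw [HahnSeries.coeff_mul, HahnSeries.coeff_mul]
  refine Finset.sum_nbij' Prod.swap Prod.swap ?_ ?_ ?_ ?_ ?_
  · rintro ⟨a, b⟩ hab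
    simp only [Finset.mem_antidiagonal, Prod.fst_swap, Prod.snd_swap] at hab ⊢
    exact ⟨hab.2.1, hab.1, by rw [add_comm]; exact hab.2.2⟩
  · rintro ⟨a, b⟩ hab
    simp only [Finset.mem_antidiagonal, Prod.fst_swap, Prod.snd_swap] at hab ⊢
    exact ⟨hab.2.1, hab.1, by rw [add_comm]; exact hab.2.2⟩
  · simp
  · simp
  · rintro ⟨a, b⟩ _
    exact h a b

theorem coeff_mul_eq_sum {f g : LaurentSeries R} {N m : ℤ} {s : Finset ℤ}
    (hs : Finset.Icc m (N - m) ⊆ s) (hf : ∀ p < m, f.coeff p = 0) (hg : ∀ p < m, g.coeff p = 0) :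
    (f * g).coeff N = ∑ p ∈ s, f.coeff p * g.coeff (N - p) := by
  rw [HahnSeries.coeff_mul]
  refine Finset.sum_of_injOn Prod.fst ?_ ?_ ?_ ?_
  · rintro ⟨a, b⟩ hab ⟨c, d⟩ hcd h
    simp only [Finset.mem_coe, Finset.mem_antidiagonal] at hab hcd h
    ext <;> simp <;> omega
  · rintro ⟨a, b⟩ hab
    simp only [Finset.mem_coe, Finset.mem_antidiagonal, HahnSeries.mem_support] at hab
    have h1 : m ≤ a := not_lt.1 fun h => hab.1 (hf a h)
    have h2 : m ≤ b := not_lt.1 fun h => hab.2.1 (hg b h)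
    exact hs (Finset.mem_Icc.2 ⟨h1, by simp only; omega⟩)
  · intro p _ hp
    by_contra h
    refine hp ⟨(p, N - p), ?_, rfl⟩
    simp only [Finset.mem_coe, Finset.mem_antidiagonal, HahnSeries.mem_support]
    exact ⟨left_ne_zero_of_mul h, right_ne_zero_of_mul h, by ring⟩
  · rintro ⟨a, b⟩ hab
    simp only [Finset.mem_antidiagonal] at hab
    rw [show N - a = b by omega]

theorem coeff_mul_eq_sum' {f g : LaurentSeries R} {N m : ℤ} {s : Finset ℤ}
    (hs : Finset.Icc m (N - m) ⊆ s) (hf : ∀ p < m, f.coeff p = 0) (hg : ∀ p < m, g.coeff p = 0) :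
    (g * f).coeff N = ∑ p ∈ s, g.coeff (N - p) * f.coeff p := by
  have h1 : Finset.Icc m (N - m) ⊆ s.image (N - ·) := fun p hp => by
    rw [Finset.mem_Icc] at hp
    exact Finset.mem_image.2 ⟨N - p, hs (Finset.mem_Icc.2 ⟨by omega, by omega⟩), by omega⟩
  rw [coeff_mul_eq_sum h1 hg hf, Finset.sum_image fun a _ b _ h => by simpa using h]
  simp only [sub_sub_cancel]

/-- The matrix of the coefficients at `x ^ p`. -/
abbrev coeffMatrix (L : Matrix (Fin n) (Fin n) (LaurentSeries S)) (p : ℤ) :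
    Matrix (Fin n) (Fin n) S :=
  L.map fun f => f.coeff p

theorem exists_coeffMatrix_eq_zero (L : Matrix (Fin n) (Fin n) (LaurentSeries S)) :
    ∃ m : ℤ, ∀ i j, ∀ p < m, (L i j).coeff p = 0 := by
  obtain ⟨m, hm⟩ := (Set.finite_range fun x : Fin n × Fin n => (L x.1 x.2).order).bddBelow
  exact ⟨m, fun i j p hp => HahnSeries.coeff_eq_zero_of_lt_order
    (hp.trans_le (hm ⟨(i, j), rfl⟩))⟩

theorem coeff_defect {A B : Matrix (Fin n) (Fin n) (LaurentSeries S)} {N m : ℤ} {s : Finset ℤ}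
    (hs : Finset.Icc m (N - m) ⊆ s) (hA : ∀ i j, ∀ p < m, (A i j).coeff p = 0)
    (hB : ∀ i j, ∀ p < m, (B i j).coeff p = 0) (u v : ℂ) (i j k l : Fin n) :
    (defect q u v A B i j k l).coeff N
      = ∑ p ∈ s, defect q u v (coeffMatrix A p) (coeffMatrix B (N - p)) i j k l := by
  simp only [defect, HahnSeries.coeff_sub, HahnSeries.coeff_add, HahnSeries.coeff_smul,
    coeff_mul_eq_sum hs (hA _ _) (hB _ _), coeff_mul_eq_sum' hs (hA _ _) (hB _ _),
    Finset.smul_sum, Finset.sum_sub_distrib, Finset.sum_add_distrib, Matrix.map_apply]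

theorem coeffMatrix_formalShift (ε : ℤˣ) (L : Matrix (Fin n) (Fin n) (LaurentSeries S)) (s : ℕ)
    (p : ℤ) :
    coeffMatrix (formalShift q ε L s) p = ((q ^ (2 * s)) ^ (ε : ℤ)) ^ p • coeffMatrix L p := rfl

theorem RLLFormal.defect_add (hq : q ≠ 0) {ε : ℤˣ}
    {L : Matrix (Fin n) (Fin n) (LaurentSeries S)} (h : RLLFormal q ε L) (p r : ℤ)
    (i j k l : Fin n) :
    defect q 1 0 (coeffMatrix L (p - ε)) (coeffMatrix L r) i j k l
      + defect q 0 1 (coeffMatrix L p) (coeffMatrix L (r - ε)) i j k l = 0 := by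
  -- `RLLFormal` is indexed by exponents of z and w, while the series have formal variable z^ε;
  -- since ε² = 1, multiplying by ε converts one index into the other.
  have h1 := congrArg (fun X => q • X (i, k) (j, l)) (h (ε * p) (ε * r))
  simp only [Matrix.add_apply, smul_add, smul_Rnum_mul_apply hq, smul_mul_Rnum_apply hq, coeff12,
    coeff21, kronecker_one_mul_apply, one_kronecker_mul_apply, zCoeff, Matrix.map_apply] at h1
  have hε : (ε : ℤ) * ε = 1 := by rw [← Units.val_mul, Int.units_mul_self, Units.val_one]
  have e1 : ∀ p : ℤ, (ε : ℤ) * (ε * p) = p := fun p => by rw [← mul_assoc, hε, one_mul]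
  have e2 : ∀ p : ℤ, (ε : ℤ) * (ε * p - 1) = p - ε := fun p => by rw [mul_sub, e1, mul_one]
  simp only [e1, e2] at h1
  rw [← sub_eq_zero] at h1
  rw [← h1]
  simp only [defect, Matrix.map_apply]
  abel

theorem zpow_zpow_sub_units {c : ℂ} (hc : c ≠ 0) (ε : ℤˣ) (p : ℤ) :
    c * (c ^ (ε : ℤ)) ^ (p - ε) = (c ^ (ε : ℤ)) ^ p := by
  have hε : (ε : ℤ) * ε = 1 := by rw [← Units.val_mul, Int.units_mul_self, Units.val_one]
  rw [zpow_sub₀ (zpow_ne_zero _ hc), ← zpow_mul c ε ε, hε, zpow_one]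
  field_simp

theorem RLLFormal.defect_shift (hq : q ≠ 0) {ε : ℤˣ}
    {L : Matrix (Fin n) (Fin n) (LaurentSeries S)} (h : RLLFormal q ε L) (a b : ℕ) (p r : ℤ)
    (i j k l : Fin n) :
    q ^ (2 * a) • defect q 1 0 (coeffMatrix (formalShift q ε L a) (p - ε))
        (coeffMatrix (formalShift q ε L b) r) i j k l
      + q ^ (2 * b) • defect q 0 1 (coeffMatrix (formalShift q ε L a) p)
        (coeffMatrix (formalShift q ε L b) (r - ε)) i j k l = 0 := by
  simp only [coeffMatrix_formalShift, defect_smul, smul_smul]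
  rw [← mul_assoc, zpow_zpow_sub_units (pow_ne_zero _ hq), mul_left_comm,
    zpow_zpow_sub_units (pow_ne_zero _ hq), ← smul_add, h.defect_add hq, smul_zero]

/-- Puts both matrices into the same variable, as fusion requires. The coefficient at N sums the
two-variable relations along an antidiagonal, a finite sum because all coefficients vanish below
some m. -/
theorem RLLFormal.defect_self (hq : q ≠ 0) {ε : ℤˣ}
    {L : Matrix (Fin n) (Fin n) (LaurentSeries S)} (h : RLLFormal q ε L) (a b : ℕ)
    (i j k l : Fin n) :
    q ^ (2 * a) • defect q 1 0 (formalShift q ε L a) (formalShift q ε L b) i j k l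
      + q ^ (2 * b) • defect q 0 1 (formalShift q ε L a) (formalShift q ε L b) i j k l = 0 := by
  obtain ⟨m, hm⟩ := exists_coeffMatrix_eq_zero L
  have hm' : ∀ s i j, ∀ p < m, (formalShift q ε L s i j).coeff p = 0 := fun s i j p hp => by
    change ((q ^ (2 * s)) ^ (ε : ℤ)) ^ p • (L i j).coeff p = 0
    rw [hm i j p hp, smul_zero]
  have hε : (ε : ℤ) = 1 ∨ (ε : ℤ) = -1 := by
    rcases Int.units_eq_one_or ε with rfl | rfl <;> simp
  ext N
  have hs1 : Finset.Icc m (N - m) ⊆ Finset.Icc (m - 1) (N - m + 1) :=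
    Finset.Icc_subset_Icc (by omega) (by omega)
  -- The two defects have first indices p - ε and p. Widening the interval by one on either side
  -- lets both sums run over the same p.
  have hs2 : Finset.Icc m (N - m) ⊆ (Finset.Icc (m - 1) (N - m + 1)).image (· - (ε : ℤ)) :=
    fun p hp => by
      rw [Finset.mem_Icc] at hp
      exact Finset.mem_image.2 ⟨p + ε, Finset.mem_Icc.2 ⟨by omega, by omega⟩, by omega⟩
  rw [HahnSeries.coeff_add, HahnSeries.coeff_smul, HahnSeries.coeff_smul,
    coeff_defect hs2 (hm' a) (hm' b), coeff_defect hs1 (hm' a) (hm' b),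
    Finset.sum_image fun a _ b _ h => by simpa using h, Finset.smul_sum, Finset.smul_sum,
    ← Finset.sum_add_distrib]
  refine Finset.sum_eq_zero fun p _ => ?_
  have h1 := h.defect_shift hq a b p (N - (p - ε)) i j k l
  rwa [show N - (p - (ε : ℤ)) - ε = N - p by ring] at h1

/-! ### Laurent series in two variables -/

/-- A series in the first of two variables. -/
def firstVar : LaurentSeries S →ₐ[ℂ] LaurentSeries (LaurentSeries S) :=
  { HahnSeries.C with commutes' := fun _ => rfl }

/-- A series in the second of two variables. -/
def secondVar : LaurentSeries S →ₐ[ℂ] LaurentSeries (LaurentSeries S) :=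
  { seriesMap (HahnSeries.C : S →+* LaurentSeries S) with
    commutes' := fun c => HahnSeries.map_C (algebraMap ℂ S c) HahnSeries.C }

theorem coeff_firstVar_mul_secondVar (f g : LaurentSeries S) (p r : ℤ) :
    ((firstVar f * secondVar g).coeff r).coeff p = f.coeff p * g.coeff r := by
  change ((HahnSeries.single 0 f * secondVar g).coeff r).coeff p = _
  rw [HahnSeries.coeff_single_zero_mul]
  exact HahnSeries.coeff_mul_single_zero

theorem coeff_secondVar_mul_firstVar (f g : LaurentSeries S) (p r : ℤ) :
    ((secondVar g * firstVar f).coeff r).coeff p = g.coeff r * f.coeff p := by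
  change ((secondVar g * HahnSeries.single 0 f).coeff r).coeff p = _
  rw [HahnSeries.coeff_mul_single_zero]
  exact HahnSeries.coeff_single_zero_mul

/-- In independent variables each coefficient of the product is a single product of coefficients, so
commuting series have commuting coefficients. -/
theorem commute_coeff_of_commute {f g : LaurentSeries S}
    (h : Commute (firstVar f) (secondVar g)) (a b : ℤ) : Commute (f.coeff a) (g.coeff b) := by
  have h1 := congrArg (fun X => (X.coeff b).coeff a) h.eq
  simp only [coeff_firstVar_mul_secondVar, coeff_secondVar_mul_firstVar] at h1
  exact h1

theorem coeff_defect_firstVar_secondVar (u v : ℂ) (A B : Matrix (Fin n) (Fin n) (LaurentSeries S))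
    (i j k l : Fin n) (p r : ℤ) :
    ((defect q u v (A.map firstVar) (B.map secondVar) i j k l).coeff r).coeff p
      = defect q u v (coeffMatrix A p) (coeffMatrix B r) i j k l := by
  simp only [defect, HahnSeries.coeff_sub, HahnSeries.coeff_add, HahnSeries.coeff_smul,
    Matrix.map_apply, coeff_firstVar_mul_secondVar, coeff_secondVar_mul_firstVar]

/-- Complex Laurent series in two variables. -/
def BiLaurent : Type := LaurentSeries (LaurentSeries ℂ)

-- In a field the units required for fusion are just the nonzero elements.
instance : Field BiLaurent := inferInstanceAs (Field (LaurentSeries (LaurentSeries ℂ)))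

instance : Algebra ℂ BiLaurent := RingHom.toAlgebra
  ((HahnSeries.C : LaurentSeries ℂ →+* LaurentSeries (LaurentSeries ℂ)).comp
    (HahnSeries.C : ℂ →+* LaurentSeries ℂ))

/-- The monomial `z ^ a` in the first variable. -/
def BiLaurent.fst (a : ℤ) : BiLaurent :=
  (HahnSeries.C (HahnSeries.single a 1) : LaurentSeries (LaurentSeries ℂ))

/-- The monomial `w ^ a` in the second variable. -/
def BiLaurent.snd (a : ℤ) : BiLaurent :=
  (HahnSeries.single a 1 : LaurentSeries (LaurentSeries ℂ))

theorem BiLaurent.fst_ne_zero (a : ℤ) : BiLaurent.fst a ≠ 0 :=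
  HahnSeries.C_ne_zero (HahnSeries.single_ne_zero one_ne_zero)

theorem BiLaurent.snd_ne_zero (a : ℤ) : BiLaurent.snd a ≠ 0 :=
  HahnSeries.single_ne_zero (one_ne_zero : (1 : LaurentSeries ℂ) ≠ 0)

/-- As a ≠ 0, the second monomial does not contribute to the coefficient at exponent 0 of the outer
and a of the inner variable, which is α. -/
theorem C_mul_C_sub_ne_zero {a : ℤ} (ha : a ≠ 0) {α β : ℂ} (hα : α ≠ 0) :
    (HahnSeries.C (HahnSeries.C α) * HahnSeries.C (HahnSeries.single a 1)
      - HahnSeries.C (HahnSeries.C β) * HahnSeries.single a 1 :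
        LaurentSeries (LaurentSeries ℂ)) ≠ 0 := by
  intro h
  have h1 := congrArg (fun X => (X.coeff 0).coeff a) h
  simp only [HahnSeries.C_apply, HahnSeries.coeff_sub, HahnSeries.coeff_single_zero_mul,
    HahnSeries.coeff_single_of_ne ha.symm, HahnSeries.coeff_single_same, mul_zero, sub_zero,
    HahnSeries.coeff_zero, mul_one] at h1
  exact hα h1

theorem BiLaurent.fst_sub_snd_ne_zero {a : ℤ} (ha : a ≠ 0) {α β : ℂ} (hα : α ≠ 0) :
    algebraMap ℂ BiLaurent α * BiLaurent.fst a - algebraMap ℂ BiLaurent β * BiLaurent.snd a ≠ 0 :=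
  C_mul_C_sub_ne_zero ha hα

/-- Complex series in two variables as series with coefficients in a `ℂ`-algebra. -/
def scalarSeries (S : Type*) [Ring S] [Algebra ℂ S] :
    BiLaurent →+* LaurentSeries (LaurentSeries S) :=
  seriesMap (seriesMap (algebraMap ℂ S))

theorem scalarSeries_commute (f : BiLaurent) (g : LaurentSeries (LaurentSeries S)) :
    scalarSeries S f * g = g * scalarSeries S f :=
  commute_of_coeff fun _ _ => commute_of_coeff fun _ _ => Algebra.commutes _ _

/-- Series with coefficients in a `ℂ`-algebra form an algebra over the complex ones. -/
instance scalarSeriesAlgebra : Algebra BiLaurent (LaurentSeries (LaurentSeries S)) :=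
  (scalarSeries S).toAlgebra' scalarSeries_commute

theorem scalarSeries_algebraMap (c : ℂ) :
    scalarSeries S (algebraMap ℂ BiLaurent c)
      = algebraMap ℂ (LaurentSeries (LaurentSeries S)) c := by
  change seriesMap (seriesMap (algebraMap ℂ S)) (HahnSeries.C (HahnSeries.C c))
    = HahnSeries.C (HahnSeries.C (algebraMap ℂ S c))
  refine (HahnSeries.map_C _ _).trans (congrArg _ ?_)
  exact HahnSeries.map_C _ _

instance : IsScalarTower ℂ BiLaurent (LaurentSeries (LaurentSeries S)) :=
  IsScalarTower.of_algebraMap_eq fun c => (scalarSeries_algebraMap c).symm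

theorem coeff_fst_smul (a : ℤ) (X : LaurentSeries (LaurentSeries S)) (p r : ℤ) :
    ((BiLaurent.fst a • X).coeff r).coeff p = (X.coeff r).coeff (p - a) := by
  have h : scalarSeries S (BiLaurent.fst a) = HahnSeries.single 0 (HahnSeries.single a 1) := by
    refine (HahnSeries.map_C _ _).trans (congrArg _ ?_)
    refine (HahnSeries.map_single (algebraMap ℂ S).toMonoidWithZeroHom.toZeroHom).trans ?_
    simp
  change ((scalarSeries S (BiLaurent.fst a) * X).coeff r).coeff p = _
  rw [h, HahnSeries.coeff_single_zero_mul, HahnSeries.coeff_single_mul, one_mul]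

theorem coeff_snd_smul (a : ℤ) (X : LaurentSeries (LaurentSeries S)) (r : ℤ) :
    (BiLaurent.snd a • X).coeff r = X.coeff (r - a) := by
  have h : scalarSeries S (BiLaurent.snd a) = HahnSeries.single a 1 := by
    refine (HahnSeries.map_single
      (seriesMap (algebraMap ℂ S)).toMonoidWithZeroHom.toZeroHom).trans ?_
    simp
  change (scalarSeries S (BiLaurent.snd a) * X).coeff r = _
  rw [h, HahnSeries.coeff_single_mul, one_mul]

theorem map_qPowTrace {T : Type*} [Ring T] [Algebra ℂ T] (φ : S →ₐ[ℂ] T)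
    (M : ℕ → Matrix (Fin n) (Fin n) S) (k : ℕ) :
    qPowTrace q (fun s => (M s).map φ) k = φ (qPowTrace q M k) := by
  have h : qPow q (fun s => (M s).map φ) k = (qPow q M k).map φ := by
    induction k with
    | zero => exact (Matrix.map_one φ (map_zero φ) (map_one φ)).symm
    | succ k ih =>
      rw [qPow, ih]
      ext i j
      simp [qPow, qMul]
  rw [qPowTrace, h]
  exact (AddMonoidHom.map_trace (φ : S →+ T) _).symm

theorem map_antisymmTrace {T : Type*} [Ring T] [Algebra ℂ T] (φ : S →ₐ[ℂ] T)
    (M : ℕ → Matrix (Fin n) (Fin n) S) (k : ℕ) :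
    antisymmTrace q (fun s => (M s).map φ) k = φ (antisymmTrace q M k) := by
  have h1 : scalar T (qAntisymm n k q) = (scalar S (qAntisymm n k q)).map φ := by
    ext I J
    simp [scalar]
  have h2 : ∀ s : Fin k, leg s ((M s).map φ) = (φ : S →+* T).mapMatrix (leg s (M s)) := fun s => by
    ext I J
    simp only [leg, Matrix.of_apply, RingHom.mapMatrix_apply, Matrix.map_apply]
    split_ifs <;> simp
  have h3 : (List.ofFn fun s : Fin k => leg s ((M s).map φ)).prod
      = (φ : S →+* T).mapMatrix (List.ofFn fun s : Fin k => leg s (M s)).prod := by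
    rw [map_list_prod, List.map_ofFn]
    congr 2
    funext s
    exact h2 s
  rw [antisymmTrace, h1, h3]
  change ((φ : S →+* T).mapMatrix (scalar S (qAntisymm n k q)) * _).trace = _
  rw [← map_mul]
  exact (AddMonoidHom.map_trace (φ : S →+ T) _).symm

/-- `commute_of_RLL` is applied to L(z) and L(w) in independent variables over the field
`BiLaurent`. Relations between different variables come from `defect_shift`, those within one
variable from `defect_self`. -/
theorem commute_coeff_of_RLLFormal (hq : q ≠ 0) {ε : ℤˣ}
    {L : Matrix (Fin n) (Fin n) (LaurentSeries S)} (h : RLLFormal q ε L) (k l : ℕ) (a b : ℤ) :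
    Commute ((formalI q ε L k).coeff a) ((formalI q ε L l).coeff b) ∧
      Commute ((formalI q ε L k).coeff a) ((formalT q ε L l).coeff b) := by
  have hα : ∀ i, algebraMap ℂ BiLaurent (q ^ (2 * i)) ≠ 0 := fun i =>
    (map_ne_zero _).2 (pow_ne_zero _ hq)
  have hnext : ∀ (X : BiLaurent) (i : ℕ),
      algebraMap ℂ BiLaurent (q ^ (2 * (i + 1))) * X
        = algebraMap ℂ _ q ^ 2 * (algebraMap ℂ _ (q ^ (2 * i)) * X) := fun X i => by
    simp only [map_pow]
    ring
  have hself : ∀ (φ : LaurentSeries S →ₐ[ℂ] LaurentSeries (LaurentSeries S))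
      (X : BiLaurent) (i : ℕ),
      RLL (algebraMap ℂ BiLaurent q) (algebraMap ℂ _ (q ^ (2 * i)) * X)
        (algebraMap ℂ _ (q ^ (2 * (i + 1))) * X) ((formalShift q ε L i).map φ)
        ((formalShift q ε L (i + 1)).map φ) := fun φ X i => by
    refine RLL_of_defect X fun i₁ j₁ k₁ l₁ => ?_
    rw [map_defect, map_defect, ← map_smul, ← map_smul, ← map_add, h.defect_self hq, map_zero]
  have key := commute_of_RLL (T := LaurentSeries (LaurentSeries S))
    (K := BiLaurent) (k := k) (l := l) hq
    (M := fun s => (formalShift q ε L s).map firstVar)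
    (N := fun s => (formalShift q ε L s).map secondVar)
    -- The formal variable x stands for z^ε, so z itself is x^ε.
    (u := fun i => algebraMap ℂ _ (q ^ (2 * i)) * BiLaurent.fst ε)
    (v := fun i => algebraMap ℂ _ (q ^ (2 * i)) * BiLaurent.snd ε)
    (fun i _ => (mul_ne_zero (hα i) (BiLaurent.fst_ne_zero _)).isUnit)
    (fun i _ => (mul_ne_zero (hα i) (BiLaurent.snd_ne_zero _)).isUnit)
    (fun i _ => hnext _ i) (fun i _ => hnext _ i)
    (fun _ i _ => hself _ _ i) (fun _ i _ => hself _ _ i)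
    (fun i _ j _ => ?_) (fun i _ j _ => ?_)
  · simp only [map_qPowTrace, map_antisymmTrace] at key
    exact ⟨commute_coeff_of_commute key.1 a b, commute_coeff_of_commute key.2 a b⟩
  · refine (mul_ne_zero ?_ ?_).isUnit
    · rw [← mul_assoc, ← map_pow, ← map_mul]
      exact BiLaurent.fst_sub_snd_ne_zero (Units.ne_zero ε) (mul_ne_zero (pow_ne_zero _ hq) (pow_ne_zero _ hq))
    · rw [← mul_assoc, ← map_pow, ← map_mul]
      exact BiLaurent.fst_sub_snd_ne_zero (Units.ne_zero ε) (pow_ne_zero _ hq)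
  · refine (RLL_iff_defect _ _ _ _).2 fun i₁ j₁ k₁ l₁ => ?_
    rw [mul_smul, mul_smul, algebraMap_smul, algebraMap_smul]
    ext r p
    have h1 := h.defect_shift hq i j p r i₁ j₁ k₁ l₁
    simp only [← coeff_defect_firstVar_secondVar] at h1
    simp only [HahnSeries.coeff_add, HahnSeries.coeff_smul, HahnSeries.coeff_zero]
    rw [← h1]
    congr 2
    · exact coeff_fst_smul (ε : ℤ) _ p r
    · exact congrArg (fun X : LaurentSeries S => X.coeff p)
        (coeff_snd_smul (ε : ℤ) _ r)

end Formal

end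

end QLax

theorem mainTheorem5 {𝓡 : Type*} [Ring 𝓡] [Algebra ℂ 𝓡] (n : ℕ) (q : ℂ) (hq : q ≠ 0) :
    -- formal Laurent series in `z` or in `z⁻¹`: all coefficients commute
    (∀ (ε : ℤˣ) (L : Matrix (Fin n) (Fin n) (LaurentSeries 𝓡)), QLax.RLLFormal q ε L →
      ∀ k l : ℕ, 0 < k → 0 < l → ∀ a b : ℤ,
        Commute ((QLax.formalI q ε L k).coeff a) ((QLax.formalI q ε L l).coeff b) ∧
        Commute ((QLax.formalI q ε L k).coeff a) ((QLax.formalT q ε L l).coeff b)) ∧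
    -- arbitrary functions of a complex parameter, where the `R`-matrices are regular, invertible
    (∀ (D : Set ℂ) (L : ℂ → Matrix (Fin n) (Fin n) 𝓡), (0 : ℂ) ∉ D → QLax.RLLOn q D L →
      ∀ k l : ℕ, 0 < k → 0 < l → ∀ z w : ℂ,
        (∀ i < k, q ^ (2 * i) * z ∈ D) → (∀ j < l, q ^ (2 * j) * w ∈ D) →
        (∀ s : ℤ, -(l : ℤ) ≤ s → s ≤ k → w ≠ q ^ (2 * s) * z) →
        Commute (QLax.I q L k z) (QLax.I q L l w) ∧
        Commute (QLax.I q L k z) (QLax.t q L l w)) ∧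
    -- continuous functions of a complex parameter: all values of the parameters
    (∀ [TopologicalSpace 𝓡] [IsTopologicalRing 𝓡] [T2Space 𝓡]
      (D : Set ℂ) (L : ℂ → Matrix (Fin n) (Fin n) 𝓡), IsOpen D → (0 : ℂ) ∉ D →
      ContinuousOn L D → QLax.RLLOn q D L →
      ∀ k l : ℕ, 0 < k → 0 < l → ∀ z w : ℂ,
        (∀ i < k, q ^ (2 * i) * z ∈ D) → (∀ j < l, q ^ (2 * j) * w ∈ D) →
        Commute (QLax.I q L k z) (QLax.I q L l w) ∧
        Commute (QLax.I q L k z) (QLax.t q L l w)) :=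
  ⟨fun _ _ h k l _ _ a b => QLax.commute_coeff_of_RLLFormal hq h k l a b,
    fun _ _ h0 h _ _ _ _ _ _ hz hw hzw => QLax.commute_of_RLLOn hq h0 h hz hw hzw,
    fun _ _ hD h0 hL h _ _ _ _ _ _ hz hw => QLax.commute_of_continuousOn hq hD h0 hL h hz hw⟩
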